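/- Let $M$ be a smooth manifold, $(A,\rho,[\![\cdot,\cdot]\!])$ a (real) Lie algebroid over $M$, and $E\to M$ a smooth real vector bundle, both of finite rank. *Conventions.* A covariant differential operator on $E$ with symbol $X\in\mathfrak X(M)$ is an $\mathbb R$-linear map $\ell:\Gamma(E)\to\Gamma(E)$ with $\ell(f\zeta)=f\,\ell(\zeta)+X(f)\,\zeta$ for all $f\in C^\infty(M)$, $\zeta\in\Gamma(E)$. An $\mathbb R$-linear connection of $A$ on $E$ is an $\mathbb R$-linear map $\nabla$, $a\mapsto\nabla_a$, from $\Gamma(A)$ to covariant differential operators on $E$ such that $\nabla_a$ has symbol $\rho\circ a$; neither $C^\infty(M)$-linearity nor locality in $a$ is required. Its curvature is $R^\nabla_{a,b}=[\nabla_a,\nabla_b]-\nabla_{[\![a,b]\!]}\in\Gamma(\operatorname{End}E)$. For $p\ge 1$ the Chern character form is the $\mathbb R$-multilinear alternating $2p$-form on $\Gamma(A)$ with values in $C^\infty(M)$ $$\operatorname{ch}_p(\nabla)(a_1,\dots,a_{2p})=\frac1{2^p}\sum_{\tau\in S_{2p}}\operatorname{sgn}(\tau)\,\operatorname{Tr}\bigl(R^\nabla_{a_{\tau(1)},a_{\tau(2)}}\circ\cdots\circ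 R^\nabla_{a_{\tau(2p-1)},a_{\tau(2p)}}\bigr).$$ For an $\mathbb R$-multilinear alternating $n$-form $\eta$ on $\Gamma(A)$ with values in $C^\infty(M)$, $$(d_{A,\mathbb R}\eta)(a_1,\dots,a_{n+1})=\sum_{i=1}^{n+1}(-1)^{i+1}(\rho\circ a_i)\bigl(\eta(a_1,\dots\hat\imath\dots,a_{n+1})\bigr)+\sum_{i<j}(-1)^{i+j}\eta([\![a_i,a_j]\!],a_1,\dots\hat\imath\dots\hat\jmath\dots,a_{n+1}).$$ Let $\nabla^0,\dots,\nabla^k$ be $\mathbb R$-linear connections of $A$ on $E$, $k\ge1$. For $u\in\mathbb R^k$ and $a\in\Gamma(A)$ let $(u,a)$ denote the section $(t,x)\mapsto(u,a(x))$ of the product Lie algebroid $T\mathbb R^k\times A$ over $\mathbb R^k\times M$; these sections form the Lie algebra $\mathbb R^k\times\Gamma(A)$ with bracket $[(u,a),(v,b)]=(0,[\![a,b]\!])$, acting on $C^\infty(\mathbb R^k\times M)$ through the anchor. The affine combination $\nabla^{\mathrm{aff}}$ of $\nabla^0,\dots,\nabla^k$ is the $\mathbb R$-linear connection of this Lie algebra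 on $\operatorname{pr}_2^*E\to\mathbb R^k\times M$ which, for a section $S$ of $\operatorname{pr}_2^*E$ with restrictions $S_t=S(t,\cdot)\in\Gamma(E)$, is given by $$(\nabla^{\mathrm{aff}}_{(u,a)}S)(t,\cdot)=\sum_{j=1}^k u_j\,\frac{\partial S}{\partial t_j}(t,\cdot)+\Bigl(1-\sum_{i=1}^kt_i\Bigr)\nabla^0_aS_t+\sum_{i=1}^kt_i\,\nabla^i_aS_t .$$ (Its curvature and $\operatorname{ch}_p(\nabla^{\mathrm{aff}})$, with values in $C^\infty(\mathbb R^k\times M)$, are given by the formulas above.) With $\Delta^k=\{t\in\mathbb R^k: t_i\ge0,\ \sum_i t_i\le1\}$ put, for $0<k\le2p$, $$\operatorname{cs}_p(\nabla^0,\dots,\nabla^k)(a_1,\dots,a_{2p-k})=\int_{\Delta^k}\operatorname{ch}_p(\nabla^{\mathrm{aff}})\Bigl(\tfrac{\partial}{\partial t_1},\dots,\tfrac{\partial}{\partial t_k},a_1,\dots,a_{2p-k}\Bigr)\Big|_{(t,\cdot)}\,dt_1\cdots dt_k ,$$ where $\partial/\partial t_j=(e_j,0)$ and $a_i$ stands for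 $(0,a_i)$, and put $\operatorname{cs}_p(\nabla^0)=\operatorname{ch}_p(\nabla^0)$. **Theorem (Chern–Simons formula for Lie algebroids and $\mathbb R$-linear connections).** For all integers $k,p$ with $0<k\le2p$ and all $\mathbb R$-linear connections $\nabla^0,\dots,\nabla^k$ of $A$ on $E$, $$(-1)^{k+1}\,d_{A,\mathbb R}\bigl(\operatorname{cs}_p(\nabla^0,\dots,\nabla^k)\bigr)=\sum_{j=0}^k(-1)^j\operatorname{cs}_p(\nabla^0,\dots,\widehat{\nabla^j},\dots,\nabla^k).$$ Moreover $d_{A,\mathbb R}\bigl(\operatorname{ch}_p(\nabla^0)\bigr)=0$ for every $p\ge1$ and every $\mathbb R$-linear connection $\nabla^0$ of $A$ on $E$. -/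

import Mathlib

open Bundle
open scoped Manifold ContDiff Topology

set_option linter.unusedSectionVars false

noncomputable section

namespace LieAlgebroidCS

section Sections

variable {V : Type*} [NormedAddCommGroup V] [NormedSpace ℝ V] {H : Type*} [TopologicalSpace H]
  {I : ModelWithCorners ℝ V H} {M : Type*} [TopologicalSpace M] [ChartedSpace H M]
  {F : Type*} [NormedAddCommGroup F] [NormedSpace ℝ F] {E : M → Type*}
  [TopologicalSpace (TotalSpace F E)] [∀ x, AddCommGroup (E x)] [∀ x, Module ℝ (E x)]
  [∀ x, TopologicalSpace (E x)] [FiberBundle F E] [VectorBundle ℝ F E]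

instance sectionSMul : SMul C^∞⟮I, M; ℝ⟯ Cₛ^∞⟮I; F, E⟯ :=
  ⟨fun f s => ⟨(f : M → ℝ) • (s : ∀ x, E x), f.contMDiff.smul_section s.contMDiff⟩⟩

@[simp] theorem section_smul_apply (f : C^∞⟮I, M; ℝ⟯) (s : Cₛ^∞⟮I; F, E⟯) (x : M) :
    (f • s) x = f x • s x := rfl

/-- Pointwise multiplication makes `Γ(E)` a module over `C^∞(M)`. -/
instance sectionModule : Module C^∞⟮I, M; ℝ⟯ Cₛ^∞⟮I; F, E⟯ where
  one_smul s := by ext x; exact one_smul ℝ (s x)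
  mul_smul f g s := by ext x; exact mul_smul (f x) (g x) (s x)
  smul_zero f := by ext x; exact smul_zero (f x)
  smul_add f s t := by ext x; exact smul_add (f x) (s x) (t x)
  add_smul f g s := by ext x; exact add_smul (f x) (g x) (s x)
  zero_smul s := by ext x; exact zero_smul ℝ (s x)

instance sectionTower : IsScalarTower ℝ C^∞⟮I, M; ℝ⟯ Cₛ^∞⟮I; F, E⟯ :=
  ⟨fun c f s => by ext x; exact mul_smul c (f x) (s x)⟩

instance sectionComm : SMulCommClass C^∞⟮I, M; ℝ⟯ ℝ Cₛ^∞⟮I; F, E⟯ :=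
  ⟨fun f c s => by ext x; exact smul_comm (f x) c (s x)⟩

instance sectionComm' : SMulCommClass ℝ C^∞⟮I, M; ℝ⟯ Cₛ^∞⟮I; F, E⟯ :=
  ⟨fun c f s => by ext x; exact smul_comm c (f x) (s x)⟩

end Sections

section VectorFields

variable {V : Type*} [NormedAddCommGroup V] [NormedSpace ℝ V] {H : Type*} [TopologicalSpace H]
  (I : ModelWithCorners ℝ V H) (M : Type*) [TopologicalSpace M] [ChartedSpace H M]
  [IsManifold I ∞ M]

instance : IsManifold I 1 M := IsManifold.of_le (n := ∞) (by simp)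

/-- Smooth vector fields on `M`. -/
abbrev VectorFields : Type _ := Cₛ^∞⟮I; V, (TangentSpace I : M → Type _)⟯

variable {I M}

theorem contMDiff_vectorField_apply (X : VectorFields I M) (f : C^∞⟮I, M; ℝ⟯) :
    ContMDiff I 𝓘(ℝ, ℝ) ∞ (fun x => (mfderiv I 𝓘(ℝ, ℝ) f x (X x) : ℝ)) := by
  have h1 : ContMDiff I.tangent 𝓘(ℝ, ℝ).tangent ∞ (tangentMap I 𝓘(ℝ, ℝ) f) :=
    f.contMDiff.contMDiff_tangentMap (by simp)
  have h2 := h1.comp X.contMDiff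
  intro x
  have h3 := (contMDiffAt_totalSpace.1 (h2 x)).2
  simpa [tangentMap, Function.comp_def] using! h3

/-- The derivation `f ↦ X(f)` of `C^∞(M)` given by a smooth vector field `X`. -/
def vectorFieldDerivation (X : VectorFields I M) : Derivation ℝ C^∞⟮I, M; ℝ⟯ C^∞⟮I, M; ℝ⟯ :=
  Derivation.mk'
    { toFun := fun f => ⟨fun x => mfderiv I 𝓘(ℝ, ℝ) f x (X x), contMDiff_vectorField_apply X f⟩
      map_add' := fun f g => by
        ext x
        change (mfderiv I 𝓘(ℝ, ℝ) ((f : M → ℝ) + (g : M → ℝ)) x (X x) : ℝ) = _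
        rw [mfderiv_add f.mdifferentiableAt g.mdifferentiableAt]
        rfl
      map_smul' := fun c f => by
        ext x
        change (mfderiv I 𝓘(ℝ, ℝ) (c • (f : M → ℝ)) x (X x) : ℝ) = _
        rw [const_smul_mfderiv f.mdifferentiableAt]
        rfl }
    (fun f g => by
      ext x
      change (mfderiv I 𝓘(ℝ, ℝ) ((f : M → ℝ) * (g : M → ℝ)) x (X x) : ℝ) = _
      rw [(f.mdifferentiableAt.hasMFDerivAt.mul g.mdifferentiableAt.hasMFDerivAt).mfderiv]
      rfl)

theorem vectorFieldDerivation_apply (X : VectorFields I M) (f : C^∞⟮I, M; ℝ⟯) (x : M) :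
    vectorFieldDerivation X f x = mfderiv I 𝓘(ℝ, ℝ) f x (X x) := rfl

/-- `X ↦ (f ↦ X(f))` as a linear map. -/
def vectorFieldDerivationₗ :
    VectorFields I M →ₗ[ℝ] Derivation ℝ C^∞⟮I, M; ℝ⟯ C^∞⟮I, M; ℝ⟯ where
  toFun := vectorFieldDerivation
  map_add' X Y := by
    ext f x
    exact map_add (mfderiv I 𝓘(ℝ, ℝ) f x) (X x) (Y x)
  map_smul' c X := by
    ext f x
    exact map_smul (mfderiv I 𝓘(ℝ, ℝ) f x) c (X x)

end VectorFields

section LocalFrames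

variable {V : Type*} [NormedAddCommGroup V] [NormedSpace ℝ V] [FiniteDimensional ℝ V]
  {H : Type*} [TopologicalSpace H]
  (I : ModelWithCorners ℝ V H) {M : Type*} [TopologicalSpace M] [ChartedSpace H M]
  [IsManifold I ∞ M] [T2Space M]
  (F : Type*) [NormedAddCommGroup F] [NormedSpace ℝ F] [FiniteDimensional ℝ F] (E : M → Type*)
  [TopologicalSpace (TotalSpace F E)] [∀ x, AddCommGroup (E x)] [∀ x, Module ℝ (E x)]
  [∀ x, TopologicalSpace (E x)] [FiberBundle F E] [VectorBundle ℝ F E]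
  [ContMDiffVectorBundle ∞ F E I]

/-- Near any point there are finitely many global sections `e i` and smooth fibrewise linear
functionals `c i` such that `∑ c i(v) e i = v`. -/
theorem exists_local_frame (x₀ : M) : ∃ (n : ℕ) (ψ : C^∞⟮I, M; ℝ⟯)
    (e : Fin n → Cₛ^∞⟮I; F, E⟯) (c : Fin n → ∀ x, E x →ₗ[ℝ] ℝ),
    (∀ i, ContMDiff (I.prod 𝓘(ℝ, F)) 𝓘(ℝ, ℝ) ∞ (fun v : TotalSpace F E => c i v.1 v.2)) ∧
    (∀ x v, ψ x • v = ∑ i, c i x v • e i x) ∧ (∀ᶠ x in 𝓝 x₀, ψ x = 1) := by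
  set t := trivializationAt F E x₀
  have ht : t.baseSet ∈ 𝓝 x₀ :=
    t.open_baseSet.mem_nhds (FiberBundle.mem_baseSet_trivializationAt F E x₀)
  obtain ⟨χ, hχ⟩ : ∃ χ : SmoothBumpFunction I x₀, tsupport χ ⊆ t.baseSet := by
    obtain ⟨χ, -, h⟩ := (SmoothBumpFunction.nhds_basis_tsupport (I := I) x₀).mem_iff.1 ht
    exact ⟨χ, h⟩
  set b := Module.finBasis ℝ F
  refine ⟨Module.finrank ℝ F, ⟨fun x => χ x * χ x, χ.contMDiff.mul χ.contMDiff⟩,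
    fun i => ⟨(χ : M → ℝ) • t.localFrame b i,
      ContMDiffOn.smul_section_of_tsupport (χ.contMDiff.contMDiffOn) t.open_baseSet hχ
        (t.contMDiffOn_localFrame_baseSet (n := ∞) b i)⟩,
    fun i x => χ x • (b.coord i ∘ₗ t.linearMapAt ℝ x), fun i => ?_, fun x v => ?_, ?_⟩
  · have hproj : ContMDiff (I.prod 𝓘(ℝ, F)) I ∞ (Bundle.TotalSpace.proj : TotalSpace F E → M) :=
      Bundle.contMDiff_proj E
    refine contMDiff_of_contMDiffOn_union_of_isOpen (s := t.source)
      (t := Bundle.TotalSpace.proj ⁻¹' (tsupport χ)ᶜ) ?_ ?_ ?_ t.open_source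
      ((isClosed_tsupport χ).isOpen_compl.preimage hproj.continuous)
    · have h1 : ContMDiffOn (I.prod 𝓘(ℝ, F)) 𝓘(ℝ, F) ∞ (fun v : TotalSpace F E => (t v).2)
          t.source := contMDiff_snd.comp_contMDiffOn (t.contMDiffOn (IB := I) (n := ∞))
      have h2 : ContMDiffOn (I.prod 𝓘(ℝ, F)) 𝓘(ℝ, ℝ) ∞
          (fun v : TotalSpace F E => χ v.1 * b.coord i (t v).2) t.source := by
        refine ((χ.contMDiff.comp hproj).contMDiffOn).mul ?_
        exact ((b.coord i).toContinuousLinearMap.contMDiff).comp_contMDiffOn h1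
      refine h2.congr fun v hv => ?_
      have hv' : v.1 ∈ t.baseSet := t.mem_source.1 hv
      simp [t.linearMapAt_def_of_mem hv']
    · refine (contMDiffOn_const (c := (0 : ℝ))).congr fun v hv => ?_
      have : χ v.1 = 0 := image_eq_zero_of_notMem_tsupport hv
      simp [this]
    · ext v
      simp only [Set.mem_union, Set.mem_univ, iff_true, t.mem_source, Set.mem_preimage,
        Set.mem_compl_iff]
      by_cases h : v.1 ∈ tsupport χ
      · exact Or.inl (hχ h)
      · exact Or.inr h
  · by_cases hx : x ∈ t.baseSet
    · have key : v = ∑ i, (b.coord i (t.linearMapAt ℝ x v)) • t.localFrame b i x := by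
        apply (t.linearEquivAt ℝ x hx).injective
        rw [map_sum]
        simp only [map_smul, t.localFrame_apply_of_mem_baseSet b hx]
        have h1 : t.linearEquivAt ℝ x hx v = t.linearMapAt ℝ x v := by
          simp [t.linearMapAt_def_of_mem hx]
        simp only [Bundle.Trivialization.basisAt, Module.Basis.map_apply,
          LinearEquiv.apply_symm_apply]
        rw [h1]
        exact (b.sum_repr _).symm
      change (χ x * χ x) • v = ∑ i, (χ x * b.coord i (t.linearMapAt ℝ x v)) •
        (χ x • t.localFrame b i x)
      conv_lhs => rw [key]
      rw [Finset.smul_sum]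
      refine Finset.sum_congr rfl fun i _ => ?_
      simp only [smul_smul]
      congr 1
      ring
    · have : χ x = 0 := image_eq_zero_of_notMem_tsupport fun h => hx (hχ h)
      change (χ x * χ x) • v = ∑ i, (χ x * b.coord i (t.linearMapAt ℝ x v)) •
        (χ x • t.localFrame b i x)
      simp [this]
  · filter_upwards [χ.eventuallyEq_one] with x hx
    change χ x * χ x = 1
    rw [hx]; simp

variable {I F E}

theorem exists_section_eq (x : M) (v : E x) : ∃ s : Cₛ^∞⟮I; F, E⟯, s x = v := by
  obtain ⟨n, ψ, e, c, hc, hψ, h1⟩ := exists_local_frame I F E x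
  have hx : ψ x = 1 := h1.self_of_nhds
  refine ⟨∑ i, c i x v • e i, ?_⟩
  have h3 : (∑ i, c i x v • e i) x = ∑ i, (c i x v • e i) x :=
    (congrFun (map_sum (ContMDiffSection.coeAddHom I F ∞ E) (fun i => c i x v • e i)
      Finset.univ) x).trans (Finset.sum_apply _ _ _)
  rw [h3]
  have := hψ x v
  rw [hx, one_smul] at this
  exact this.symm

/-- A `C^∞(M)`-linear operator on `Γ(E)` is given by a linear endomorphism of each fibre. -/
theorem exists_fiberMap (φ : Module.End C^∞⟮I, M; ℝ⟯ Cₛ^∞⟮I; F, E⟯) (x : M) :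
    ∃! T : Module.End ℝ (E x), ∀ s : Cₛ^∞⟮I; F, E⟯, T (s x) = (φ s) x := by
  obtain ⟨n, ψ, e, c, hc, hψ, h1⟩ := exists_local_frame I F E x
  have hx : ψ x = 1 := h1.self_of_nhds
  refine ⟨∑ i, (c i x).smulRight (φ (e i) x), fun s => ?_, fun T hT => ?_⟩
  · let a : Fin n → C^∞⟮I, M; ℝ⟯ := fun i => ⟨fun y => c i y (s y), (hc i).comp s.contMDiff⟩
    have h : ψ • s = ∑ i, a i • e i := by
      ext y
      have : (∑ i, a i • e i) y = ∑ i, (a i • e i) y := by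
        exact (congrFun (map_sum (ContMDiffSection.coeAddHom I F ∞ E) (fun i => a i • e i)
          Finset.univ) y).trans (Finset.sum_apply _ _ _)
      rw [this]
      exact hψ y (s y)
    have h2 := congrArg (fun u => (φ u) x) h
    simp only [map_smul, map_sum] at h2
    have h3 : (∑ i, a i • φ (e i)) x = ∑ i, (a i • φ (e i)) x :=
      (congrFun (map_sum (ContMDiffSection.coeAddHom I F ∞ E) (fun i => a i • φ (e i))
          Finset.univ) x).trans (Finset.sum_apply _ _ _)
    rw [h3, section_smul_apply, hx, one_smul] at h2
    rw [h2, LinearMap.sum_apply]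
    exact Finset.sum_congr rfl fun i _ => rfl
  · ext v
    have hv := hψ x v
    rw [hx, one_smul] at hv
    conv_lhs => rw [hv]
    simp [map_sum, hT]

/-- The endomorphism of the fibre `E x` given by a `C^∞(M)`-linear operator on `Γ(E)`, i.e. by a
section of `End E`. -/
def fiberMap (φ : Module.End C^∞⟮I, M; ℝ⟯ Cₛ^∞⟮I; F, E⟯) (x : M) : Module.End ℝ (E x) :=
  (exists_fiberMap φ x).choose

theorem fiberMap_apply (φ : Module.End C^∞⟮I, M; ℝ⟯ Cₛ^∞⟮I; F, E⟯) (x : M)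
    (s : Cₛ^∞⟮I; F, E⟯) : fiberMap φ x (s x) = (φ s) x :=
  (exists_fiberMap φ x).choose_spec.1 s

theorem fiberMap_unique {φ : Module.End C^∞⟮I, M; ℝ⟯ Cₛ^∞⟮I; F, E⟯} {x : M}
    {T : Module.End ℝ (E x)} (hT : ∀ s : Cₛ^∞⟮I; F, E⟯, T (s x) = (φ s) x) :
    fiberMap φ x = T :=
  ((exists_fiberMap φ x).choose_spec.2 T hT).symm

theorem contMDiff_fiberTrace (φ : Module.End C^∞⟮I, M; ℝ⟯ Cₛ^∞⟮I; F, E⟯) :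
    ContMDiff I 𝓘(ℝ, ℝ) ∞ (fun x => LinearMap.trace ℝ (E x) (fiberMap φ x)) := by
  intro x₀
  obtain ⟨n, ψ, e, c, hc, hψ, h1⟩ := exists_local_frame I F E x₀
  have hs : ContMDiff I 𝓘(ℝ, ℝ) ∞ (fun x => ∑ i, c i x (φ (e i) x)) :=
    contMDiff_finsetSum fun i _ => (hc i).comp (φ (e i)).contMDiff
  refine (hs x₀).congr_of_eventuallyEq ?_
  filter_upwards [h1] with x hx
  have hfd : FiniteDimensional ℝ (E x) := VectorBundle.finiteDimensional ℝ F E x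
  have : fiberMap φ x = ∑ i, (c i x).smulRight (φ (e i) x) := by
    ext v
    have hv := hψ x v
    rw [hx, one_smul] at hv
    conv_lhs => rw [hv]
    simp [map_sum, fiberMap_apply]
  rw [this, map_sum]
  simp

/-- The fibrewise trace `Γ(End E) → C^∞(M)`. -/
def fiberTrace : Module.End C^∞⟮I, M; ℝ⟯ Cₛ^∞⟮I; F, E⟯ →ₗ[ℝ] C^∞⟮I, M; ℝ⟯ where
  toFun φ := ⟨fun x => LinearMap.trace ℝ (E x) (fiberMap φ x), contMDiff_fiberTrace φ⟩
  map_add' φ θ := by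
    ext x
    have : fiberMap (φ + θ) x = fiberMap φ x + fiberMap θ x :=
      fiberMap_unique fun s => by simp [fiberMap_apply]
    change LinearMap.trace ℝ (E x) (fiberMap (φ + θ) x) = _
    rw [this, map_add]
    rfl
  map_smul' c φ := by
    ext x
    have : fiberMap (c • φ) x = c • fiberMap φ x :=
      fiberMap_unique fun s => by simp [fiberMap_apply]
    change LinearMap.trace ℝ (E x) (fiberMap (c • φ) x) = _
    rw [this, map_smul]
    rfl

end LocalFrames

section Algebroids

variable {V : Type*} [NormedAddCommGroup V] [NormedSpace ℝ V] {H : Type*} [TopologicalSpace H]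
  (I : ModelWithCorners ℝ V H) {M : Type*} [TopologicalSpace M] [ChartedSpace H M]
  [IsManifold I ∞ M]
  (F : Type*) [NormedAddCommGroup F] [NormedSpace ℝ F] (A : M → Type*)
  [TopologicalSpace (TotalSpace F A)] [∀ x, AddCommGroup (A x)] [∀ x, Module ℝ (A x)]
  [∀ x, TopologicalSpace (A x)] [FiberBundle F A] [VectorBundle ℝ F A]

/-- A smooth vector bundle morphism `A → TM` over the identity of `M`. -/
structure AnchorMap where
  toFun : ∀ x, A x →ₗ[ℝ] TangentSpace I x
  contMDiff_toFun : ContMDiff (I.prod 𝓘(ℝ, F)) I.tangent ∞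
    (fun v : TotalSpace F A => (⟨v.1, toFun v.1 v.2⟩ : TangentBundle I M))

variable {I F A} in
/-- The map `a ↦ ρ ∘ a` from sections of `A` to vector fields. -/
def AnchorMap.onSections (ρ : AnchorMap I F A) : Cₛ^∞⟮I; F, A⟯ →ₗ[ℝ] VectorFields I M where
  toFun a := ⟨fun x => ρ.toFun x (a x), ρ.contMDiff_toFun.comp a.contMDiff⟩
  map_add' a b := by ext x; exact map_add (ρ.toFun x) (a x) (b x)
  map_smul' c a := by ext x; exact map_smul (ρ.toFun x) c (a x)

/-- A Lie algebroid structure on the vector bundle `A` over `M`: an anchor `A → TM` and a real Lie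
bracket on `Γ(A)` with `[a, f b] = f [a, b] + (ρ ∘ a)(f) b`. -/
class LieAlgebroid where
  anchor : AnchorMap I F A
  bracket : Cₛ^∞⟮I; F, A⟯ →ₗ[ℝ] Cₛ^∞⟮I; F, A⟯ →ₗ[ℝ] Cₛ^∞⟮I; F, A⟯
  bracket_self : ∀ a, bracket a a = 0
  jacobi : ∀ a b c, bracket a (bracket b c) = bracket (bracket a b) c + bracket b (bracket a c)
  leibniz : ∀ (a b : Cₛ^∞⟮I; F, A⟯) (f : C^∞⟮I, M; ℝ⟯),
    bracket a (f • b) = f • bracket a b + vectorFieldDerivation (anchor.onSections a) f • b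

variable {I F A} [LieAlgebroid I F A]

instance : LieRing Cₛ^∞⟮I; F, A⟯ where
  bracket a b := LieAlgebroid.bracket a b
  add_lie a b c := by
    change LieAlgebroid.bracket (a + b) c = _
    rw [map_add]
    rfl
  lie_add a b c := by
    change LieAlgebroid.bracket a (b + c) = _
    exact map_add _ _ _
  lie_self a := LieAlgebroid.bracket_self a
  leibniz_lie a b c := LieAlgebroid.jacobi a b c

instance : LieAlgebra ℝ Cₛ^∞⟮I; F, A⟯ where
  lie_smul c a b := by
    change LieAlgebroid.bracket a (c • b) = _
    exact map_smul _ _ _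

variable (I F A) in
/-- The map `a ↦ (f ↦ (ρ ∘ a)(f))`. -/
def anchorDerivation : Cₛ^∞⟮I; F, A⟯ →ₗ[ℝ] Derivation ℝ C^∞⟮I, M; ℝ⟯ C^∞⟮I, M; ℝ⟯ :=
  vectorFieldDerivationₗ ∘ₗ (LieAlgebroid.anchor (I := I) (F := F) (A := A)).onSections

theorem lie_smul_section (a b : Cₛ^∞⟮I; F, A⟯) (f : C^∞⟮I, M; ℝ⟯) :
    ⁅a, f • b⁆ = f • ⁅a, b⁆ + anchorDerivation I F A a f • b :=
  LieAlgebroid.leibniz a b f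

variable [FiniteDimensional ℝ V] [T2Space M] [FiniteDimensional ℝ F] [ContMDiffVectorBundle ∞ F A I]

theorem anchorDerivation_lie (a b : Cₛ^∞⟮I; F, A⟯) :
    anchorDerivation I F A ⁅a, b⁆ = ⁅anchorDerivation I F A a, anchorDerivation I F A b⁆ := by
  set r := anchorDerivation I F A
  have key : ∀ (f : C^∞⟮I, M; ℝ⟯) (c : Cₛ^∞⟮I; F, A⟯), (r ⁅a, b⁆ f - ⁅r a, r b⁆ f) • c = 0 := by
    intro f c
    have h := lie_lie a b (f • c)
    rw [lie_smul_section, lie_smul_section, lie_smul_section, lie_add, lie_add, lie_smul_section,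
      lie_smul_section, lie_smul_section, lie_smul_section, lie_lie, smul_sub] at h
    rw [Derivation.commutator_apply, sub_smul, sub_smul]
    have h' : r ⁅a, b⁆ f • c = (r a) ((r b) f) • c - (r b) ((r a) f) • c := by
      have := sub_eq_zero.2 h
      rw [← sub_eq_zero, ← this]
      abel
    rw [h', sub_self]
  ext f x
  by_cases hx : ∃ c : Cₛ^∞⟮I; F, A⟯, c x ≠ 0
  · obtain ⟨c, hc⟩ := hx
    have h := congrArg (fun s : Cₛ^∞⟮I; F, A⟯ => s x) (key f c)
    have h2 : ((r ⁅a, b⁆ f) x - (⁅r a, r b⁆ f) x) • c x = 0 := h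
    exact sub_eq_zero.1 ((smul_eq_zero.1 h2).resolve_right hc)
  · push Not at hx
    have hF : Subsingleton F := by
      have : Subsingleton (A x) := ⟨fun v w => by
        obtain ⟨s, rfl⟩ := exists_section_eq (I := I) (F := F) x v
        obtain ⟨t, rfl⟩ := exists_section_eq (I := I) (F := F) x w
        rw [hx, hx]⟩
      exact (VectorBundle.continuousLinearEquivAt ℝ F A x).symm.injective.subsingleton
    have hs : ∀ s : Cₛ^∞⟮I; F, A⟯, s = 0 := fun s => by
      ext y
      exact (VectorBundle.continuousLinearEquivAt ℝ F A y).injective (Subsingleton.elim _ _)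
    rw [hs ⁅a, b⁆, hs a, map_zero, zero_lie (r b)]

variable (I F A) in
/-- The homomorphism of Lie algebras `Γ(A) → 𝔛(M)`, `a ↦ ρ ∘ a`, with vector fields acting as
derivations of `C^∞(M)`. -/
def anchorHom : Cₛ^∞⟮I; F, A⟯ →ₗ⁅ℝ⁆ Derivation ℝ C^∞⟮I, M; ℝ⟯ C^∞⟮I, M; ℝ⟯ where
  toLinearMap := anchorDerivation I F A
  map_lie' := anchorDerivation_lie _ _

end Algebroids

section Connections

variable {C L : Type*} [CommRing C] [Algebra ℝ C] [LieRing L] [LieAlgebra ℝ L]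
  (ρ : L →ₗ⁅ℝ⁆ Derivation ℝ C C)

/-- The formula for the differential `d` on `ℝ`-multilinear alternating forms on `L` with values in
`C`, for a Lie algebra `L` acting on `C` by derivations through `ρ`. With indices starting at `0`,
it is `∑ i, (-1)^i ρ(a i)(η(.., î, ..)) + ∑ i < j, (-1)^(i+j) η([a i, a j], .., î, .., ĵ, ..)`;
the pairs `i < j` are written as `(i.castSucc, j.succ)` with `i ≤ j`. -/
def differentialFun : {n : ℕ} → (L [⋀^Fin n]→ₗ[ℝ] C) → (Fin (n + 1) → L) → C
  | 0, η, a => ρ (a 0) (η ![])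
  | n + 1, η, a =>
    (∑ i : Fin (n + 2), (-1 : ℤ) ^ (i : ℕ) • ρ (a i) (η (i.removeNth a))) +
    ∑ i : Fin (n + 1), ∑ j ≥ i, (-1 : ℤ) ^ ((i.castSucc : ℕ) + (j.succ : ℕ)) •
      η (Matrix.vecCons ⁅a i.castSucc, a j.succ⁆ (j.removeNth (i.castSucc.removeNth a)))

theorem differentialFun_eq {n : ℕ} (η : L [⋀^Fin n]→ₗ[ℝ] C) :
    ∃ θ : L [⋀^Fin (n + 1)]→ₗ[ℝ] C, ∀ a, differentialFun ρ η a = θ a := by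
  have key : ∀ {n : ℕ} (η : L [⋀^Fin n]→ₗ[ℝ] C), ∃ D : L →ₗ[ℝ] L [⋀^Fin n]→ₗ[ℝ] C,
      ∀ a v, D a v = ρ a (η v) := fun η =>
    ⟨{ toFun := fun a => ((ρ a : Derivation ℝ C C) : C →ₗ[ℝ] C).compAlternatingMap η
       map_add' := fun a b => by ext v; simp
       map_smul' := fun c a => by ext v; simp }, fun _ _ => rfl⟩
  obtain ⟨D, hD⟩ := key η
  cases n with
  | zero =>
    refine ⟨AlternatingMap.alternatizeUncurryFin D, ?_⟩
    intro a
    simp only [differentialFun, AlternatingMap.alternatizeUncurryFin_apply, hD]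
    simp [Subsingleton.elim (![] : Fin 0 → L) (Fin.tail a)]
  | succ n =>
    let B : L →ₗ[ℝ] L →ₗ[ℝ] L [⋀^Fin n]→ₗ[ℝ] C :=
      LinearMap.mk₂ ℝ (fun a b => η.curryLeft ⁅a, b⁆) (by simp) (by simp) (by simp) (by simp)
    have hB : ∀ a b v, B a b v = η (Matrix.vecCons ⁅a, b⁆ v) := fun _ _ _ => rfl
    refine ⟨AlternatingMap.alternatizeUncurryFin D - (1 / 2 : ℝ) •
      AlternatingMap.alternatizeUncurryFin (AlternatingMap.alternatizeUncurryFinLM ∘ₗ B), ?_⟩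
    intro a
    rw [AlternatingMap.sub_apply, AlternatingMap.smul_apply,
      AlternatingMap.alternatizeUncurryFin_alternatizeUncurryFinLM_comp_apply,
      AlternatingMap.alternatizeUncurryFin_apply]
    simp only [differentialFun, hD, sub_eq_add_neg, Finset.smul_sum, ← Finset.sum_neg_distrib]
    refine congrArg₂ _ rfl (Finset.sum_congr rfl fun i _ => Finset.sum_congr rfl fun j _ => ?_)
    have h : B (a j.succ) (a i.castSucc) (j.removeNth (i.castSucc.removeNth a)) =
        -B (a i.castSucc) (a j.succ) (j.removeNth (i.castSucc.removeNth a)) := by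
      change η.curryLeft ⁅a j.succ, a i.castSucc⁆ _ = -η.curryLeft ⁅a i.castSucc, a j.succ⁆ _
      rw [← lie_skew, map_neg, AlternatingMap.neg_apply]
    rw [h, neg_neg, ← hB, ← two_smul ℝ, smul_comm (1 / 2 : ℝ), smul_smul]
    norm_num [pow_succ, ← add_assoc]

/-- The differential `d` on `ℝ`-multilinear alternating forms on `L` with values in `C`. -/
def differential {n : ℕ} (η : L [⋀^Fin n]→ₗ[ℝ] C) : L [⋀^Fin (n + 1)]→ₗ[ℝ] C where
  toFun := differentialFun ρ η
  map_update_add' v i a b := by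
    obtain ⟨θ, h⟩ := differentialFun_eq ρ η
    simp only [h]
    convert θ.map_update_add v i a b
  map_update_smul' v i c a := by
    obtain ⟨θ, h⟩ := differentialFun_eq ρ η
    simp only [h]
    convert θ.map_update_smul v i c a
  map_eq_zero_of_eq' v i j hv hij := by
    obtain ⟨θ, h⟩ := differentialFun_eq ρ η
    rw [h]
    exact θ.map_eq_zero_of_eq v hv hij

variable {G : Type*} [AddCommGroup G] [Module ℝ G] [Module C G]

/-- `ℓ` is a derivative operator on the `C`-module `G` with symbol `X`:
`ℓ(f s) = f ℓ(s) + X(f) s`. For `C = C^∞(M)` and `G = Γ(E)` these are the covariant differential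
operators in `E`. -/
def IsCDO (ℓ : Module.End ℝ G) (X : Derivation ℝ C C) : Prop :=
  ∀ (f : C) (s : G), ℓ (f • s) = f • ℓ s + X f • s

variable (G) in
/-- An `ℝ`-linear connection of `L` on the `C`-module `G`: an `ℝ`-linear map `∇` from `L` to the
covariant differential operators on `G` such that `∇ a` has symbol `ρ a`. No linearity over `C` and
no locality in `a` is required. -/
structure RConnection where
  toFun : L →ₗ[ℝ] Module.End ℝ G
  isCDO : ∀ a, IsCDO (toFun a) (ρ a)

variable {ρ}

/-- The curvature `R a b = [∇ a, ∇ b] - ∇ [a, b]`, a `C`-linear operator on `G`. -/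
def RConnection.curvature (D : RConnection ρ G) (a b : L) : Module.End C G where
  toFun s := D.toFun a (D.toFun b s) - D.toFun b (D.toFun a s) - D.toFun ⁅a, b⁆ s
  map_add' s t := by simp only [map_add]; abel
  map_smul' f s := by
    simp only [D.isCDO _ _ _, map_add, LieHom.map_lie, Derivation.commutator_apply, sub_smul,
      smul_sub, RingHom.id_apply]
    abel

variable [SMulCommClass C ℝ G] [SMulCommClass ℝ C G] [IsScalarTower ℝ C G]

theorem RConnection.curvature_add_left (D : RConnection ρ G) (a a' b : L) :
    D.curvature (a + a') b = D.curvature a b + D.curvature a' b := by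
  ext s
  simp only [curvature, LinearMap.coe_mk, AddHom.coe_mk, LinearMap.add_apply, map_add, add_lie]
  abel

theorem RConnection.curvature_add_right (D : RConnection ρ G) (a b b' : L) :
    D.curvature a (b + b') = D.curvature a b + D.curvature a b' := by
  ext s
  simp only [curvature, LinearMap.coe_mk, AddHom.coe_mk, LinearMap.add_apply, map_add, lie_add]
  abel

theorem RConnection.curvature_smul_left (D : RConnection ρ G) (c : ℝ) (a b : L) :
    D.curvature (c • a) b = c • D.curvature a b := by
  ext s
  simp only [curvature, LinearMap.coe_mk, AddHom.coe_mk, LinearMap.smul_apply, map_smul, smul_lie,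
    smul_sub]

theorem RConnection.curvature_smul_right (D : RConnection ρ G) (c : ℝ) (a b : L) :
    D.curvature a (c • b) = c • D.curvature a b := by
  ext s
  simp only [curvature, LinearMap.coe_mk, AddHom.coe_mk, LinearMap.smul_apply, map_smul, lie_smul,
    smul_sub]

theorem RConnection.curvature_update (D : RConnection ρ G) (p : ℕ) (m : Fin (2 * p))
    (a : Fin (2 * p) → L) :
    ∃ (j : Fin p) (K : L →ₗ[ℝ] Module.End C G), ∀ x,
      (fun i : Fin p => D.curvature (Function.update a m x ⟨2 * i, by omega⟩)
        (Function.update a m x ⟨2 * i + 1, by omega⟩)) =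
      Function.update (fun i : Fin p => D.curvature (a ⟨2 * i, by omega⟩)
        (a ⟨2 * i + 1, by omega⟩)) j (K x) := by
  have hj : (m : ℕ) / 2 < p := by omega
  have hne : ∀ i : Fin p, i ≠ ⟨(m : ℕ) / 2, hj⟩ → (i : ℕ) ≠ (m : ℕ) / 2 := fun i h h' =>
    h (Fin.ext h')
  rcases Nat.even_or_odd' (m : ℕ) with ⟨c, hc | hc⟩
  · refine ⟨⟨(m : ℕ) / 2, hj⟩,
      { toFun := fun x => D.curvature x (a ⟨2 * ((m : ℕ) / 2) + 1, by omega⟩)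
        map_add' := fun _ _ => D.curvature_add_left _ _ _
        map_smul' := fun _ _ => D.curvature_smul_left _ _ _ }, fun x => ?_⟩
    ext1 i
    by_cases hi : i = ⟨(m : ℕ) / 2, hj⟩
    · subst hi
      have h1 : (⟨2 * ((m : ℕ) / 2), by omega⟩ : Fin (2 * p)) = m := Fin.ext (by simp; omega)
      have h2 : (⟨2 * ((m : ℕ) / 2) + 1, by omega⟩ : Fin (2 * p)) ≠ m := fun h => by
        have := congrArg Fin.val h
        simp at this
        omega
      simp only [Function.update_self, LinearMap.coe_mk, AddHom.coe_mk]
      rw [Function.update_of_ne h2, h1, Function.update_self]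
    · have := hne i hi
      rw [Function.update_of_ne hi, Function.update_of_ne, Function.update_of_ne]
      all_goals
        intro h
        have := congrArg Fin.val h
        simp at this
        omega
  · refine ⟨⟨(m : ℕ) / 2, hj⟩,
      { toFun := fun x => D.curvature (a ⟨2 * ((m : ℕ) / 2), by omega⟩) x
        map_add' := fun _ _ => D.curvature_add_right _ _ _
        map_smul' := fun _ _ => D.curvature_smul_right _ _ _ }, fun x => ?_⟩
    ext1 i
    by_cases hi : i = ⟨(m : ℕ) / 2, hj⟩
    · subst hi
      have h1 : (⟨2 * ((m : ℕ) / 2) + 1, by omega⟩ : Fin (2 * p)) = m := Fin.ext (by simp; omega)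
      have h2 : (⟨2 * ((m : ℕ) / 2), by omega⟩ : Fin (2 * p)) ≠ m := fun h => by
        have := congrArg Fin.val h
        simp at this
        omega
      simp only [Function.update_self, LinearMap.coe_mk, AddHom.coe_mk]
      rw [Function.update_of_ne h2, h1, Function.update_self]
    · have := hne i hi
      rw [Function.update_of_ne hi, Function.update_of_ne, Function.update_of_ne]
      all_goals
        intro h
        have := congrArg Fin.val h
        simp at this
        omega

/-- The map `(a_1, ..., a_2p) ↦ R(a_1, a_2) ∘ ... ∘ R(a_{2p-1}, a_2p)`. -/
def RConnection.curvatureProd (D : RConnection ρ G) (p : ℕ) :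
    MultilinearMap ℝ (fun _ : Fin (2 * p) => L) (Module.End C G) where
  toFun a := (List.ofFn fun i : Fin p =>
    D.curvature (a ⟨2 * i, by omega⟩) (a ⟨2 * i + 1, by omega⟩)).prod
  map_update_add' {inst} a m x y := by
    obtain rfl : inst = instDecidableEqFin _ := Subsingleton.elim _ _
    obtain ⟨j, K, h⟩ := D.curvature_update p m a
    simp only [← MultilinearMap.mkPiAlgebraFin_apply (R := ℝ), h, map_add,
      MultilinearMap.map_update_add]
  map_update_smul' {inst} a m c x := by
    obtain rfl : inst = instDecidableEqFin _ := Subsingleton.elim _ _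
    obtain ⟨j, K, h⟩ := D.curvature_update p m a
    simp only [← MultilinearMap.mkPiAlgebraFin_apply (R := ℝ), h, map_smul,
      MultilinearMap.map_update_smul]

/-- The power `R^p`, an alternating `2p`-form on `L` with values in the `C`-linear operators:
`R^p(a_1, ..., a_2p) = 2^(-p) ∑ τ, sgn τ • R(a_τ1, a_τ2) ∘ ... ∘ R(a_τ(2p-1), a_τ(2p))`. -/
def RConnection.curvaturePow (D : RConnection ρ G) (p : ℕ) :
    L [⋀^Fin (2 * p)]→ₗ[ℝ] Module.End C G :=
  (1 / 2 ^ p : ℝ) • MultilinearMap.alternatization (D.curvatureProd p)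

/-- The Chern character form `Tr(R^p)` with respect to a trace `Tr` on the `C`-linear operators. -/
def RConnection.chernForm (Tr : Module.End C G →ₗ[ℝ] C) (D : RConnection ρ G) (p : ℕ) :
    L [⋀^Fin (2 * p)]→ₗ[ℝ] C :=
  Tr.compAlternatingMap (D.curvaturePow p)

end Connections

section Cylinder

variable (k : ℕ) {V : Type*} [NormedAddCommGroup V] [NormedSpace ℝ V]
  {M : Type*} [TopologicalSpace M] [ChartedSpace V M]

variable (V M) in
/-- The projection `ℝ^k × M → M`. -/
abbrev pr₂ : C^∞⟮𝓘(ℝ, Fin k → ℝ).prod 𝓘(ℝ, V), (Fin k → ℝ) × M; 𝓘(ℝ, V), M⟯ :=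
  ContMDiffMap.snd

variable {k}

/-- The value at time `t` of a smooth function on `ℝ^k × M`. -/
def slice (f : C^∞⟮𝓘(ℝ, Fin k → ℝ).prod 𝓘(ℝ, V), (Fin k → ℝ) × M; ℝ⟯) (t : Fin k → ℝ) :
    C^∞⟮𝓘(ℝ, V), M; ℝ⟯ :=
  ⟨fun x => f (t, x), f.contMDiff.comp (contMDiff_const.prodMk contMDiff_id)⟩

/-- The pullback of a smooth function on `M` to `ℝ^k × M`. -/
def pullFun (f : C^∞⟮𝓘(ℝ, V), M; ℝ⟯) :
    C^∞⟮𝓘(ℝ, Fin k → ℝ).prod 𝓘(ℝ, V), (Fin k → ℝ) × M; ℝ⟯ :=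
  ⟨fun p => f p.2, f.contMDiff.comp contMDiff_snd⟩

variable [IsManifold 𝓘(ℝ, V) ∞ M]

/-- The vector field `(t, x) ↦ (u, X x)` on `ℝ^k × M`. -/
def prodVectorField (u : Fin k → ℝ) (X : VectorFields 𝓘(ℝ, V) M) :
    VectorFields (𝓘(ℝ, Fin k → ℝ).prod 𝓘(ℝ, V)) ((Fin k → ℝ) × M) :=
  ⟨fun p => (u, X p.2), by
    have h1 : ContMDiff (𝓘(ℝ, Fin k → ℝ).prod 𝓘(ℝ, V)) 𝓘(ℝ, Fin k → ℝ).tangent ∞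
        (fun p : (Fin k → ℝ) × M => (⟨p.1, u⟩ : TangentBundle 𝓘(ℝ, Fin k → ℝ) (Fin k → ℝ))) := by
      intro p
      rw [contMDiffAt_totalSpace]
      refine ⟨contMDiffAt_fst, ?_⟩
      simpa using! contMDiffAt_const
    have h2 := X.contMDiff.comp
      (contMDiff_snd (I := 𝓘(ℝ, Fin k → ℝ)) (J := 𝓘(ℝ, V)) (M := Fin k → ℝ) (N := M) (n := ∞))
    exact (contMDiff_equivTangentBundleProd_symm (n := ∞) (I := 𝓘(ℝ, Fin k → ℝ))
      (I' := 𝓘(ℝ, V)) (M := Fin k → ℝ) (M' := M)).comp (h1.prodMk h2)⟩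

theorem prodVectorField_apply (u : Fin k → ℝ) (X : VectorFields 𝓘(ℝ, V) M)
    (f : C^∞⟮𝓘(ℝ, Fin k → ℝ).prod 𝓘(ℝ, V), (Fin k → ℝ) × M; ℝ⟯) (t : Fin k → ℝ) (x : M) :
    vectorFieldDerivation (prodVectorField u X) f (t, x) =
      fderiv ℝ (fun τ => f (τ, x)) t u + vectorFieldDerivation X (slice f t) x := by
  rw [vectorFieldDerivation_apply, vectorFieldDerivation_apply]
  rw [← mfderiv_eq_fderiv]
  exact mfderiv_prod_eq_add_apply (f.mdifferentiableAt)

theorem mfderiv_eq_fderiv_chart {f : M → ℝ} {x : M} (hf : MDifferentiableAt 𝓘(ℝ, V) 𝓘(ℝ, ℝ) f x)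
    (v : V) : mfderiv 𝓘(ℝ, V) 𝓘(ℝ, ℝ) f x v =
      fderiv ℝ (fun y => f ((extChartAt 𝓘(ℝ, V) x).symm y)) (extChartAt 𝓘(ℝ, V) x x) v := by
  have h := hf.mfderiv
  simp only [writtenInExtChartAt, extChartAt_model_space_eq_id, PartialEquiv.refl_coe,
    Function.id_comp, modelWithCornersSelf_coe, Set.range_id, fderivWithin_univ] at h
  exact congrArg (fun T : V →L[ℝ] ℝ => T v) h

theorem contDiffAt_chart (f : C^∞⟮𝓘(ℝ, Fin k → ℝ).prod 𝓘(ℝ, V), (Fin k → ℝ) × M; ℝ⟯)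
    (t : Fin k → ℝ) (x : M) {y : V} (hy : y ∈ (extChartAt 𝓘(ℝ, V) x).target) :
    ContDiffAt ℝ ∞ (fun q : (Fin k → ℝ) × V => f (q.1, (extChartAt 𝓘(ℝ, V) x).symm q.2))
      (t, y) := by
  have h0 : ContMDiffAt 𝓘(ℝ, V) 𝓘(ℝ, V) ∞ (extChartAt 𝓘(ℝ, V) x).symm y :=
    (contMDiffOn_extChartAt_symm x).contMDiffAt ((isOpen_extChartAt_target x).mem_nhds hy)
  have h : ContMDiffAt (𝓘(ℝ, Fin k → ℝ).prod 𝓘(ℝ, V)) 𝓘(ℝ, ℝ) ∞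
      (fun q : (Fin k → ℝ) × V => f (q.1, (extChartAt 𝓘(ℝ, V) x).symm q.2)) (t, y) :=
    f.contMDiff.contMDiffAt.comp (t, y) (contMDiffAt_fst.prodMk (h0.comp (t, y) contMDiffAt_snd))
  generalize (fun q : (Fin k → ℝ) × V => f (q.1, (extChartAt 𝓘(ℝ, V) x).symm q.2)) = g at h ⊢
  rw [← modelWithCornersSelf_prod, chartedSpaceSelf_prod] at h
  exact contMDiffAt_iff_contDiffAt.1 h

theorem two_le_infty : (2 : WithTop ℕ∞) ≤ ∞ := WithTop.coe_le_coe.2 (le_top : (2 : ℕ∞) ≤ ⊤)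

theorem fderiv_time_comm (f : C^∞⟮𝓘(ℝ, Fin k → ℝ).prod 𝓘(ℝ, V), (Fin k → ℝ) × M; ℝ⟯)
    (u v : Fin k → ℝ) (t : Fin k → ℝ) (x : M) :
    fderiv ℝ (fun τ => fderiv ℝ (fun σ => f (σ, x)) τ v) t u =
      fderiv ℝ (fun τ => fderiv ℝ (fun σ => f (σ, x)) τ u) t v := by
  have hf : ContDiff ℝ ∞ (fun σ : Fin k → ℝ => f (σ, x)) := by
    rw [← contMDiff_iff_contDiff]
    exact f.contMDiff.comp (contMDiff_id.prodMk contMDiff_const)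
  have hs : IsSymmSndFDerivAt ℝ (fun σ : Fin k → ℝ => f (σ, x)) t :=
    hf.contDiffAt.isSymmSndFDerivAt (by simpa using two_le_infty)
  have hd : DifferentiableAt ℝ (fderiv ℝ (fun σ : Fin k → ℝ => f (σ, x))) t :=
    ((hf.fderiv_right (m := 1) (by rw [one_add_one_eq_two]; exact two_le_infty)).differentiable (by simp)) t
  have h1 : ∀ w, fderiv ℝ (fun τ => fderiv ℝ (fun σ => f (σ, x)) τ w) t =
      (fderiv ℝ (fderiv ℝ (fun σ : Fin k → ℝ => f (σ, x))) t).flip w := fun w => by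
    rw [fderiv_clm_apply hd (differentiableAt_const w)]
    simp
  rw [h1, h1]
  exact hs u v

theorem fderiv_time_vectorField_comm
    (f : C^∞⟮𝓘(ℝ, Fin k → ℝ).prod 𝓘(ℝ, V), (Fin k → ℝ) × M; ℝ⟯)
    (u : Fin k → ℝ) (X : VectorFields 𝓘(ℝ, V) M) (t : Fin k → ℝ) (x : M) :
    fderiv ℝ (fun τ => vectorFieldDerivation X (slice f τ) x) t u =
      vectorFieldDerivation X (slice (vectorFieldDerivation (prodVectorField u 0) f) t) x := by
  set φ := extChartAt 𝓘(ℝ, V) x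
  set w : V := X x
  set g : (Fin k → ℝ) × V → ℝ := fun q => f (q.1, φ.symm q.2)
  set y₀ := φ x
  have hg : ∀ τ, ∀ y ∈ φ.target, ContDiffAt ℝ ∞ g (τ, y) := fun τ y hy => contDiffAt_chart f τ x hy
  have hy₀ : y₀ ∈ φ.target := mem_extChartAt_target x
  have ht : φ.target ∈ 𝓝 y₀ := (isOpen_extChartAt_target x).mem_nhds hy₀
  have hgd : ∀ τ, ∀ y ∈ φ.target, HasFDerivAt g (fderiv ℝ g (τ, y)) (τ, y) := fun τ y hy =>
    ((hg τ y hy).differentiableAt (by simp)).hasFDerivAt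
  have hd : HasFDerivAt (fderiv ℝ g) (fderiv ℝ (fderiv ℝ g) (t, y₀)) (t, y₀) :=
    (((hg t y₀ hy₀).fderiv_right (m := 1) (by rw [one_add_one_eq_two]; exact two_le_infty)).differentiableAt (by simp)).hasFDerivAt
  have hs : IsSymmSndFDerivAt ℝ g (t, y₀) := (hg t y₀ hy₀).isSymmSndFDerivAt (by simpa using two_le_infty)
  have h1 : ∀ τ, vectorFieldDerivation X (slice f τ) x = fderiv ℝ g (τ, y₀) (0, w) := by
    intro τ
    refine (mfderiv_eq_fderiv_chart (V := V) (slice f τ).mdifferentiableAt w).trans ?_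
    have : HasFDerivAt (fun y => g (τ, y)) ((fderiv ℝ g (τ, y₀)).comp
        (ContinuousLinearMap.inr ℝ (Fin k → ℝ) V)) y₀ :=
      (hgd τ y₀ hy₀).comp y₀ (hasFDerivAt_prodMk_right τ y₀)
    exact congrArg (fun T : V →L[ℝ] ℝ => T w) this.fderiv
  have h2 : ∀ y ∈ φ.target, vectorFieldDerivation (prodVectorField u 0) f (t, φ.symm y) =
      fderiv ℝ g (t, y) (u, 0) := by
    intro y hy
    rw [prodVectorField_apply, vectorFieldDerivation_apply]
    have : HasFDerivAt (fun τ => g (τ, y)) ((fderiv ℝ g (t, y)).comp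
        (ContinuousLinearMap.inl ℝ (Fin k → ℝ) V)) t :=
      HasFDerivAt.comp (g := g) (f := fun e => (e, y)) t (hgd t y hy) (hasFDerivAt_prodMk_left t y)
    have h3 := congrArg (fun T : (Fin k → ℝ) →L[ℝ] ℝ => T u) this.fderiv
    refine (congrArg₂ (· + ·) h3 (map_zero _)).trans ?_
    simp
  have h3 : fderiv ℝ (fun τ => vectorFieldDerivation X (slice f τ) x) t u =
      fderiv ℝ (fderiv ℝ g) (t, y₀) (u, 0) (0, w) := by
    have h1' : (fun τ => vectorFieldDerivation X (slice f τ) x) =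
        fun τ => fderiv ℝ g (τ, y₀) (0, w) := funext h1
    rw [h1']
    have h : HasFDerivAt (fun τ => fderiv ℝ g (τ, y₀)) ((fderiv ℝ (fderiv ℝ g) (t, y₀)).comp
        (ContinuousLinearMap.inl ℝ (Fin k → ℝ) V)) t :=
      HasFDerivAt.comp t hd (hasFDerivAt_prodMk_left t y₀)
    rw [fderiv_clm_apply h.differentiableAt (differentiableAt_const _), h.fderiv]
    simp
  have h4 : vectorFieldDerivation X (slice (vectorFieldDerivation (prodVectorField u 0) f) t) x =
      fderiv ℝ (fderiv ℝ g) (t, y₀) (0, w) (u, 0) := by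
    refine (mfderiv_eq_fderiv_chart (V := V)
      (slice (vectorFieldDerivation (prodVectorField u 0) f) t).mdifferentiableAt w).trans ?_
    have h5 : (fun y => slice (vectorFieldDerivation (prodVectorField u 0) f) t (φ.symm y))
        =ᶠ[𝓝 y₀] fun y => fderiv ℝ g (t, y) (u, 0) := by
      filter_upwards [ht] with y hy using h2 y hy
    have h : HasFDerivAt (fun y => fderiv ℝ g (t, y)) ((fderiv ℝ (fderiv ℝ g) (t, y₀)).comp
        (ContinuousLinearMap.inr ℝ (Fin k → ℝ) V)) y₀ :=
      HasFDerivAt.comp y₀ hd (hasFDerivAt_prodMk_right t y₀)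
    have h6 := h5.fderiv_eq (𝕜 := ℝ)
    rw [fderiv_clm_apply h.differentiableAt (differentiableAt_const _), h.fderiv] at h6
    refine (congrArg (fun T : V →L[ℝ] ℝ => T w) h6).trans ?_
    simp
  rw [h3, h4]
  exact hs _ _

end Cylinder

section ProductAlgebra

variable (k : ℕ) {V : Type*} [NormedAddCommGroup V] [NormedSpace ℝ V] [FiniteDimensional ℝ V]
  {M : Type*} [TopologicalSpace M] [ChartedSpace V M] [IsManifold 𝓘(ℝ, V) ∞ M] [T2Space M]
  (F : Type*) [NormedAddCommGroup F] [NormedSpace ℝ F] [FiniteDimensional ℝ F] (A : M → Type*)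
  [TopologicalSpace (TotalSpace F A)] [∀ x, AddCommGroup (A x)] [∀ x, Module ℝ (A x)]
  [∀ x, TopologicalSpace (A x)] [FiberBundle F A] [VectorBundle ℝ F A]
  [ContMDiffVectorBundle ∞ F A 𝓘(ℝ, V)] [LieAlgebroid 𝓘(ℝ, V) F A]

/-- The constant vector fields on `ℝ^k` form a Lie algebra `ℝ^k` with trivial bracket. -/
instance constVectorFieldsLieRing : LieRing (Fin k → ℝ) where
  bracket _ _ := 0
  add_lie _ _ _ := (add_zero 0).symm
  lie_add _ _ _ := (add_zero 0).symm
  lie_self _ := rfl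
  leibniz_lie _ _ _ := (add_zero 0).symm

instance constVectorFieldsLieAlgebra : LieAlgebra ℝ (Fin k → ℝ) where
  lie_smul c _ _ := (smul_zero c).symm

/-- The anchor of the product Lie algebroid `Tℝ^k × A → ℝ^k × M` on the Lie algebra
`ℝ^k × Γ(A)` of the sections `(t, x) ↦ (u, a x)` with `u ∈ ℝ^k` and `a ∈ Γ(A)`. The bracket of two
of these sections is `[(u, a), (v, b)] = (0, [a, b])`. -/
def prodAnchorHom : (Fin k → ℝ) × Cₛ^∞⟮𝓘(ℝ, V); F, A⟯ →ₗ⁅ℝ⁆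
    Derivation ℝ C^∞⟮𝓘(ℝ, Fin k → ℝ).prod 𝓘(ℝ, V), (Fin k → ℝ) × M; ℝ⟯
      C^∞⟮𝓘(ℝ, Fin k → ℝ).prod 𝓘(ℝ, V), (Fin k → ℝ) × M; ℝ⟯ where
  toFun a := vectorFieldDerivation (prodVectorField a.1
    ((LieAlgebroid.anchor (I := 𝓘(ℝ, V)) (F := F) (A := A)).onSections a.2))
  map_add' a b := by
    ext f ⟨t, x⟩
    simp only [Derivation.add_apply, ContMDiffMap.coe_add, Pi.add_apply, prodVectorField_apply,
      Prod.fst_add, Prod.snd_add, map_add]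
    have : ∀ X Y : VectorFields 𝓘(ℝ, V) M, vectorFieldDerivation (X + Y) =
      vectorFieldDerivation X + vectorFieldDerivation Y := map_add vectorFieldDerivationₗ
    rw [this, Derivation.add_apply, ContMDiffMap.coe_add, Pi.add_apply]
    ring
  map_smul' c a := by
    ext f ⟨t, x⟩
    simp only [Derivation.smul_apply, ContMDiffMap.coe_smul, Pi.smul_apply, prodVectorField_apply,
      Prod.smul_fst, Prod.smul_snd, map_smul, RingHom.id_apply]
    have : ∀ X : VectorFields 𝓘(ℝ, V) M, vectorFieldDerivation (c • X) =
      c • vectorFieldDerivation X := map_smul vectorFieldDerivationₗ c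
    rw [this, Derivation.smul_apply, ContMDiffMap.coe_smul, Pi.smul_apply]
    simp [mul_add]
  map_lie' {a b} := by
    set r := anchorDerivation 𝓘(ℝ, V) F A
    set θ : Cₛ^∞⟮𝓘(ℝ, V); F, A⟯ →ₗ[ℝ] VectorFields 𝓘(ℝ, V) M :=
      (LieAlgebroid.anchor (I := 𝓘(ℝ, V)) (F := F) (A := A)).onSections
    have hr : ∀ c g, vectorFieldDerivation (θ c) g = r c g := fun _ _ => rfl
    have hsplit : ∀ (u : Fin k → ℝ) (X : VectorFields 𝓘(ℝ, V) M)
      (g : C^∞⟮𝓘(ℝ, Fin k → ℝ).prod 𝓘(ℝ, V), (Fin k → ℝ) × M; ℝ⟯) (t : Fin k → ℝ),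
      slice (vectorFieldDerivation (prodVectorField u X) g) t =
        slice (vectorFieldDerivation (prodVectorField u 0) g) t +
          vectorFieldDerivation X (slice g t) := by
      intro u X g t
      ext x
      change vectorFieldDerivation _ _ _ = vectorFieldDerivation _ _ _ + _
      rw [prodVectorField_apply, prodVectorField_apply]
      have : vectorFieldDerivation (0 : VectorFields 𝓘(ℝ, V) M) (slice g t) x = 0 :=
        map_zero (mfderiv 𝓘(ℝ, V) 𝓘(ℝ, ℝ) (slice g t) x)
      rw [this, add_zero]
    have hadd : ∀ (X : VectorFields 𝓘(ℝ, V) M) (g h : C^∞⟮𝓘(ℝ, V), M; ℝ⟯) (x : M),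
        vectorFieldDerivation X (g + h) x =
          vectorFieldDerivation X g x + vectorFieldDerivation X h x := fun X g h x => by
      rw [map_add]; rfl
    have hz : ∀ (u : Fin k → ℝ)
        (g : C^∞⟮𝓘(ℝ, Fin k → ℝ).prod 𝓘(ℝ, V), (Fin k → ℝ) × M; ℝ⟯) (t : Fin k → ℝ) (x : M),
        vectorFieldDerivation (prodVectorField u 0) g (t, x) =
          fderiv ℝ (fun τ => g (τ, x)) t u := fun u g t x => by
      rw [prodVectorField_apply]
      exact (congrArg _ (map_zero (mfderiv 𝓘(ℝ, V) 𝓘(ℝ, ℝ) (slice g t) x))).trans (add_zero _)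
    have key : ∀ (u v : Fin k → ℝ) (X Y : VectorFields 𝓘(ℝ, V) M)
        (g : C^∞⟮𝓘(ℝ, Fin k → ℝ).prod 𝓘(ℝ, V), (Fin k → ℝ) × M; ℝ⟯) (t : Fin k → ℝ) (x : M),
        vectorFieldDerivation (prodVectorField u X)
          (vectorFieldDerivation (prodVectorField v Y) g) (t, x) =
        fderiv ℝ (fun τ => fderiv ℝ (fun σ => g (σ, x)) τ v) t u +
        vectorFieldDerivation Y (slice (vectorFieldDerivation (prodVectorField u 0) g) t) x +
        vectorFieldDerivation X (slice (vectorFieldDerivation (prodVectorField v 0) g) t) x +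
        vectorFieldDerivation X (vectorFieldDerivation Y (slice g t)) x := by
      intro u v X Y g t x
      have hc : ∀ Z : VectorFields (𝓘(ℝ, Fin k → ℝ).prod 𝓘(ℝ, V)) ((Fin k → ℝ) × M),
          DifferentiableAt ℝ (fun τ => vectorFieldDerivation Z g (τ, x)) t := fun Z => by
        have : ContDiff ℝ ∞ (fun σ : Fin k → ℝ => vectorFieldDerivation Z g (σ, x)) := by
          rw [← contMDiff_iff_contDiff]
          exact (vectorFieldDerivation Z g).contMDiff.comp (contMDiff_id.prodMk contMDiff_const)
        exact this.differentiable (by simp) t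
      have h1 := hc (prodVectorField v 0)
      have h2 := hc (prodVectorField v Y)
      simp only [prodVectorField_apply v Y] at h2
      simp only [hz] at h1
      have h3 : DifferentiableAt ℝ (fun τ => vectorFieldDerivation Y (slice g τ) x) t := by
        exact (h2.sub h1).congr_of_eventuallyEq (.of_forall fun τ => (add_sub_cancel_left _ _).symm)
      rw [prodVectorField_apply, hsplit v Y, hadd, ← fderiv_time_vectorField_comm g u Y,
        ← fderiv_time_vectorField_comm g v X]
      simp only [prodVectorField_apply v Y]
      rw [fderiv_fun_add h1 h3]
      simp only [add_apply]
      ring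
    ext f ⟨t, x⟩
    have e := congrArg (fun D => D (slice f t) x) (anchorDerivation_lie (I := 𝓘(ℝ, V)) a.2 b.2)
    simp only [Derivation.commutator_apply] at e ⊢
    change vectorFieldDerivation (prodVectorField 0 (θ ⁅a.2, b.2⁆)) f (t, x) =
      vectorFieldDerivation _ _ (t, x) - vectorFieldDerivation _ _ (t, x)
    rw [key, key, prodVectorField_apply, hr, e, fderiv_time_comm f a.1 b.1]
    simp only [map_zero, zero_add]
    change r a.2 (r b.2 (slice f t)) x - r b.2 (r a.2 (slice f t)) x = _ + r a.2 (r b.2 _) x -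
      (_ + r b.2 (r a.2 _) x)
    ring

end ProductAlgebra

section PullbackSections

variable {k : ℕ} {V : Type*} [NormedAddCommGroup V] [NormedSpace ℝ V]
  {M : Type*} [TopologicalSpace M] [ChartedSpace V M] [IsManifold 𝓘(ℝ, V) ∞ M]
  {F : Type*} [NormedAddCommGroup F] [NormedSpace ℝ F] {E : M → Type*}
  [TopologicalSpace (TotalSpace F E)] [∀ x, AddCommGroup (E x)] [∀ x, Module ℝ (E x)]
  [∀ x, TopologicalSpace (E x)] [FiberBundle F E] [VectorBundle ℝ F E]

instance pullbackAddCommGroup {B B' : Type*} (f : B' → B) (E : B → Type*)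
    [i : ∀ x, AddCommGroup (E x)] (x : B') : AddCommGroup ((f *ᵖ E) x) :=
  inferInstanceAs <| AddCommGroup (E (f x))

variable (k V F E) in
/-- The sections of the pullback of `E` to `ℝ^k × M`. -/
abbrev PullbackSections : Type _ :=
  Cₛ^∞⟮𝓘(ℝ, Fin k → ℝ).prod 𝓘(ℝ, V); F, (pr₂ k V M : (Fin k → ℝ) × M → M) *ᵖ E⟯

theorem contMDiff_pullback_iff (S : ∀ p : (Fin k → ℝ) × M, E p.2) :
    ContMDiff (𝓘(ℝ, Fin k → ℝ).prod 𝓘(ℝ, V)) ((𝓘(ℝ, Fin k → ℝ).prod 𝓘(ℝ, V)).prod 𝓘(ℝ, F)) ∞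
      (fun p => (TotalSpace.mk p (S p) :
        TotalSpace F ((pr₂ k V M : (Fin k → ℝ) × M → M) *ᵖ E))) ↔
    ContMDiff (𝓘(ℝ, Fin k → ℝ).prod 𝓘(ℝ, V)) (𝓘(ℝ, V).prod 𝓘(ℝ, F)) ∞
      (fun p => (⟨p.2, S p⟩ : TotalSpace F E)) := by
  refine forall_congr' fun p => ?_
  rw [contMDiffAt_totalSpace, contMDiffAt_totalSpace]
  exact ⟨fun h => ⟨contMDiffAt_snd, h.2⟩, fun h => ⟨contMDiffAt_id, h.2⟩⟩

/-- The section `S_t` of `E` given by a section `S` of the pullback bundle and `t ∈ ℝ^k`. -/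
def sliceSection (S : PullbackSections k V F E) (t : Fin k → ℝ) : Cₛ^∞⟮𝓘(ℝ, V); F, E⟯ :=
  ⟨fun x => S (t, x),
    ((contMDiff_pullback_iff (E := E) S).1 S.contMDiff).comp (contMDiff_const.prodMk contMDiff_id)⟩

/-- The pullback of a section of `E`. -/
def pullSection (s : Cₛ^∞⟮𝓘(ℝ, V); F, E⟯) : PullbackSections k V F E :=
  ⟨fun p => s p.2, (contMDiff_pullback_iff (E := E) fun p => s p.2).2
    (s.contMDiff.comp contMDiff_snd)⟩

theorem sum_section_apply {V' H' M' : Type*} [NormedAddCommGroup V'] [NormedSpace ℝ V']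
    [TopologicalSpace H'] {I : ModelWithCorners ℝ V' H'} [TopologicalSpace M'] [ChartedSpace H' M']
    {E' : M' → Type*} [TopologicalSpace (TotalSpace F E')] [∀ x, AddCommGroup (E' x)]
    [∀ x, Module ℝ (E' x)] [∀ x, TopologicalSpace (E' x)] [FiberBundle F E'] [VectorBundle ℝ F E']
    {n : ℕ} (s : Fin n → Cₛ^∞⟮I; F, E'⟯) (x : M') : (∑ i, s i) x = ∑ i, s i x :=
  (congrFun (map_sum (ContMDiffSection.coeAddHom I F ∞ E') s Finset.univ) x).trans
    (Finset.sum_apply _ _ _)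

theorem contMDiff_of_local {W : ∀ p : (Fin k → ℝ) × M, E p.2}
    (h : ∀ x₀, ∃ T : PullbackSections k V F E, ∀ᶠ x in 𝓝 x₀, ∀ t, W (t, x) = T (t, x)) :
    ContMDiff (𝓘(ℝ, Fin k → ℝ).prod 𝓘(ℝ, V)) ((𝓘(ℝ, Fin k → ℝ).prod 𝓘(ℝ, V)).prod 𝓘(ℝ, F)) ∞
      (fun p => (TotalSpace.mk p (W p) :
        TotalSpace F ((pr₂ k V M : (Fin k → ℝ) × M → M) *ᵖ E))) := by
  rintro ⟨t₀, x₀⟩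
  obtain ⟨T, hT⟩ := h x₀
  refine (T.contMDiff (t₀, x₀)).congr_of_eventuallyEq ?_
  filter_upwards [(continuous_snd.tendsto (t₀, x₀)).eventually hT] with p hp
  exact congrArg (TotalSpace.mk p) (hp p.1)

variable [FiniteDimensional ℝ V] [T2Space M] [FiniteDimensional ℝ F]
  [ContMDiffVectorBundle ∞ F E 𝓘(ℝ, V)]

theorem exists_coefficients (S : PullbackSections k V F E) (x₀ : M) : ∃ (n : ℕ)
    (ψ : C^∞⟮𝓘(ℝ, V), M; ℝ⟯) (e : Fin n → Cₛ^∞⟮𝓘(ℝ, V); F, E⟯)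
    (c : Fin n → C^∞⟮𝓘(ℝ, Fin k → ℝ).prod 𝓘(ℝ, V), (Fin k → ℝ) × M; ℝ⟯),
    (∀ t, ψ • sliceSection S t = ∑ i, slice (c i) t • e i) ∧ (∀ᶠ x in 𝓝 x₀, ψ x = 1) := by
  obtain ⟨n, ψ, e, c, hc, hψ, h1⟩ := exists_local_frame 𝓘(ℝ, V) F E x₀
  refine ⟨n, ψ, e, fun i => ⟨fun p => c i p.2 (S p),
    (hc i).comp ((contMDiff_pullback_iff (E := E) S).1 S.contMDiff)⟩, fun t => ?_, h1⟩
  ext x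
  rw [sum_section_apply]
  exact hψ x _

theorem smooth_time (f : C^∞⟮𝓘(ℝ, Fin k → ℝ).prod 𝓘(ℝ, V), (Fin k → ℝ) × M; ℝ⟯) (x : M) :
    ContDiff ℝ ∞ (fun t : Fin k → ℝ => f (t, x)) := by
  rw [← contMDiff_iff_contDiff]
  exact f.contMDiff.comp (contMDiff_id.prodMk contMDiff_const)

theorem prodVectorField_zero_right (u : Fin k → ℝ)
    (f : C^∞⟮𝓘(ℝ, Fin k → ℝ).prod 𝓘(ℝ, V), (Fin k → ℝ) × M; ℝ⟯) (t : Fin k → ℝ) (x : M) :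
    vectorFieldDerivation (prodVectorField u 0) f (t, x) = fderiv ℝ (fun τ => f (τ, x)) t u := by
  rw [prodVectorField_apply]
  exact (congrArg _ (map_zero (mfderiv 𝓘(ℝ, V) 𝓘(ℝ, ℝ) (slice f t) x))).trans (add_zero _)

theorem prodVectorField_zero_left (X : VectorFields 𝓘(ℝ, V) M)
    (f : C^∞⟮𝓘(ℝ, Fin k → ℝ).prod 𝓘(ℝ, V), (Fin k → ℝ) × M; ℝ⟯) (t : Fin k → ℝ) (x : M) :
    vectorFieldDerivation (prodVectorField 0 X) f (t, x) =
      vectorFieldDerivation X (slice f t) x := by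
  rw [prodVectorField_apply, map_zero, zero_add]

/-- The derivative at time `t`, in the direction `u`, of a curve `t ↦ s t` in the fibre `E x`. -/
def fiberDeriv (F : Type*) [NormedAddCommGroup F] [NormedSpace ℝ F] {E : M → Type*}
    [TopologicalSpace (TotalSpace F E)] [∀ x, AddCommGroup (E x)] [∀ x, Module ℝ (E x)]
    [∀ x, TopologicalSpace (E x)] [FiberBundle F E] [VectorBundle ℝ F E]
    {x : M} (s : (Fin k → ℝ) → E x) (t u : Fin k → ℝ) : E x :=
  (VectorBundle.continuousLinearEquivAt ℝ F E x).symm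
    (fderiv ℝ (fun τ => VectorBundle.continuousLinearEquivAt ℝ F E x (s τ)) t u)

theorem fiberDeriv_sum {x : M} {n : ℕ} (C : Fin n → (Fin k → ℝ) → ℝ) (e : Fin n → E x)
    (t u : Fin k → ℝ) (hC : ∀ i, DifferentiableAt ℝ (C i) t) :
    fiberDeriv F (fun τ => ∑ i, C i τ • e i) t u = ∑ i, fderiv ℝ (C i) t u • e i := by
  have h : HasFDerivAt (fun τ => ∑ i, C i τ • VectorBundle.continuousLinearEquivAt ℝ F E x (e i))
      (∑ i, (fderiv ℝ (C i) t).smulRight (VectorBundle.continuousLinearEquivAt ℝ F E x (e i))) t :=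
    HasFDerivAt.fun_sum fun i _ => (hC i).hasFDerivAt.smul_const _
  simp only [fiberDeriv, map_sum, map_smul]
  rw [h.fderiv]
  simp only [sum_apply, ContinuousLinearMap.smulRight_apply, map_sum, map_smul,
    ContinuousLinearEquiv.symm_apply_apply]

theorem exists_timeDeriv (S : PullbackSections k V F E) (u : Fin k → ℝ) (x₀ : M) :
    ∃ T : PullbackSections k V F E, ∀ᶠ x in 𝓝 x₀, ∀ t,
      fiberDeriv F (fun τ => S (τ, x)) t u = T (t, x) := by
  obtain ⟨n, ψ, e, c, hc, h1⟩ := exists_coefficients S x₀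
  refine ⟨∑ i, vectorFieldDerivation (prodVectorField u 0) (c i) • pullSection (e i), ?_⟩
  filter_upwards [h1] with x hx t
  have h2 : ∀ τ, S (τ, x) = ∑ i, c i (τ, x) • e i x := fun τ => by
    have h := congrArg (fun s : Cₛ^∞⟮𝓘(ℝ, V); F, E⟯ => s x) (hc τ)
    simp only [sum_section_apply, section_smul_apply, hx, one_smul] at h
    exact h
  rw [sum_section_apply]
  simp only [section_smul_apply, prodVectorField_zero_right]
  rw [funext h2]
  exact fiberDeriv_sum (F := F) (fun i τ => c i (τ, x)) (fun i => e i x) t u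
    fun i => (smooth_time (c i) x).differentiable (by simp) t

theorem differentiable_time (S : PullbackSections k V F E) (x : M) : Differentiable ℝ
    (fun τ : Fin k → ℝ => VectorBundle.continuousLinearEquivAt ℝ F E x (S (τ, x))) := by
  obtain ⟨n, ψ, e, c, hc, h1⟩ := exists_coefficients S x
  have h2 : ∀ τ, S (τ, x) = ∑ i, c i (τ, x) • e i x := fun τ => by
    have h := congrArg (fun s : Cₛ^∞⟮𝓘(ℝ, V); F, E⟯ => s x) (hc τ)
    simp only [sum_section_apply, section_smul_apply, h1.self_of_nhds, one_smul] at h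
    exact h
  have h3 : (fun τ : Fin k → ℝ => VectorBundle.continuousLinearEquivAt ℝ F E x (S (τ, x))) =
      fun τ => ∑ i, c i (τ, x) • VectorBundle.continuousLinearEquivAt ℝ F E x (e i x) := by
    funext τ
    rw [h2 τ, map_sum]
    simp only [map_smul]
  rw [h3]
  exact Differentiable.fun_sum fun i _ =>
    ((smooth_time (c i) x).differentiable (by simp)).smul_const _

theorem fiberDeriv_add {x : M} (s r : (Fin k → ℝ) → E x) (t u : Fin k → ℝ)
    (hs : DifferentiableAt ℝ (fun τ => VectorBundle.continuousLinearEquivAt ℝ F E x (s τ)) t)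
    (hr : DifferentiableAt ℝ (fun τ => VectorBundle.continuousLinearEquivAt ℝ F E x (r τ)) t) :
    fiberDeriv F (fun τ => s τ + r τ) t u = fiberDeriv F s t u + fiberDeriv F r t u := by
  simp only [fiberDeriv, map_add]
  rw [fderiv_fun_add hs hr, add_apply, map_add]

theorem fiberDeriv_smul {x : M} (f : (Fin k → ℝ) → ℝ) (s : (Fin k → ℝ) → E x) (t u : Fin k → ℝ)
    (hf : DifferentiableAt ℝ f t)
    (hs : DifferentiableAt ℝ (fun τ => VectorBundle.continuousLinearEquivAt ℝ F E x (s τ)) t) :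
    fiberDeriv F (fun τ => f τ • s τ) t u =
      f t • fiberDeriv F s t u + fderiv ℝ f t u • s t := by
  simp only [fiberDeriv, map_smul]
  rw [fderiv_fun_smul hf hs]
  simp only [add_apply, smul_apply, ContinuousLinearMap.smulRight_apply, map_add, map_smul,
    ContinuousLinearEquiv.symm_apply_apply]

theorem fiberDeriv_const_smul {x : M} (c : ℝ) (s : (Fin k → ℝ) → E x) (t u : Fin k → ℝ)
    (hs : DifferentiableAt ℝ (fun τ => VectorBundle.continuousLinearEquivAt ℝ F E x (s τ)) t) :
    fiberDeriv F (fun τ => c • s τ) t u = c • fiberDeriv F s t u := by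
  rw [fiberDeriv_smul (fun _ => c) s t u (differentiableAt_const c) hs]
  simp

/-- The derivative `∂_u S` of a section `S` of the pullback bundle in the direction `u ∈ ℝ^k`, i.e.
`∑ j, u j ∂S/∂t_j`. -/
def timeDeriv (u : Fin k → ℝ) : Module.End ℝ (PullbackSections k V F E) where
  toFun S := ⟨fun p => fiberDeriv F (E := E) (fun τ => S (τ, p.2)) p.1 u,
    contMDiff_of_local fun x₀ => exists_timeDeriv S u x₀⟩
  map_add' S T := by
    ext ⟨t, x⟩
    exact fiberDeriv_add (E := E) (x := x) (fun τ => S (τ, x)) (fun τ => T (τ, x)) t u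
      (differentiable_time S x t) (differentiable_time T x t)
  map_smul' c S := by
    ext ⟨t, x⟩
    exact fiberDeriv_const_smul (E := E) (x := x) c (fun τ => S (τ, x)) t u
      (differentiable_time S x t)

theorem timeDeriv_add (u v : Fin k → ℝ) (S : PullbackSections k V F E) :
    timeDeriv (u + v) S = timeDeriv u S + timeDeriv v S := by
  ext ⟨t, x⟩
  change fiberDeriv F (E := E) (x := x) _ t (u + v) = fiberDeriv F (E := E) (x := x) _ t u +
    fiberDeriv F (E := E) (x := x) _ t v
  simp only [fiberDeriv, map_add]

theorem timeDeriv_smul (c : ℝ) (u : Fin k → ℝ) (S : PullbackSections k V F E) :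
    timeDeriv (c • u) S = c • timeDeriv u S := by
  ext ⟨t, x⟩
  change fiberDeriv F (E := E) (x := x) _ t (c • u) = c • fiberDeriv F (E := E) (x := x) _ t u
  simp only [fiberDeriv, map_smul]

theorem timeDeriv_isCDO (u : Fin k → ℝ) :
    IsCDO (timeDeriv (V := V) (F := F) (E := E) u)
      (vectorFieldDerivation (prodVectorField u (0 : VectorFields 𝓘(ℝ, V) M))) := by
  intro f S
  ext ⟨t, x⟩
  refine (fiberDeriv_smul (E := E) (x := x) (fun τ => f (τ, x)) (fun τ => S (τ, x)) t u
    ((smooth_time f x).differentiable (by simp) t) (differentiable_time S x t)).trans ?_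
  rw [← prodVectorField_zero_right]
  rfl

theorem exists_liftOp {D : Module.End ℝ Cₛ^∞⟮𝓘(ℝ, V); F, E⟯} {X : VectorFields 𝓘(ℝ, V) M}
    (hD : IsCDO D (vectorFieldDerivation X)) (S : PullbackSections k V F E) (x₀ : M) :
    ∃ T : PullbackSections k V F E, ∀ᶠ x in 𝓝 x₀, ∀ t, D (sliceSection S t) x = T (t, x) := by
  obtain ⟨n, ψ, e, c, hc, h1⟩ := exists_coefficients S x₀
  refine ⟨∑ i, (c i • pullSection (D (e i)) +
    vectorFieldDerivation (prodVectorField 0 X) (c i) • pullSection (e i)), ?_⟩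
  filter_upwards [h1.eventually_nhds] with x hx t
  have h2 := congrArg (fun s : Cₛ^∞⟮𝓘(ℝ, V); F, E⟯ => D s x) (hc t)
  have h3 : vectorFieldDerivation X ψ x = 0 := by
    have hx' : (ψ : M → ℝ) =ᶠ[𝓝 x] fun _ => 1 := hx
    rw [vectorFieldDerivation_apply, hx'.mfderiv_eq, mfderiv_const]
    rfl
  simp only [map_sum, sum_section_apply] at h2 ⊢
  rw [hD ψ] at h2
  simp only [hD _ (e _)] at h2
  simp only [ContMDiffSection.coe_add, Pi.add_apply, section_smul_apply, h3, hx.self_of_nhds,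
    one_smul, zero_smul, add_zero] at h2
  rw [h2]
  refine Finset.sum_congr rfl fun i _ => ?_
  simp only [ContMDiffSection.coe_add, Pi.add_apply, section_smul_apply, prodVectorField_zero_left]
  rfl

/-- The operator `S ↦ ((t, x) ↦ D(S_t)(x))` on sections of the pullback bundle, for a covariant
differential operator `D` on `E`. -/
def liftOp (D : Module.End ℝ Cₛ^∞⟮𝓘(ℝ, V); F, E⟯) {X : VectorFields 𝓘(ℝ, V) M}
    (hD : IsCDO D (vectorFieldDerivation X)) : Module.End ℝ (PullbackSections k V F E) where
  toFun S := ⟨fun p => D (sliceSection S p.1) p.2, contMDiff_of_local fun x₀ => exists_liftOp hD S x₀⟩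
  map_add' S T := by
    ext ⟨t, x⟩
    exact congrArg (fun s : Cₛ^∞⟮𝓘(ℝ, V); F, E⟯ => s x)
      (map_add D (sliceSection S t) (sliceSection T t))
  map_smul' c S := by
    ext ⟨t, x⟩
    exact congrArg (fun s : Cₛ^∞⟮𝓘(ℝ, V); F, E⟯ => s x) (map_smul D c (sliceSection S t))

theorem liftOp_isCDO {D : Module.End ℝ Cₛ^∞⟮𝓘(ℝ, V); F, E⟯} {X : VectorFields 𝓘(ℝ, V) M}
    (hD : IsCDO D (vectorFieldDerivation X)) :
    IsCDO (liftOp D hD : Module.End ℝ (PullbackSections k V F E))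
      (vectorFieldDerivation (prodVectorField (0 : Fin k → ℝ) X)) := by
  intro f S
  ext ⟨t, x⟩
  change (D (slice f t • sliceSection S t) x : E x) = f (t, x) • D (sliceSection S t) x +
    vectorFieldDerivation (prodVectorField (0 : Fin k → ℝ) X) f (t, x) • sliceSection S t x
  rw [hD, prodVectorField_zero_left]
  rfl

end PullbackSections

section AffineConnection

variable {k : ℕ} {V : Type*} [NormedAddCommGroup V] [NormedSpace ℝ V] [FiniteDimensional ℝ V]
  {M : Type*} [TopologicalSpace M] [ChartedSpace V M] [IsManifold 𝓘(ℝ, V) ∞ M] [T2Space M]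
  {FA : Type*} [NormedAddCommGroup FA] [NormedSpace ℝ FA] [FiniteDimensional ℝ FA] {A : M → Type*}
  [TopologicalSpace (TotalSpace FA A)] [∀ x, AddCommGroup (A x)] [∀ x, Module ℝ (A x)]
  [∀ x, TopologicalSpace (A x)] [FiberBundle FA A] [VectorBundle ℝ FA A]
  [ContMDiffVectorBundle ∞ FA A 𝓘(ℝ, V)] [LieAlgebroid 𝓘(ℝ, V) FA A]
  {FE : Type*} [NormedAddCommGroup FE] [NormedSpace ℝ FE] [FiniteDimensional ℝ FE] {E : M → Type*}
  [TopologicalSpace (TotalSpace FE E)] [∀ x, AddCommGroup (E x)] [∀ x, Module ℝ (E x)]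
  [∀ x, TopologicalSpace (E x)] [FiberBundle FE E] [VectorBundle ℝ FE E]
  [ContMDiffVectorBundle ∞ FE E 𝓘(ℝ, V)]

/-- The barycentric coordinates `(1 - t_1 - ... - t_k, t_1, ..., t_k)` as smooth functions on
`ℝ^k × M`. -/
def weight (V : Type*) [NormedAddCommGroup V] [NormedSpace ℝ V] (M : Type*) [TopologicalSpace M]
    [ChartedSpace V M] (i : Fin (k + 1)) :
    C^∞⟮𝓘(ℝ, Fin k → ℝ).prod 𝓘(ℝ, V), (Fin k → ℝ) × M; ℝ⟯ :=
  ⟨fun p => (Fin.cons (1 - ∑ j, p.1 j) p.1 : Fin (k + 1) → ℝ) i, by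
    have h : ContDiff ℝ ∞ (fun t : Fin k → ℝ => (Fin.cons (1 - ∑ j, t j) t : Fin (k + 1) → ℝ) i) := by
      refine Fin.cases ?_ (fun j => ?_) i
      · simp only [Fin.cons_zero]
        fun_prop
      · simp only [Fin.cons_succ]
        fun_prop
    exact h.contMDiff.comp contMDiff_fst⟩

theorem sum_weight (t : Fin k → ℝ) (x : M) : ∑ i, weight V M i (t, x) = 1 := by
  change ∑ i, (Fin.cons (1 - ∑ j, t j) t : Fin (k + 1) → ℝ) i = 1
  rw [Fin.sum_univ_succ]
  simp

/-- The operator `S ↦ ∂_u S + (1 - ∑ t_i) ∇⁰_a S + ∑ t_i ∇ⁱ_a S` on sections of the pullback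
of `E` to `ℝ^k × M`. -/
def affineOp (D : Fin (k + 1) → RConnection (anchorHom 𝓘(ℝ, V) FA A) Cₛ^∞⟮𝓘(ℝ, V); FE, E⟯)
    (u : Fin k → ℝ) (a : Cₛ^∞⟮𝓘(ℝ, V); FA, A⟯) : Module.End ℝ (PullbackSections k V FE E) :=
  timeDeriv u + ∑ i, weight V M i •
    liftOp ((D i).toFun a) (X := LieAlgebroid.anchor.onSections a) ((D i).isCDO a)

theorem affineOp_apply
    (D : Fin (k + 1) → RConnection (anchorHom 𝓘(ℝ, V) FA A) Cₛ^∞⟮𝓘(ℝ, V); FE, E⟯)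
    (u : Fin k → ℝ) (a : Cₛ^∞⟮𝓘(ℝ, V); FA, A⟯) (S : PullbackSections k V FE E)
    (t : Fin k → ℝ) (x : M) : (affineOp D u a S (t, x) : E x) =
      (sliceSection (timeDeriv (u) S) t x : E x) +
        ∑ i, weight V M i (t, x) • ((D i).toFun a (sliceSection S t) x : E x) := by
  simp only [affineOp, LinearMap.add_apply, LinearMap.sum_apply, LinearMap.smul_apply,
    ContMDiffSection.coe_add, Pi.add_apply]
  refine congrArg₂ (fun v w : E x => v + w) rfl ?_
  exact sum_section_apply _ _

/-- The affine combination of the connections `∇⁰, …, ∇ᵏ`: the `ℝ`-linear connection on the pullback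
of `E` to `ℝ^k × M` given by
`(∇^aff_{(u, a)} S)(t, x) = (∂_u S)(t, x) + (1 - ∑ t_i) (∇⁰_a S_t)(x) + ∑ t_i (∇ⁱ_a S_t)(x)`. -/
def affineConnection
    (D : Fin (k + 1) → RConnection (anchorHom 𝓘(ℝ, V) FA A) Cₛ^∞⟮𝓘(ℝ, V); FE, E⟯) :
    RConnection (prodAnchorHom (V := V) k FA A) (PullbackSections k V FE E) where
  toFun :=
    { toFun := fun a => affineOp D a.1 a.2
      map_add' := fun a b => by
        ext S ⟨t, x⟩
        have h : (sliceSection (timeDeriv (a.1 + b.1) S) t x : E x) =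
          (sliceSection (timeDeriv (a.1) S) t x : E x) + (sliceSection (timeDeriv (b.1) S) t x : E x) := by rw [timeDeriv_add]; rfl
        refine (affineOp_apply D (a.1 + b.1) (a.2 + b.2) S t x).trans ((?_ : _ = _).trans
          (congrArg₂ (fun v w : E x => v + w) (affineOp_apply D a.1 a.2 S t x)
            (affineOp_apply D b.1 b.2 S t x)).symm)
        simp only [h, map_add, LinearMap.add_apply, ContMDiffSection.coe_add, Pi.add_apply,
          smul_add, Finset.sum_add_distrib]
        abel
      map_smul' := fun c a => by
        ext S ⟨t, x⟩
        have h : (sliceSection (timeDeriv (c • a.1) S) t x : E x) = c • (sliceSection (timeDeriv (a.1) S) t x : E x) := by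
          rw [timeDeriv_smul]; rfl
        refine (affineOp_apply D (c • a.1) (c • a.2) S t x).trans ((?_ : _ = _).trans
          (congrArg (fun v : E x => c • v) (affineOp_apply D a.1 a.2 S t x)).symm)
        simp only [h, map_smul, LinearMap.smul_apply, ContMDiffSection.coe_smul, Pi.smul_apply,
          smul_add, Finset.smul_sum, smul_comm c]
        rfl }
  isCDO := fun a f S => by
    ext ⟨t, x⟩
    have h1 : (sliceSection (timeDeriv (a.1) (f • S)) t x : E x) = f (t, x) • (sliceSection (timeDeriv (a.1) S) t x : E x) +
        fderiv ℝ (fun τ => f (τ, x)) t a.1 • sliceSection S t x := by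
      rw [timeDeriv_isCDO a.1 f S, ← prodVectorField_zero_right]
      rfl
    have h2 : ∀ i, ((D i).toFun a.2 (sliceSection (f • S) t) x : E x) =
        f (t, x) • (D i).toFun a.2 (sliceSection S t) x +
          vectorFieldDerivation (LieAlgebroid.anchor.onSections a.2) (slice f t) x •
            sliceSection S t x := fun i =>
      congrArg (fun s : Cₛ^∞⟮𝓘(ℝ, V); FE, E⟯ => s x) ((D i).isCDO a.2 (slice f t) (sliceSection S t))
    have h3 : prodAnchorHom (V := V) k FA A a f (t, x) = fderiv ℝ (fun τ => f (τ, x)) t a.1 +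
        vectorFieldDerivation (LieAlgebroid.anchor.onSections a.2) (slice f t) x :=
      prodVectorField_apply _ _ _ _ _
    refine (affineOp_apply D a.1 a.2 (f • S) t x).trans ((?_ : _ = _).trans
      (congrArg (fun v : E x => f (t, x) • v +
        prodAnchorHom (V := V) k FA A a f (t, x) • sliceSection S t x)
          (affineOp_apply D a.1 a.2 S t x)).symm)
    simp only [h1, h2, h3, smul_add, Finset.sum_add_distrib, add_smul, Finset.smul_sum,
      smul_comm _ (f (t, x)), ← Finset.sum_smul, sum_weight]
    change @Eq (E x) _ _
    rw [one_smul]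
    abel

end AffineConnection

section Integration

variable (k : ℕ)

/-- The standard simplex `{t ∈ ℝ^k | t_i ≥ 0, t_1 + ... + t_k ≤ 1}`. -/
def simplex : Set (Fin k → ℝ) := {t | (∀ i, 0 ≤ t i) ∧ ∑ i, t i ≤ 1}

theorem simplex_subset : simplex k ⊆ Set.Icc 0 1 := fun _ ht =>
  ⟨ht.1, fun i => (Finset.single_le_sum (fun j _ => ht.1 j) (Finset.mem_univ i)).trans ht.2⟩

theorem isCompact_simplex : IsCompact (simplex k) := by
  refine isCompact_Icc.of_isClosed_subset ?_ (simplex_subset k)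
  refine IsClosed.inter (s₁ := {t : Fin k → ℝ | ∀ i, 0 ≤ t i})
    (s₂ := {t : Fin k → ℝ | ∑ i, t i ≤ 1}) ?_ ?_
  · rw [Set.ofPred_forall]
    exact isClosed_iInter fun i => isClosed_le continuous_const (continuous_apply i)
  · exact isClosed_le (by fun_prop) continuous_const

variable {k}
variable {V : Type*} [NormedAddCommGroup V] [NormedSpace ℝ V]
  {M : Type*} [TopologicalSpace M] [ChartedSpace V M] [IsManifold 𝓘(ℝ, V) ∞ M]

theorem contDiffOn_integral_simplex {U : Set V} (hU : IsOpen U) (g : (Fin k → ℝ) × V → ℝ)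
    (hg : ∀ t, ∀ y ∈ U, ContDiffAt ℝ ∞ g (t, y)) :
    ContDiffOn ℝ ∞ (fun y => ∫ t in simplex k, g (t, y)) U := by
  let b : ContDiffBump (0 : Fin k → ℝ) := ⟨1, 2, by norm_num, by norm_num⟩
  have hb : ∀ t ∈ simplex k, b t = 1 := fun t ht => by
    refine b.one_of_mem_closedBall ?_
    rw [mem_closedBall_zero_iff, pi_norm_le_iff_of_nonneg zero_le_one]
    intro i
    have := simplex_subset k ht
    rw [Real.norm_eq_abs, abs_of_nonneg (this.1 i)]
    exact this.2 i
  let G : V → (Fin k → ℝ) → ℝ := fun y τ => b (-τ) * g (-τ, y)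
  have h := MeasureTheory.contDiffOn_convolution_right_with_param_comp (n := ⊤) (𝕜 := ℝ)
    (μ := (MeasureTheory.volume : MeasureTheory.Measure (Fin k → ℝ)))
    (ContinuousLinearMap.mul ℝ ℝ) (s := U) (v := fun _ : V => (0 : Fin k → ℝ))
    (f := (simplex k).indicator fun _ => (1 : ℝ)) (g := G) (k := Metric.closedBall 0 2)
    contDiffOn_const hU (isCompact_closedBall _ _) ?_ ?_ ?_
  · refine h.congr fun y hy => ?_
    simp only [MeasureTheory.convolution, G, zero_sub, neg_neg, ContinuousLinearMap.mul_apply']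
    rw [← MeasureTheory.integral_indicator (isCompact_simplex k).measurableSet]
    refine MeasureTheory.integral_congr_ae (Filter.Eventually.of_forall fun t => ?_)
    by_cases ht : t ∈ simplex k
    · simp [ht, hb t ht]
    · simp [ht]
  · intro y τ _ hτ
    have : b (-τ) = 0 := by
      refine b.zero_of_le_dist ?_
      rw [dist_zero_right, norm_neg]
      rw [mem_closedBall_zero_iff, not_le] at hτ
      exact hτ.le
    simp [G, this]
  · refine MeasureTheory.Integrable.locallyIntegrable ?_
    rw [MeasureTheory.integrable_indicator_iff (isCompact_simplex k).measurableSet]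
    exact MeasureTheory.integrableOn_const (isCompact_simplex k).measure_lt_top.ne
  · rintro ⟨y, τ⟩ ⟨hy, -⟩
    refine ContDiffAt.contDiffWithinAt ?_
    refine ContDiffAt.mul ?_ ?_
    · exact (b.contDiff.comp contDiff_snd.neg).contDiffAt
    · exact (hg (-τ) y hy).comp (y, τ) (contDiff_snd.neg.prodMk contDiff_fst).contDiffAt

theorem contMDiff_integral_simplex
    (f : C^∞⟮𝓘(ℝ, Fin k → ℝ).prod 𝓘(ℝ, V), (Fin k → ℝ) × M; ℝ⟯) :
    ContMDiff 𝓘(ℝ, V) 𝓘(ℝ, ℝ) ∞ (fun x => ∫ t in simplex k, f (t, x)) := by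
  intro x₀
  have h := contDiffOn_integral_simplex (isOpen_extChartAt_target (I := 𝓘(ℝ, V)) x₀) _
    (fun t y hy => contDiffAt_chart f t x₀ hy)
  have h1 := (h.contDiffAt ((isOpen_extChartAt_target x₀).mem_nhds (mem_extChartAt_target x₀))).contMDiffAt
  refine (h1.comp x₀ contMDiffAt_extChartAt).congr_of_eventuallyEq ?_
  filter_upwards [extChartAt_source_mem_nhds (I := 𝓘(ℝ, V)) x₀] with x hx
  simp only [Function.comp_apply, (extChartAt 𝓘(ℝ, V) x₀).left_inv hx]

theorem integrableOn_simplex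
    (f : C^∞⟮𝓘(ℝ, Fin k → ℝ).prod 𝓘(ℝ, V), (Fin k → ℝ) × M; ℝ⟯) (x : M) :
    MeasureTheory.IntegrableOn (fun t => f (t, x)) (simplex k) :=
  (f.contMDiff.continuous.comp (by fun_prop : Continuous fun t : Fin k → ℝ => (t, x))).continuousOn
    |>.integrableOn_compact (isCompact_simplex k)

/-- Integration over the standard simplex: `f ↦ (x ↦ ∫_{Δᵏ} f(t, x) dt)`. -/
def integrateSimplex : C^∞⟮𝓘(ℝ, Fin k → ℝ).prod 𝓘(ℝ, V), (Fin k → ℝ) × M; ℝ⟯ →ₗ[ℝ]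
    C^∞⟮𝓘(ℝ, V), M; ℝ⟯ where
  toFun f := ⟨fun x => ∫ t in simplex k, f (t, x), contMDiff_integral_simplex f⟩
  map_add' f g := by
    ext x
    exact MeasureTheory.integral_add (integrableOn_simplex f x) (integrableOn_simplex g x)
  map_smul' c f := by
    ext x
    exact MeasureTheory.integral_const_mul c _

theorem append_update {L : Type*} [AddCommGroup L] {m : ℕ} [DecidableEq (Fin m)]
    (u : Fin k → (Fin k → ℝ) × L) (a : Fin m → L) (i : Fin m) (x : L) :
    Fin.append u (fun i' => (0, Function.update a i x i')) =
      Function.update (Fin.append u (fun i' => (0, a i'))) (Fin.natAdd k i) (0, x) := by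
  funext j
  refine Fin.addCases (fun j => ?_) (fun j => ?_) j
  · rw [Fin.append_left, Function.update_of_ne, Fin.append_left]
    intro h
    have := congrArg Fin.val h
    simp at this
    omega
  · rw [Fin.append_right]
    by_cases h : j = i
    · subst h
      simp
    · rw [Function.update_of_ne h, Function.update_of_ne, Fin.append_right]
      exact fun hj => h ((Fin.natAdd_inj k).1 hj)

/-- The integral over the standard simplex of an `ℝ`-multilinear form `η` on `ℝ^k × L`: the form
`a ↦ ∫_{Δᵏ} η(∂/∂t_1, ..., ∂/∂t_k, a_1, ..., a_m)(t, ·) dt`. -/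
def fiberIntegral {L : Type*} [AddCommGroup L] [Module ℝ L] {m : ℕ}
    (η : ((Fin k → ℝ) × L) [⋀^Fin (k + m)]→ₗ[ℝ]
      C^∞⟮𝓘(ℝ, Fin k → ℝ).prod 𝓘(ℝ, V), (Fin k → ℝ) × M; ℝ⟯) :
    L [⋀^Fin m]→ₗ[ℝ] C^∞⟮𝓘(ℝ, V), M; ℝ⟯ where
  toFun a := integrateSimplex
    (η (Fin.append (fun j => (Pi.single j 1, 0)) (fun i => (0, a i))))
  map_update_add' a i x y := by
    have h : ((0, x + y) : (Fin k → ℝ) × L) = (0, x) + (0, y) := by simp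
    simp only [append_update, h, AlternatingMap.map_update_add, map_add]
  map_update_smul' a i c x := by
    have h : ((0, c • x) : (Fin k → ℝ) × L) = c • (0, x) := by simp
    simp only [append_update, h, AlternatingMap.map_update_smul, map_smul]
  map_eq_zero_of_eq' a i j hij hne := by
    rw [η.map_eq_zero_of_eq _ (i := Fin.natAdd k i) (j := Fin.natAdd k j), map_zero]
    · simp [hij]
    · exact fun h => hne ((Fin.natAdd_inj k).1 h)

end Integration

section ChernSimons

variable {V : Type*} [NormedAddCommGroup V] [NormedSpace ℝ V] [FiniteDimensional ℝ V]
  {M : Type*} [TopologicalSpace M] [ChartedSpace V M] [IsManifold 𝓘(ℝ, V) ∞ M] [T2Space M]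
  {FA : Type*} [NormedAddCommGroup FA] [NormedSpace ℝ FA] [FiniteDimensional ℝ FA] {A : M → Type*}
  [TopologicalSpace (TotalSpace FA A)] [∀ x, AddCommGroup (A x)] [∀ x, Module ℝ (A x)]
  [∀ x, TopologicalSpace (A x)] [FiberBundle FA A] [VectorBundle ℝ FA A]
  [ContMDiffVectorBundle ∞ FA A 𝓘(ℝ, V)] [LieAlgebroid 𝓘(ℝ, V) FA A]
  {FE : Type*} [NormedAddCommGroup FE] [NormedSpace ℝ FE] [FiniteDimensional ℝ FE] {E : M → Type*}
  [TopologicalSpace (TotalSpace FE E)] [∀ x, AddCommGroup (E x)] [∀ x, Module ℝ (E x)]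
  [∀ x, TopologicalSpace (E x)] [FiberBundle FE E] [VectorBundle ℝ FE E]
  [ContMDiffVectorBundle ∞ FE E 𝓘(ℝ, V)]

/-- The Chern-Simons form `cs_p(∇⁰, ..., ∇ᵏ)`, an alternating form of degree `m = 2 p - k` on `Γ(A)`.
For `k = 0` it is `ch_p(∇⁰) = Tr((R^{∇⁰})^p)`. For `k > 0` it is
`a ↦ ∫_{Δᵏ} ch_p(∇^aff)(∂/∂t_1, ..., ∂/∂t_k, a_1, ..., a_m)(t, ·) dt`, where `∇^aff` is the affine
combination of the connections. -/
def chernSimons (p : ℕ) : (k m : ℕ) → k + m = 2 * p →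
    (Fin (k + 1) → RConnection (anchorHom 𝓘(ℝ, V) FA A) Cₛ^∞⟮𝓘(ℝ, V); FE, E⟯) →
    Cₛ^∞⟮𝓘(ℝ, V); FA, A⟯ [⋀^Fin m]→ₗ[ℝ] C^∞⟮𝓘(ℝ, V), M; ℝ⟯
  | 0, m, h, D =>
    AlternatingMap.domDomCongr (finCongr (show 2 * p = m by omega)) ((D 0).chernForm fiberTrace p)
  | k + 1, m, h, D =>
    fiberIntegral (k := k + 1) (AlternatingMap.domDomCongr (finCongr h.symm)
      ((affineConnection D).chernForm fiberTrace p))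

end ChernSimons

end LieAlgebroidCS

end

open LieAlgebroidCS

/-! The formula is Stokes' theorem on the simplex, applied to the closed form `ch_p(∇^aff)`. It
needs no `C^∞(M)`-linearity and no locality in the sections of `A`: forms are treated as cochains of
a Lie algebra that acts on functions by derivations, and only the curvature's linearity over
functions on sections of `E` is used, to form a fibrewise trace.

Closedness. For a connection on a bundle, `Tr [∇_a, φ] = ρ(a)(Tr φ)` (`fiberTrace_commutator`).
Hence `ρ(a)` applied to `Tr(R ∘ ... ∘ R)` is a sum of traces in which one factor `R` is replaced by
`[∇_a, R]`. The bracket terms of the differential also change one factor at a time. Together they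
replace that factor by a summand of the differential of `R`, whose cyclic sum vanishes by the
Bianchi identity (`RConnection.bianchi`), so the antisymmetrization is zero
(`RConnection.differential_chernForm`). This applies to each connection on `E` and to the affine
combination.

The formula. Evaluate `d ch_p(∇^aff) = 0` on `∂/∂t_1, ..., ∂/∂t_k` followed by sections of `A`. The
fields `∂/∂t_j` commute with all the arguments, so Cartan's formula (`differential_append`) splits
the result into the derivatives `∂/∂t_j` of the form with `∂/∂t_j` omitted, and the differential of
its contraction with all the `∂/∂t_j`. Integrate over the simplex. The differential commutes with
the integral (`differential_fiberIntegral`), so the second part gives `d cs_p`. In the first part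
the fundamental theorem of calculus (`integral_simplex_fderiv`) leaves, for each `j`, the integral
over the face opposite to the origin minus the integral over the face `t_j = 0`.

On a face one barycentric weight is zero, so `∇^aff` restricts to the affine combination of the
remaining connections (`chernForm_affineConnection_face`). The faces `t_j = 0` thus give the terms
without `∇^j` for `j ≥ 1`. On the opposite face the `k` contributions have to be assembled into a
single term, the one without `∇^0`: its tangent vectors are differences of the `∂/∂t_j`, and the
value of an alternating form on these differences is exactly the alternating sum that occurs
(`map_append_sub`). -/

noncomputable section

namespace LieAlgebroidCS

/-! ### Alternating sums over permutations and their expansions. -/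

section AlternatingSums

variable {L N : Type*} [AddCommGroup N] {n : ℕ}

/-- The alternating sum `∑ σ, sgn σ • h (a ∘ σ)` of an arbitrary function `h` of `n` arguments. -/
def altSum (h : (Fin n → L) → N) (a : Fin n → L) : N :=
  ∑ σ : Equiv.Perm (Fin n), Equiv.Perm.sign σ • h (a ∘ σ)

/-- Substitute `σ * τ` for `σ`; the sign of `τ` is its own inverse. -/
theorem altSum_comp_perm (h : (Fin n → L) → N) (τ : Equiv.Perm (Fin n)) (a : Fin n → L) :
    altSum (fun b => h (b ∘ τ)) a = Equiv.Perm.sign τ • altSum h a := by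
  simp only [altSum, Finset.smul_sum, smul_smul]
  refine Fintype.sum_equiv (Equiv.mulRight τ) _ _ fun σ => ?_
  have h1 : Equiv.Perm.sign τ * (Equiv.Perm.sign σ * Equiv.Perm.sign τ) = Equiv.Perm.sign σ := by
    rw [mul_left_comm, Int.units_mul_self, mul_one]
  rw [Equiv.coe_mulRight, Equiv.Perm.sign_mul, h1, Equiv.Perm.coe_mul]
  rfl

theorem altSum_add (h h' : (Fin n → L) → N) (a : Fin n → L) :
    altSum (fun b => h b + h' b) a = altSum h a + altSum h' a := by
  simp only [altSum, smul_add, Finset.sum_add_distrib]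

theorem altSum_sum {ι : Type*} (s : Finset ι) (h : ι → (Fin n → L) → N) (a : Fin n → L) :
    altSum (fun b => ∑ i ∈ s, h i b) a = ∑ i ∈ s, altSum (h i) a := by
  simp only [altSum, Finset.smul_sum]
  exact Finset.sum_comm

theorem altSum_smul [Module ℝ N] (c : ℝ) (h : (Fin n → L) → N) (a : Fin n → L) :
    altSum (fun b => c • h b) a = c • altSum h a := by
  simp only [altSum, Finset.smul_sum]
  exact Finset.sum_congr rfl fun σ _ => smul_comm _ _ _

theorem map_altSum {N' F : Type*} [AddCommGroup N'] [FunLike F N N'] [AddMonoidHomClass F N N']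
    (T : F) (h : (Fin n → L) → N) (a : Fin n → L) :
    T (altSum h a) = altSum (fun b => T (h b)) a := by
  simp only [altSum, map_sum, Units.smul_def, map_zsmul]

/-- A permutation of `Fin (n + 1)` is determined by the image of `0` and by the permutation it
induces on the remaining elements. -/
def permOfImageZero (x : Fin (n + 1) × Equiv.Perm (Fin n)) : Equiv.Perm (Fin (n + 1)) :=
  x.1.cycleRange.symm * Equiv.Perm.decomposeFin.symm (0, x.2)

theorem permOfImageZero_apply_zero (x : Fin (n + 1) × Equiv.Perm (Fin n)) :
    permOfImageZero x 0 = x.1 := by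
  simp [permOfImageZero]

theorem permOfImageZero_apply_succ (x : Fin (n + 1) × Equiv.Perm (Fin n)) (j : Fin n) :
    permOfImageZero x j.succ = x.1.succAbove (x.2 j) := by
  simp [permOfImageZero]

theorem sign_permOfImageZero (x : Fin (n + 1) × Equiv.Perm (Fin n)) :
    Equiv.Perm.sign (permOfImageZero x) = (-1) ^ (x.1 : ℕ) * Equiv.Perm.sign x.2 := by
  rw [permOfImageZero, Equiv.Perm.sign_mul, Equiv.Perm.sign_symm, Fin.sign_cycleRange,
    Equiv.Perm.decomposeFin.symm_sign, if_pos rfl, one_mul]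

theorem permOfImageZero_bijective :
    Function.Bijective (permOfImageZero : Fin (n + 1) × Equiv.Perm (Fin n) → _) := by
  rw [Fintype.bijective_iff_injective_and_card]
  refine ⟨fun x y h => ?_, ?_⟩
  · have h0 : x.1 = y.1 := by
      rw [← permOfImageZero_apply_zero x, h, permOfImageZero_apply_zero]
    refine Prod.ext h0 (Equiv.ext fun j => ?_)
    have := permOfImageZero_apply_succ x j
    rw [h, permOfImageZero_apply_succ, h0] at this
    exact (Fin.succAbove_right_injective this).symm
  · simp [Fintype.card_perm, Nat.factorial_succ]

/-- Laplace expansion: the permutations are sorted by the image `i` of `0`, and the cycle that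
brings `i` to the front has sign `(-1)^i`. -/
theorem altSum_succ (h : (Fin (n + 1) → L) → N) (a : Fin (n + 1) → L) :
    altSum h a = ∑ i : Fin (n + 1), (-1 : ℤ) ^ (i : ℕ) •
      altSum (fun r => h (Fin.cons (a i) r)) (i.removeNth a) := by
  simp only [altSum, Finset.smul_sum]
  rw [← Fintype.sum_prod_type']
  refine (Fintype.sum_bijective permOfImageZero permOfImageZero_bijective _ _ fun x => ?_).symm
  rw [sign_permOfImageZero, mul_smul]
  have h1 : a ∘ permOfImageZero x = Fin.cons (a x.1) (x.1.removeNth a ∘ x.2) := by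
    funext j
    refine Fin.cases ?_ (fun j => ?_) j
    · simp [permOfImageZero_apply_zero]
    · simp [permOfImageZero_apply_succ, Fin.removeNth]
  rw [h1]
  simp [Units.smul_def]

/-- The dual expansion, sorted by the preimage of `0`, that is, by the position `q` at which `c`
arrives. It serves the bracket terms of the differential: there the bracket is the first argument,
while a non-alternating summand must be told in which of its slots the bracket lands. -/
theorem altSum_cons (h : (Fin (n + 1) → L) → N) (c : L) (r : Fin n → L) :
    altSum h (Fin.cons c r) = ∑ q : Fin (n + 1), (-1 : ℤ) ^ (q : ℕ) •
      altSum (fun r' => h (q.insertNth c r')) r := by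
  simp only [altSum, Finset.smul_sum]
  rw [← Fintype.sum_prod_type']
  -- The outer inverse exchanges image and preimage of `0`; the inner one makes the permutation
  -- induced on the rest equal to `x.2`.
  let e : Fin (n + 1) × Equiv.Perm (Fin n) → Equiv.Perm (Fin (n + 1)) := fun x =>
    (permOfImageZero (x.1, x.2⁻¹))⁻¹
  have he : Function.Bijective e :=
    (Equiv.inv _).bijective.comp (permOfImageZero_bijective.comp
      ((Equiv.refl _).prodCongr (Equiv.inv _)).bijective)
  refine (Fintype.sum_bijective e he _ _ fun x => ?_).symm
  have h0 : e x = Equiv.Perm.decomposeFin.symm (0, x.2) * x.1.cycleRange := by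
    have h2 : (Equiv.Perm.decomposeFin.symm (0, x.2⁻¹))⁻¹ =
        (Equiv.Perm.decomposeFin.symm (0, x.2) : Equiv.Perm (Fin (n + 1))) := by
      rw [inv_eq_iff_mul_eq_one]
      ext j
      refine Fin.cases ?_ (fun j => ?_) j <;> simp
    simp only [e, permOfImageZero, mul_inv_rev, h2]
    rfl
  have h1 : (Fin.cons c r : Fin (n + 1) → L) ∘ e x = x.1.insertNth c (r ∘ x.2) := by
    rw [h0, Equiv.Perm.coe_mul, ← Function.comp_assoc, ← Fin.cons_comp_cycleRange]
    congr 1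
    funext j
    refine Fin.cases ?_ (fun j => ?_) j <;> simp
  rw [h1, h0, Equiv.Perm.sign_mul, Fin.sign_cycleRange, Equiv.Perm.decomposeFin.symm_sign,
    if_pos rfl, one_mul, mul_comm, mul_smul]
  simp [Units.smul_def]

/-- Moving the first entry to position `q` is a cycle of length `q + 1`. -/
theorem altSum_insertNth (φ : (Fin (n + 1) → L) → N) (q : Fin (n + 1)) (a : Fin (n + 1) → L) :
    altSum (fun c => φ (q.insertNth (c 0) (Fin.tail c))) a = (-1 : ℤ) ^ (q : ℕ) • altSum φ a := by
  have h : ∀ c : Fin (n + 1) → L, q.insertNth (c 0) (Fin.tail c) = c ∘ q.cycleRange := fun c => by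
    rw [← Fin.cons_comp_cycleRange, Fin.cons_self_tail]
  simp only [h]
  rw [altSum_comp_perm φ q.cycleRange a, Fin.sign_cycleRange]
  simp [Units.smul_def]

/-- An even permutation of the arguments does not change the alternating sum, so the three terms of
`H` contribute equally and three times the sum is zero. This is how the Bianchi identity enters. -/
theorem altSum_eq_zero_of_cyclic [Module ℝ N] (h : (Fin n → L) → N) (τ : Equiv.Perm (Fin n))
    (hτ : Equiv.Perm.sign τ = 1)
    (H : ∀ b, h b + h (b ∘ τ) + h (b ∘ τ ∘ τ) = 0) (a : Fin n → L) : altSum h a = 0 := by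
  have h1 := altSum_comp_perm h τ a
  have h2 := altSum_comp_perm h (τ * τ) a
  rw [Equiv.Perm.sign_mul, Equiv.Perm.coe_mul] at h2
  rw [hτ] at h1 h2
  have h3 : altSum (fun b => h b + h (b ∘ τ) + h (b ∘ τ ∘ τ)) a = 0 := by
    simp [H, altSum]
  rw [altSum_add, altSum_add, h1, h2] at h3
  have h4 : (3 : ℝ) • altSum h a = 0 := by
    rw [← h3]
    simp only [one_smul, mul_one]
    module
  exact (smul_eq_zero.1 h4).resolve_left (by norm_num)

end AlternatingSums

/-! ### The differential of a form that is given as an alternating sum. -/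

section DifferentialOfAlternatization

variable {C L : Type*} [CommRing C] [Algebra ℝ C] [LieRing L] [LieAlgebra ℝ L]
  (ρ : L →ₗ⁅ℝ⁆ Derivation ℝ C C)

theorem differential_zero_apply (η : L [⋀^Fin 0]→ₗ[ℝ] C) (a : Fin 1 → L) :
    differential ρ η a = ρ (a 0) (η ![]) := rfl

theorem differential_succ_apply {n : ℕ} (η : L [⋀^Fin (n + 1)]→ₗ[ℝ] C) (a : Fin (n + 2) → L) :
    differential ρ η a =
      (∑ i : Fin (n + 2), (-1 : ℤ) ^ (i : ℕ) • ρ (a i) (η (i.removeNth a))) +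
      ∑ i : Fin (n + 1), ∑ j ≥ i, (-1 : ℤ) ^ ((i.castSucc : ℕ) + (j.succ : ℕ)) •
        η (Matrix.vecCons ⁅a i.castSucc, a j.succ⁆ (j.removeNth (i.castSucc.removeNth a))) := rfl

/-- The differential with the bracket terms summed over all ordered pairs of arguments. -/
theorem differential_succ_apply' {n : ℕ} (η : L [⋀^Fin (n + 1)]→ₗ[ℝ] C) (a : Fin (n + 2) → L) :
    differential ρ η a =
      (∑ i : Fin (n + 2), (-1 : ℤ) ^ (i : ℕ) • ρ (a i) (η (i.removeNth a))) -
      (1 / 2 : ℝ) • ∑ i : Fin (n + 2), (-1 : ℤ) ^ (i : ℕ) • ∑ j : Fin (n + 1), (-1 : ℤ) ^ (j : ℕ) •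
        η (Fin.cons ⁅a i, i.removeNth a j⁆ (j.removeNth (i.removeNth a))) := by
  -- Each unordered pair is counted twice with equal values, since `B` is skew; hence the factor `1
  -- / 2`. When `i` precedes the second index, the latter is one smaller after removal of `i`; hence
  -- the minus sign in front of the factor.
  let B : L →ₗ[ℝ] L →ₗ[ℝ] L [⋀^Fin n]→ₗ[ℝ] C :=
    LinearMap.mk₂ ℝ (fun a b => η.curryLeft ⁅a, b⁆) (by simp) (by simp) (by simp) (by simp)
  have hB : ∀ a b v, B a b v = η (Matrix.vecCons ⁅a, b⁆ v) := fun _ _ _ => rfl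
  have h1 := AlternatingMap.alternatizeUncurryFin_alternatizeUncurryFinLM_comp_apply B a
  rw [AlternatingMap.alternatizeUncurryFin_apply] at h1
  have h2 : ∑ i : Fin (n + 2), (-1 : ℤ) ^ (i : ℕ) • ∑ j : Fin (n + 1), (-1 : ℤ) ^ (j : ℕ) •
        η (Fin.cons ⁅a i, i.removeNth a j⁆ (j.removeNth (i.removeNth a))) =
      ∑ i : Fin (n + 2), (-1 : ℤ) ^ (i : ℕ) •
        (AlternatingMap.alternatizeUncurryFinLM ∘ₗ B) (a i) (i.removeNth a) := by
    refine Finset.sum_congr rfl fun i _ => ?_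
    rw [LinearMap.comp_apply, AlternatingMap.alternatizeUncurryFinLM_apply,
      AlternatingMap.alternatizeUncurryFin_apply]
    rfl
  rw [h2, h1, differential_succ_apply, sub_eq_add_neg]
  simp only [Finset.smul_sum, ← Finset.sum_neg_distrib]
  refine congrArg₂ _ rfl (Finset.sum_congr rfl fun i _ => Finset.sum_congr rfl fun j _ => ?_)
  have h : B (a j.succ) (a i.castSucc) (j.removeNth (i.castSucc.removeNth a)) =
      -B (a i.castSucc) (a j.succ) (j.removeNth (i.castSucc.removeNth a)) := by
    change η.curryLeft ⁅a j.succ, a i.castSucc⁆ _ = -η.curryLeft ⁅a i.castSucc, a j.succ⁆ _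
    rw [← lie_skew, map_neg, AlternatingMap.neg_apply]
  rw [h, sub_neg_eq_add, ← hB, ← two_smul ℝ, smul_comm (1 / 2 : ℝ), smul_smul]
  norm_num [pow_succ, ← add_assoc]

/-- The differential of an alternatization is the alternatization of the Lie derivative, with the
weight `1 / 2` on the bracket terms. -/
theorem differential_of_altSum {n : ℕ} (η : L [⋀^Fin n]→ₗ[ℝ] C) (f : (Fin n → L) → C)
    (hf : ∀ a, η a = altSum f a) (a : Fin (n + 1) → L) :
    differential ρ η a = altSum (fun b => ρ (b 0) (f (Fin.tail b)) -
      (1 / 2 : ℝ) • ∑ q : Fin n, f (Function.update (Fin.tail b) q ⁅b 0, Fin.tail b q⁆)) a := by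
  have hρ : ∑ i : Fin (n + 1), (-1 : ℤ) ^ (i : ℕ) • ρ (a i) (η (i.removeNth a)) =
      altSum (fun b => ρ (b 0) (f (Fin.tail b))) a := by
    rw [altSum_succ]
    refine Finset.sum_congr rfl fun i _ => ?_
    rw [hf, map_altSum]
    simp
  cases n with
  | zero =>
    rw [differential_zero_apply]
    simp only [Finset.univ_eq_empty, Finset.sum_empty, smul_zero, sub_zero]
    rw [← hρ]
    simp [Subsingleton.elim (![] : Fin 0 → L) (Fin.tail a)]
  | succ n =>
    -- For fixed `x` the bracket terms are the derivation action of `x` on the arguments of `f`: the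
    -- sign for placing the bracket in slot `q` cancels the sign for bringing an argument from the
    -- front to slot `q`.
    have h1 : ∀ (x : L) (w : Fin (n + 1) → L), ∑ j : Fin (n + 1), (-1 : ℤ) ^ (j : ℕ) •
        η (Fin.cons ⁅x, w j⁆ (j.removeNth w)) =
        altSum (fun c => ∑ q, f (Function.update c q ⁅x, c q⁆)) w := by
      intro x w
      simp only [hf, altSum_cons]
      rw [altSum_sum]
      simp only [Finset.smul_sum]
      rw [Finset.sum_comm]
      refine Finset.sum_congr rfl fun q _ => ?_
      have h2 : ∀ (y : L) (r : Fin n → L),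
          (q.insertNth ⁅x, y⁆ r : Fin (n + 1) → L) = Function.update (q.insertNth y r) q
            ⁅x, @Fin.insertNth n (fun _ => L) q y r q⁆ := by
        intro y r
        simp
      have h3 := altSum_insertNth (fun c => f (Function.update c q ⁅x, c q⁆)) q w
      have h4 : altSum (fun c => f (Function.update c q ⁅x, c q⁆)) w = (-1 : ℤ) ^ (q : ℕ) •
          altSum (fun c => f (Function.update (q.insertNth (c 0) (Fin.tail c)) q
            ⁅x, @Fin.insertNth n (fun _ => L) q (c 0) (Fin.tail c) q⁆)) w := by
        rw [h3, smul_smul, ← mul_pow]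
        simp
      rw [h4, altSum_succ, Finset.smul_sum]
      refine Finset.sum_congr rfl fun j _ => ?_
      rw [smul_comm]
      simp only [h2, Fin.cons_zero, Fin.tail_cons]
    rw [differential_succ_apply', hρ]
    simp only [h1]
    have h5 := altSum_succ (fun b : Fin (n + 2) → L =>
      ∑ q : Fin (n + 1), f (Function.update (Fin.tail b) q ⁅b 0, Fin.tail b q⁆)) a
    simp only [Fin.cons_zero, Fin.tail_cons] at h5
    rw [← h5]
    simp only [sub_eq_add_neg, ← neg_smul]
    rw [altSum_add, altSum_smul]

end DifferentialOfAlternatization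

/-! ### Commutators with covariant differential operators and the Bianchi identity. -/

section Bianchi

variable {C L : Type*} [CommRing C] [Algebra ℝ C] [LieRing L] [LieAlgebra ℝ L]
  {ρ : L →ₗ⁅ℝ⁆ Derivation ℝ C C} {G : Type*} [AddCommGroup G] [Module ℝ G] [Module C G]

/-- The commutator `[ℓ, φ]` of a derivative operator `ℓ` with a `C`-linear operator `φ`. -/
def IsCDO.commutator {ℓ : Module.End ℝ G} {X : Derivation ℝ C C} (h : IsCDO ℓ X)
    (φ : Module.End C G) : Module.End C G where
  toFun s := ℓ (φ s) - φ (ℓ s)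
  map_add' s t := by simp only [map_add]; abel
  map_smul' f s := by
    simp only [map_smul, h _ _, map_add, RingHom.id_apply, smul_sub]
    abel

theorem IsCDO.commutator_apply {ℓ : Module.End ℝ G} {X : Derivation ℝ C C} (h : IsCDO ℓ X)
    (φ : Module.End C G) (s : G) : h.commutator φ s = ℓ (φ s) - φ (ℓ s) := rfl

theorem IsCDO.commutator_mul {ℓ : Module.End ℝ G} {X : Derivation ℝ C C} (h : IsCDO ℓ X)
    (φ ψ : Module.End C G) :
    h.commutator (φ * ψ) = h.commutator φ * ψ + φ * h.commutator ψ := by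
  ext s
  simp only [commutator_apply, LinearMap.add_apply, Module.End.mul_apply, map_sub]
  abel

theorem IsCDO.commutator_one {ℓ : Module.End ℝ G} {X : Derivation ℝ C C} (h : IsCDO ℓ X) :
    h.commutator (1 : Module.End C G) = 0 := by
  ext s
  simp [commutator_apply]

theorem IsCDO.commutator_prod {ℓ : Module.End ℝ G} {X : Derivation ℝ C C} (h : IsCDO ℓ X)
    {p : ℕ} (g : Fin p → Module.End C G) : h.commutator (List.ofFn g).prod =
      ∑ l, (List.ofFn (Function.update g l (h.commutator (g l)))).prod := by
  induction p with
  | zero => simp [commutator_one]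
  | succ p ih =>
    rw [List.ofFn_succ, List.prod_cons, commutator_mul, ih, Fin.sum_univ_succ, Finset.mul_sum]
    congr 1
    · simp [List.ofFn_succ]
    · refine Finset.sum_congr rfl fun l _ => ?_
      rw [List.ofFn_succ, List.prod_cons, Function.update_of_ne (Fin.succ_ne_zero l).symm]
      congr 3
      funext i
      by_cases hi : i = l
      · subst hi; simp
      · rw [Function.update_of_ne hi, Function.update_of_ne (fun h' => hi (Fin.succ_injective _ h'))]

variable [SMulCommClass C ℝ G] [SMulCommClass ℝ C G] [IsScalarTower ℝ C G]

/-- The summand of the differential of the curvature, with the weight `1 / 2` on brackets. -/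
def RConnection.bianchiTerm (D : RConnection ρ G) (x y z : L) : Module.End C G :=
  (D.isCDO x).commutator (D.curvature y z) -
    (1 / 2 : ℝ) • (D.curvature ⁅x, y⁆ z + D.curvature y ⁅x, z⁆)

theorem RConnection.curvature_swap (D : RConnection ρ G) (a b : L) :
    D.curvature a b = -D.curvature b a := by
  ext s
  have h : D.toFun ⁅a, b⁆ s = -D.toFun ⁅b, a⁆ s := by
    rw [← lie_skew, map_neg, LinearMap.neg_apply]
  simp only [curvature, LinearMap.coe_mk, AddHom.coe_mk, LinearMap.neg_apply, h]
  abel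

/-- The Bianchi identity. -/
theorem RConnection.bianchi (D : RConnection ρ G) (x y z : L) :
    D.bianchiTerm x y z + D.bianchiTerm y z x + D.bianchiTerm z x y = 0 := by
  -- The identity without weights: all compositions of operators cancel in the expansion, and what
  -- remains is `∇` of the Jacobi sum `hj`.
  have key : (D.isCDO x).commutator (D.curvature y z) + (D.isCDO y).commutator (D.curvature z x) +
      (D.isCDO z).commutator (D.curvature x y) =
      D.curvature ⁅x, y⁆ z + D.curvature ⁅y, z⁆ x + D.curvature ⁅z, x⁆ y := by
    ext s
    have hj : D.toFun ⁅⁅x, y⁆, z⁆ s + D.toFun ⁅⁅y, z⁆, x⁆ s + D.toFun ⁅⁅z, x⁆, y⁆ s = 0 := by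
      have h := lie_jacobi x y z
      have h' : ∀ u v : L, ⁅u, v⁆ = -⁅v, u⁆ := fun u v => (lie_skew _ _).symm
      rw [h' x, h' y ⁅z, x⁆, h' z ⁅x, y⁆, ← neg_add, ← neg_add, neg_eq_zero] at h
      have h2 := congrArg (fun w => D.toFun w s) h
      simp only [map_add, map_zero, LinearMap.add_apply, LinearMap.zero_apply] at h2
      rw [← h2]
      abel
    simp only [LinearMap.add_apply, IsCDO.commutator_apply, curvature, LinearMap.coe_mk,
      AddHom.coe_mk, map_sub]
    rw [← sub_eq_zero]
    rw [← hj]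
    abel
  have h1 : ∀ x y z : L, D.curvature y ⁅x, z⁆ = D.curvature ⁅z, x⁆ y := fun x y z => by
    rw [D.curvature_swap, ← lie_skew x z]
    have := D.curvature_smul_left (-1) ⁅z, x⁆ y
    rw [neg_one_smul, neg_one_smul] at this
    rw [this, neg_neg]
  simp only [bianchiTerm, h1]
  -- Here `a`, `b`, `c` are the three curvatures with a bracket argument. Each occurs in two of the
  -- three cyclic summands, which makes up for the weight `1 / 2`.
  have h2 : ∀ u v w a b c : Module.End C G, u + v + w = a + b + c →
      u - (1 / 2 : ℝ) • (a + c) + (v - (1 / 2 : ℝ) • (b + a)) + (w - (1 / 2 : ℝ) • (c + b)) = 0 := by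
    intro u v w a b c h
    have : u = a + b + c - v - w := by rw [← h]; abel
    rw [this]
    module
  exact h2 _ _ _ _ _ _ key

end Bianchi

/-! ### Closedness of the Chern character form for a compatible trace. -/

section ChernFormClosed

variable {C L : Type*} [CommRing C] [Algebra ℝ C] [LieRing L] [LieAlgebra ℝ L]
  {ρ : L →ₗ⁅ℝ⁆ Derivation ℝ C C} {G : Type*} [AddCommGroup G] [Module ℝ G] [Module C G]

/-- Groups the arguments by curvature factor: `2 * l` and `2 * l + 1` are the slots of the factor
`l`. -/
theorem sum_fin_two_mul {N : Type*} [AddCommMonoid N] {p : ℕ} (g : Fin (2 * p) → N) :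
    ∑ q, g q = ∑ l : Fin p, (g ⟨2 * l, by omega⟩ + g ⟨2 * l + 1, by omega⟩) := by
  let e : Fin p × Fin 2 → Fin (2 * p) := fun x => ⟨2 * x.1 + x.2, by omega⟩
  have he : Function.Bijective e := by
    constructor
    · rintro ⟨a, b⟩ ⟨c, d⟩ h
      have := congrArg Fin.val h
      simp only [e] at this
      refine Prod.ext (Fin.ext ?_) (Fin.ext ?_) <;> simp only <;> omega
    · intro q
      refine ⟨(⟨(q : ℕ) / 2, by omega⟩, ⟨(q : ℕ) % 2, by omega⟩), Fin.ext ?_⟩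
      simp only [e]
      omega
  rw [← Fintype.sum_bijective e he (fun x => g (e x)) g fun _ => rfl, Fintype.sum_prod_type]
  simp [e]

variable [SMulCommClass C ℝ G] [SMulCommClass ℝ C G] [IsScalarTower ℝ C G]

/-- The factors `R(a_0, a_1), R(a_2, a_3), ...` of the product of curvatures. -/
def RConnection.curvatureFactors (D : RConnection ρ G) (p : ℕ) (a : Fin (2 * p) → L) :
    Fin p → Module.End C G :=
  fun i => D.curvature (a ⟨2 * i, by omega⟩) (a ⟨2 * i + 1, by omega⟩)

theorem RConnection.curvatureFactors_update_even (D : RConnection ρ G) (p : ℕ)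
    (a : Fin (2 * p) → L) (l : Fin p) (x : L) :
    D.curvatureFactors p (Function.update a ⟨2 * l, by omega⟩ x) =
      Function.update (D.curvatureFactors p a) l (D.curvature x (a ⟨2 * l + 1, by omega⟩)) := by
  funext i
  by_cases hi : i = l
  · subst hi
    simp [curvatureFactors]
  · have : (i : ℕ) ≠ l := fun h => hi (Fin.ext h)
    rw [Function.update_of_ne hi]
    simp only [curvatureFactors]
    rw [Function.update_of_ne, Function.update_of_ne] <;> simp only [ne_eq, Fin.mk.injEq] <;> omega

theorem RConnection.curvatureFactors_update_odd (D : RConnection ρ G) (p : ℕ)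
    (a : Fin (2 * p) → L) (l : Fin p) (x : L) :
    D.curvatureFactors p (Function.update a ⟨2 * l + 1, by omega⟩ x) =
      Function.update (D.curvatureFactors p a) l (D.curvature (a ⟨2 * l, by omega⟩) x) := by
  funext i
  by_cases hi : i = l
  · subst hi
    simp [curvatureFactors]
  · have : (i : ℕ) ≠ l := fun h => hi (Fin.ext h)
    rw [Function.update_of_ne hi]
    simp only [curvatureFactors]
    rw [Function.update_of_ne, Function.update_of_ne] <;> simp only [ne_eq, Fin.mk.injEq] <;> omega

theorem RConnection.curvaturePow_apply (D : RConnection ρ G) (p : ℕ) (a : Fin (2 * p) → L) :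
    D.curvaturePow p a = (1 / 2 ^ p : ℝ) •
      altSum (fun b => (List.ofFn (D.curvatureFactors p b)).prod) a := by
  rw [curvaturePow, AlternatingMap.smul_apply, MultilinearMap.alternatization_apply]
  rfl

theorem RConnection.chernForm_apply (Tr : Module.End C G →ₗ[ℝ] C) (D : RConnection ρ G) (p : ℕ)
    (a : Fin (2 * p) → L) : D.chernForm Tr p a =
      altSum (fun b => (1 / 2 ^ p : ℝ) • Tr (List.ofFn (D.curvatureFactors p b)).prod) a := by
  rw [altSum_smul, ← map_altSum Tr, ← map_smul, ← curvaturePow_apply]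
  rfl

/-- The Chern character form is closed if the trace is compatible with the connection. -/
theorem RConnection.differential_chernForm (Tr : Module.End C G →ₗ[ℝ] C) (D : RConnection ρ G)
    (hTr : ∀ a φ, Tr ((D.isCDO a).commutator φ) = ρ a (Tr φ)) (p : ℕ) :
    differential ρ (D.chernForm Tr p) = 0 := by
  ext1 a
  rw [differential_of_altSum ρ _ _ (D.chernForm_apply Tr p), AlternatingMap.zero_apply]
  let P : MultilinearMap ℝ (fun _ : Fin p => Module.End C G) C :=
    Tr.compMultilinearMap (MultilinearMap.mkPiAlgebraFin ℝ p (Module.End C G))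
  have hP : ∀ g : Fin p → Module.End C G, P g = Tr (List.ofFn g).prod := fun g => by
    simp [P, MultilinearMap.mkPiAlgebraFin_apply]
  let y : Fin p → Fin (2 * p) := fun l => ⟨2 * l, by omega⟩
  let z : Fin p → Fin (2 * p) := fun l => ⟨2 * l + 1, by omega⟩
  let h : Fin p → (Fin (2 * p + 1) → L) → C := fun l b =>
    P (Function.update (D.curvatureFactors p (Fin.tail b)) l
      (D.bianchiTerm (b 0) (b (y l).succ) (b (z l).succ)))
  -- The derivative of the trace is distributed over the factors by `hTr` and the Leibniz rule. The
  -- brackets in the slots `2 * l` and `2 * l + 1` change only the factor `l`, so they join the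
  -- commutator in that factor to form `bianchiTerm`.
  have h1 : ∀ b : Fin (2 * p + 1) → L,
      (ρ (b 0) ((1 / 2 ^ p : ℝ) • Tr (List.ofFn (D.curvatureFactors p (Fin.tail b))).prod) -
        (1 / 2 : ℝ) • ∑ q : Fin (2 * p), (1 / 2 ^ p : ℝ) • Tr (List.ofFn (D.curvatureFactors p
          (Function.update (Fin.tail b) q ⁅b 0, Fin.tail b q⁆))).prod) =
      (1 / 2 ^ p : ℝ) • ∑ l, h l b := by
    intro b
    rw [Derivation.map_smul, ← Finset.smul_sum, smul_comm (1 / 2 : ℝ), ← smul_sub]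
    congr 1
    rw [← hTr, IsCDO.commutator_prod, map_sum, sum_fin_two_mul, Finset.smul_sum,
      ← Finset.sum_sub_distrib]
    refine Finset.sum_congr rfl fun l _ => ?_
    simp only [curvatureFactors_update_even, curvatureFactors_update_odd]
    simp only [← hP, h, bianchiTerm]
    rw [MultilinearMap.map_update_sub, MultilinearMap.map_update_smul,
      MultilinearMap.map_update_add]
    rfl
  simp only [h1]
  rw [altSum_smul, altSum_sum, Finset.sum_eq_zero, smul_zero]
  intro l _
  have hy : (y l).succ ≠ 0 := Fin.succ_ne_zero _
  have hz : (z l).succ ≠ 0 := Fin.succ_ne_zero _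
  have hyz : (y l).succ ≠ (z l).succ := fun e => by
    have := congrArg Fin.val e
    simp [y, z] at this
  -- A three-cycle, hence even, on the differentiating argument and the two arguments of the factor
  -- `l`. It fixes the arguments of the other factors (`hF`), so multilinearity in the factor `l`
  -- reduces the cyclic identity to the Bianchi identity.
  let τ : Equiv.Perm (Fin (2 * p + 1)) := Equiv.swap 0 (y l).succ * Equiv.swap (y l).succ (z l).succ
  have τ0 : τ 0 = (y l).succ := by
    simp [τ, Equiv.swap_apply_of_ne_of_ne hy.symm hz.symm]
  have τy : τ (y l).succ = (z l).succ := by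
    simp [τ, Equiv.swap_apply_of_ne_of_ne hz hyz.symm]
  have τz : τ (z l).succ = 0 := by
    simp [τ]
  have τr : ∀ i, i ≠ 0 → i ≠ (y l).succ → i ≠ (z l).succ → τ i = i := fun i h1 h2 h3 => by
    simp [τ, Equiv.swap_apply_of_ne_of_ne h2 h3, Equiv.swap_apply_of_ne_of_ne h1 h2]
  have hF : ∀ (b : Fin (2 * p + 1) → L) (X : Module.End C G),
      Function.update (D.curvatureFactors p (Fin.tail (b ∘ τ))) l X =
        Function.update (D.curvatureFactors p (Fin.tail b)) l X := by
    intro b X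
    funext i
    by_cases hi : i = l
    · subst hi; simp
    · have : (i : ℕ) ≠ l := fun h => hi (Fin.ext h)
      rw [Function.update_of_ne hi, Function.update_of_ne hi]
      simp only [curvatureFactors, Fin.tail, Function.comp_apply]
      rw [τr, τr]
      all_goals simp only [ne_eq, Fin.ext_iff, Fin.val_succ, Fin.val_zero, y, z]; omega
  refine altSum_eq_zero_of_cyclic (h l) τ ?_ (fun b => ?_) a
  · rw [Equiv.Perm.sign_mul, Equiv.Perm.sign_swap hy.symm, Equiv.Perm.sign_swap hyz]
    simp
  · simp only [h, ← Function.comp_assoc, hF]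
    simp only [Function.comp_apply, τ0, τy, τz]
    rw [← MultilinearMap.map_update_add, ← MultilinearMap.map_update_add, D.bianchi]
    exact MultilinearMap.map_update_zero _ _ _

end ChernFormClosed

/-! ### Commutators with operators of rank one. -/

section DualDerivative

variable {C : Type*} [CommRing C] [Algebra ℝ C] {G : Type*} [AddCommGroup G] [Module ℝ G]
  [Module C G]

/-- The derivative `α ↦ X ∘ α - α ∘ ℓ` of a `C`-linear functional. -/
def IsCDO.dual {ℓ : Module.End ℝ G} {X : Derivation ℝ C C} (h : IsCDO ℓ X) (α : G →ₗ[C] C) :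
    G →ₗ[C] C where
  toFun s := X (α s) - α (ℓ s)
  map_add' s t := by simp only [map_add]; abel
  map_smul' f s := by
    simp only [map_smul, h _ _, map_add, RingHom.id_apply, smul_eq_mul, Derivation.leibniz]
    ring

/-- The Leibniz rule for the tensor product of `α` and `s`. Operators of rank one are the ones for
which the trace of a commutator can be read off. -/
theorem IsCDO.commutator_smulRight {ℓ : Module.End ℝ G} {X : Derivation ℝ C C} (h : IsCDO ℓ X)
    (α : G →ₗ[C] C) (s : G) :
    h.commutator (α.smulRight s) = (h.dual α).smulRight s + α.smulRight (ℓ s) := by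
  ext r
  simp only [commutator_apply, LinearMap.smulRight_apply, LinearMap.add_apply, h _ _, dual,
    LinearMap.coe_mk, AddHom.coe_mk, sub_smul]
  abel

theorem IsCDO.commutator_smul {ℓ : Module.End ℝ G} {X : Derivation ℝ C C} (h : IsCDO ℓ X)
    (f : C) (φ : Module.End C G) : h.commutator (f • φ) = f • h.commutator φ + X f • φ := by
  ext r
  simp only [commutator_apply, LinearMap.add_apply, LinearMap.smul_apply, h _ _, smul_sub]
  abel

theorem IsCDO.commutator_add {ℓ : Module.End ℝ G} {X : Derivation ℝ C C} (h : IsCDO ℓ X)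
    (φ ψ : Module.End C G) : h.commutator (φ + ψ) = h.commutator φ + h.commutator ψ := by
  ext r
  simp only [commutator_apply, LinearMap.add_apply, map_add]
  abel

/-- `φ ↦ [ℓ, φ]` as an additive map. -/
def IsCDO.commutatorHom {ℓ : Module.End ℝ G} {X : Derivation ℝ C C} (h : IsCDO ℓ X) :
    Module.End C G →+ Module.End C G :=
  AddMonoidHom.mk' h.commutator h.commutator_add

end DualDerivative

/-! ### The fibrewise trace and its compatibility with connections. -/

section Trace

variable {V : Type*} [NormedAddCommGroup V] [NormedSpace ℝ V] [FiniteDimensional ℝ V]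
  {H : Type*} [TopologicalSpace H]
  {I : ModelWithCorners ℝ V H} {M : Type*} [TopologicalSpace M] [ChartedSpace H M]
  [IsManifold I ∞ M] [T2Space M]
  {F : Type*} [NormedAddCommGroup F] [NormedSpace ℝ F] [FiniteDimensional ℝ F] {E : M → Type*}
  [TopologicalSpace (TotalSpace F E)] [∀ x, AddCommGroup (E x)] [∀ x, Module ℝ (E x)]
  [∀ x, TopologicalSpace (E x)] [FiberBundle F E] [VectorBundle ℝ F E]
  [ContMDiffVectorBundle ∞ F E I]

theorem fiberTrace_apply (φ : Module.End C^∞⟮I, M; ℝ⟯ Cₛ^∞⟮I; F, E⟯) (x : M) :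
    fiberTrace φ x = LinearMap.trace ℝ (E x) (fiberMap φ x) := rfl

theorem fiberTrace_smul (f : C^∞⟮I, M; ℝ⟯) (φ : Module.End C^∞⟮I, M; ℝ⟯ Cₛ^∞⟮I; F, E⟯) :
    fiberTrace (f • φ) = f * fiberTrace φ := by
  ext x
  have h : fiberMap (f • φ) x = f x • fiberMap φ x :=
    fiberMap_unique fun s => by simp [fiberMap_apply]
  rw [fiberTrace_apply, h, map_smul]
  rfl

/-- Near `x₀` the identity of `Γ(E)` is a finite sum of operators of rank one. -/
theorem exists_dual_frame (x₀ : M) : ∃ (n : ℕ) (ψ : C^∞⟮I, M; ℝ⟯) (e : Fin n → Cₛ^∞⟮I; F, E⟯)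
    (c : Fin n → Cₛ^∞⟮I; F, E⟯ →ₗ[C^∞⟮I, M; ℝ⟯] C^∞⟮I, M; ℝ⟯),
    (∀ s, ψ • s = ∑ i, c i s • e i) ∧ (∀ᶠ x in 𝓝 x₀, ψ x = 1) ∧
    ∀ φ : Module.End C^∞⟮I, M; ℝ⟯ Cₛ^∞⟮I; F, E⟯, fiberTrace φ x₀ = ∑ i, c i (φ (e i)) x₀ := by
  obtain ⟨n, ψ, e, c, hc, hψ, h1⟩ := exists_local_frame I F E x₀
  let c' : Fin n → Cₛ^∞⟮I; F, E⟯ →ₗ[C^∞⟮I, M; ℝ⟯] C^∞⟮I, M; ℝ⟯ := fun i =>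
    { toFun := fun s => ⟨fun y => c i y (s y), (hc i).comp s.contMDiff⟩
      map_add' := fun s t => by ext y; exact map_add (c i y) (s y) (t y)
      map_smul' := fun f s => by ext y; exact map_smul (c i y) (f y) (s y) }
  refine ⟨n, ψ, e, c', fun s => ?_, h1, fun φ => ?_⟩
  · ext y
    rw [sum_section_apply]
    exact hψ y (s y)
  · have hfd : FiniteDimensional ℝ (E x₀) := VectorBundle.finiteDimensional ℝ F E x₀
    have : fiberMap φ x₀ = ∑ i, (c i x₀).smulRight (φ (e i) x₀) := by
      ext v
      have hv := hψ x₀ v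
      rw [h1.self_of_nhds, one_smul] at hv
      conv_lhs => rw [hv]
      simp [map_sum, fiberMap_apply]
    rw [fiberTrace_apply, this, map_sum]
    simp only [LinearMap.trace_smulRight]
    rfl

theorem sum_fun_apply {n : ℕ} (f : Fin n → C^∞⟮I, M; ℝ⟯) (x : M) : (∑ i, f i) x = ∑ i, f i x :=
  (congrFun (map_sum (ContMDiffMap.coeFnAddMonoidHom : C^∞⟮I, M; ℝ⟯ →+ M → ℝ) f Finset.univ) x).trans
    (Finset.sum_apply _ _ _)

/-- In a local frame both sides are `∑ i, c i s * α (e i)` at the point `x`, where the cutoff is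
`1`. -/
theorem fiberTrace_smulRight (α : Cₛ^∞⟮I; F, E⟯ →ₗ[C^∞⟮I, M; ℝ⟯] C^∞⟮I, M; ℝ⟯)
    (s : Cₛ^∞⟮I; F, E⟯) : fiberTrace (α.smulRight s) = α s := by
  ext x
  obtain ⟨n, ψ, e, c, hψ, h1, htr⟩ := exists_dual_frame (I := I) (F := F) (E := E) x
  have h2 := congrArg (fun r => α r x) (hψ s)
  simp only [map_smul, map_sum, sum_fun_apply, smul_eq_mul, ContMDiffMap.coe_mul, Pi.mul_apply,
    h1.self_of_nhds, one_mul] at h2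
  rw [htr, h2]
  refine Finset.sum_congr rfl fun i _ => ?_
  rw [LinearMap.smulRight_apply, map_smul, smul_eq_mul, mul_comm]
  rfl

/-- The trace of `[∇, φ]` is the derivative of the trace of `φ`. -/
theorem fiberTrace_commutator {ℓ : Module.End ℝ Cₛ^∞⟮I; F, E⟯} {X : VectorFields I M}
    (h : IsCDO ℓ (vectorFieldDerivation X)) (φ : Module.End C^∞⟮I, M; ℝ⟯ Cₛ^∞⟮I; F, E⟯) :
    fiberTrace (h.commutator φ) = vectorFieldDerivation X (fiberTrace φ) := by
  ext x
  obtain ⟨n, ψ, e, c, hψ, h1, -⟩ := exists_dual_frame (I := I) (F := F) (E := E) x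
  -- The frame is local, so it is `ψ • φ`, and not `φ`, that is a finite sum of operators of rank
  -- one.
  have h2 : ψ • φ = ∑ i, (c i).smulRight (φ (e i)) := by
    ext1 s
    rw [LinearMap.smul_apply, ← map_smul, hψ, map_sum, LinearMap.sum_apply]
    simp only [map_smul, LinearMap.smulRight_apply]
  -- For the tensor product of `α` and `s` the trace of the commutator is `(X (α s) - α (ℓ s)) + α
  -- (ℓ s)`.
  have h3 : fiberTrace (h.commutator (ψ • φ)) = vectorFieldDerivation X (fiberTrace (ψ • φ)) := by
    rw [h2]
    change fiberTrace (h.commutatorHom (∑ i, (c i).smulRight (φ (e i)))) = _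
    rw [map_sum, map_sum, map_sum, map_sum]
    refine Finset.sum_congr rfl fun i _ => ?_
    change fiberTrace (h.commutator ((c i).smulRight (φ (e i)))) = _
    rw [h.commutator_smulRight, map_add, fiberTrace_smulRight, fiberTrace_smulRight,
      fiberTrace_smulRight]
    exact sub_add_cancel _ _
  -- The cutoff is `1` near `x`, so its derivative vanishes there and the Leibniz rule on both sides
  -- of `h3` removes it.
  have h4 : vectorFieldDerivation X ψ x = 0 := by
    have hx' : (ψ : M → ℝ) =ᶠ[𝓝 x] fun _ => 1 := h1
    rw [vectorFieldDerivation_apply, hx'.mfderiv_eq, mfderiv_const]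
    rfl
  rw [h.commutator_smul, map_add, fiberTrace_smul, fiberTrace_smul, fiberTrace_smul,
    Derivation.leibniz] at h3
  have h5 := congrArg (fun f : C^∞⟮I, M; ℝ⟯ => f x) h3
  simp only [ContMDiffMap.coe_add, ContMDiffMap.coe_mul, Pi.add_apply, Pi.mul_apply, h4,
    smul_eq_mul, h1.self_of_nhds] at h5
  linarith

end Trace

/-! ### Closedness for connections on `E` and for their affine combination. -/

section Closed

variable {V : Type*} [NormedAddCommGroup V] [NormedSpace ℝ V] [FiniteDimensional ℝ V]
  {M : Type*} [TopologicalSpace M] [ChartedSpace V M] [IsManifold 𝓘(ℝ, V) ∞ M] [T2Space M]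
  {FA : Type*} [NormedAddCommGroup FA] [NormedSpace ℝ FA] [FiniteDimensional ℝ FA] {A : M → Type*}
  [TopologicalSpace (TotalSpace FA A)] [∀ x, AddCommGroup (A x)] [∀ x, Module ℝ (A x)]
  [∀ x, TopologicalSpace (A x)] [FiberBundle FA A] [VectorBundle ℝ FA A]
  [ContMDiffVectorBundle ∞ FA A 𝓘(ℝ, V)] [LieAlgebroid 𝓘(ℝ, V) FA A]
  {FE : Type*} [NormedAddCommGroup FE] [NormedSpace ℝ FE] [FiniteDimensional ℝ FE] {E : M → Type*}
  [TopologicalSpace (TotalSpace FE E)] [∀ x, AddCommGroup (E x)] [∀ x, Module ℝ (E x)]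
  [∀ x, TopologicalSpace (E x)] [FiberBundle FE E] [VectorBundle ℝ FE E]
  [ContMDiffVectorBundle ∞ FE E 𝓘(ℝ, V)]

/-- The Chern character forms of a connection of `A` on `E` are closed. -/
theorem differential_chernForm_fiberTrace
    (D : RConnection (anchorHom 𝓘(ℝ, V) FA A) Cₛ^∞⟮𝓘(ℝ, V); FE, E⟯) (p : ℕ) :
    differential (anchorHom 𝓘(ℝ, V) FA A) (D.chernForm fiberTrace p) = 0 :=
  D.differential_chernForm fiberTrace (fun a φ =>
    fiberTrace_commutator (X := LieAlgebroid.anchor.onSections a) (D.isCDO a) φ) p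

/-- The Chern character forms of the affine combination of connections are closed. -/
theorem differential_chernForm_affineConnection {k : ℕ}
    (D : Fin (k + 1) → RConnection (anchorHom 𝓘(ℝ, V) FA A) Cₛ^∞⟮𝓘(ℝ, V); FE, E⟯) (p : ℕ) :
    differential (prodAnchorHom (V := V) k FA A)
      ((affineConnection D).chernForm fiberTrace p) = 0 :=
  (affineConnection D).differential_chernForm fiberTrace (fun a φ =>
    fiberTrace_commutator (X := prodVectorField a.1 (LieAlgebroid.anchor.onSections a.2))
      ((affineConnection D).isCDO a) φ) p

end Closed

/-! ### Removing entries from concatenated tuples. -/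

section Tuples

variable {L : Type*} {k m : ℕ}

theorem removeNth_comp_cast {n n' : ℕ} (h : n = n') (w : Fin (n' + 1) → L) (i : Fin (n + 1)) :
    i.removeNth (w ∘ Fin.cast (congrArg (· + 1) h)) =
      (Fin.cast (congrArg (· + 1) h) i).removeNth w ∘ Fin.cast h := by
  subst h
  rfl

/-- The cast is there because `k + 1 + m` and `k + m + 1` are not definitionally equal. -/
theorem append_succ_left (u : Fin (k + 1) → L) (a : Fin m → L) :
    Fin.append u a = (Fin.cons (u 0) (Fin.append (Fin.tail u) a) : Fin (k + m + 1) → L) ∘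
      Fin.cast (Nat.succ_add k m) := by
  funext i
  refine Fin.addCases (fun i => ?_) (fun i => ?_) i
  · rw [Fin.append_left]
    refine Fin.cases ?_ (fun i => ?_) i
    · rfl
    · have : Fin.cast (Nat.succ_add k m) (Fin.castAdd m i.succ) = (Fin.castAdd m i).succ := rfl
      rw [Function.comp_apply, this, Fin.cons_succ, Fin.append_left]
      rfl
  · have : Fin.cast (Nat.succ_add k m) (Fin.natAdd (k + 1) i) = (Fin.natAdd k i).succ :=
      Fin.ext (by simp; omega)
    rw [Fin.append_right, Function.comp_apply, this, Fin.cons_succ, Fin.append_right]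

theorem removeNth_castAdd_append (u : Fin (k + 1) → L) (a : Fin (m + 1) → L) (j : Fin (k + 1)) :
    (Fin.castAdd (m + 1) j : Fin (k + 1 + m + 1)).removeNth
      (Fin.append (m := k + 1) (n := m + 1) u a) =
      Fin.append (j.removeNth u) a ∘ Fin.cast (by omega : k + 1 + m = k + (m + 1)) := by
  have hk : k + 1 + m = k + (m + 1) := Nat.succ_add_eq_add_succ k m
  funext i
  obtain ⟨i, rfl⟩ : ∃ i' : Fin (k + (m + 1)), Fin.cast hk.symm i' = i := ⟨Fin.cast hk i, rfl⟩
  refine Fin.addCases (fun i => ?_) (fun i => ?_) i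
  · have h : (Fin.castAdd (m + 1) j : Fin (k + 1 + m + 1)).succAbove
        (Fin.cast hk.symm (Fin.castAdd (m + 1) i)) = Fin.castAdd (m + 1) (j.succAbove i) := by
      ext
      simp only [Fin.succAbove, Fin.lt_def, Fin.val_castSucc, Fin.val_cast, Fin.val_castAdd]
      split <;> simp
    rw [Fin.removeNth, h]
    simp [Fin.removeNth]
  · have h : (Fin.castAdd (m + 1) j : Fin (k + 1 + m + 1)).succAbove
        (Fin.cast hk.symm (Fin.natAdd k i)) = Fin.natAdd (k + 1) i := by
      ext
      simp only [Fin.succAbove, Fin.lt_def, Fin.val_castSucc, Fin.val_cast, Fin.val_castAdd,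
        Fin.val_natAdd]
      rw [if_neg (by omega)]
      simp
      omega
    rw [Fin.removeNth, h]
    simp

end Tuples

/-! ### Naturality of the differential and Cartan's formula. -/

section Cartan

variable {C L : Type*} [CommRing C] [Algebra ℝ C] [LieRing L] [LieAlgebra ℝ L]
  (ρ : L →ₗ⁅ℝ⁆ Derivation ℝ C C)

theorem differential_domDomCongr {n n' : ℕ} (h : n = n') (η : L [⋀^Fin n]→ₗ[ℝ] C)
    (a : Fin (n' + 1) → L) :
    differential ρ (AlternatingMap.domDomCongr (finCongr h) η) a =
      differential ρ η (a ∘ Fin.cast (congrArg (· + 1) h)) := by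
  subst h
  rfl

/-- The differential commutes with morphisms of Lie algebras acting on commutative algebras. -/
theorem differential_naturality {C' L' : Type*} [CommRing C'] [Algebra ℝ C'] [LieRing L']
    [LieAlgebra ℝ L'] (ρ' : L' →ₗ⁅ℝ⁆ Derivation ℝ C' C') (lam : L' →ₗ⁅ℝ⁆ L) (J : C →ₗ[ℝ] C')
    (hJ : ∀ a f, J (ρ (lam a) f) = ρ' a (J f)) {n : ℕ} (η : L [⋀^Fin n]→ₗ[ℝ] C)
    (η' : L' [⋀^Fin n]→ₗ[ℝ] C') (hη : ∀ v, η' v = J (η (lam ∘ v))) (a : Fin (n + 1) → L') :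
    differential ρ' η' a = J (differential ρ η (lam ∘ a)) := by
  cases n with
  | zero =>
    rw [differential_zero_apply, differential_zero_apply, Function.comp_apply, hJ, hη]
    congr 3
    exact Subsingleton.elim _ _
  | succ n =>
    rw [differential_succ_apply, differential_succ_apply]
    simp only [map_add, map_sum, map_zsmul, hη, Function.comp_apply, hJ]
    congr 1
    refine Finset.sum_congr rfl fun i _ => Finset.sum_congr rfl fun j _ => ?_
    congr 3
    funext l
    refine Fin.cases ?_ (fun l => ?_) l
    · simp
    · rfl

/-- Cartan's formula for an element that commutes with all the arguments. -/
theorem differential_cons {n : ℕ} (η : L [⋀^Fin (n + 1)]→ₗ[ℝ] C) (b : L) (v : Fin (n + 1) → L)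
    (hb : ∀ i, ⁅b, v i⁆ = 0) :
    differential ρ η (Fin.cons b v) = ρ b (η v) - differential ρ (η.curryLeft b) v := by
  have hr : ∀ i : Fin (n + 1), (i.succ.removeNth (Fin.cons b v : Fin (n + 2) → L)) =
      Fin.cons b (i.removeNth v) := fun i => by
    funext l
    refine Fin.cases ?_ (fun l => ?_) l
    · simp [Fin.removeNth]
    · simp [Fin.removeNth]
  rw [differential_succ_apply]
  refine (congrArg₂ (· + ·) (Fin.sum_univ_succ _) (Fin.sum_univ_succ _)).trans ?_
  -- The pairs that contain `b` contribute nothing, since `b` commutes with every `v i`.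
  have h0 : ∑ j ≥ (0 : Fin (n + 1)), (-1 : ℤ) ^ (((0 : Fin (n + 1)).castSucc : ℕ) + (j.succ : ℕ)) •
      η (Matrix.vecCons ⁅(Fin.cons b v : Fin (n + 2) → L) (0 : Fin (n + 1)).castSucc,
        (Fin.cons b v : Fin (n + 2) → L) j.succ⁆
          (j.removeNth ((0 : Fin (n + 1)).castSucc.removeNth (Fin.cons b v : Fin (n + 2) → L)))) = 0 := by
    refine Finset.sum_eq_zero fun j _ => ?_
    rw [Fin.castSucc_zero, Fin.cons_zero, Fin.cons_succ, hb,
      η.map_coord_zero (i := 0) (by simp), smul_zero]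
  rw [h0, zero_add, Fin.cons_zero]
  have h1 : (Fin.removeNth 0 (Fin.cons b v : Fin (n + 2) → L)) = v := by
    funext l
    simp [Fin.removeNth]
  rw [h1]
  simp only [hr, Fin.cons_succ, Fin.val_zero, pow_zero, one_smul, Fin.val_succ]
  -- The contraction with `b` has degree `n`, and the differential has a separate clause without
  -- brackets in degree `0`.
  cases n with
  | zero =>
    rw [differential_zero_apply]
    have h2 : (Fin.cons b (Fin.removeNth (0 : Fin (0 + 1)) v) : Fin (0 + 1) → L) =
        Matrix.vecCons b ![] := by
      funext l
      refine Fin.cases rfl (fun l => l.elim0) l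
    rw [Fin.sum_univ_succ, Fin.sum_univ_zero, Fin.sum_univ_zero, h2, AlternatingMap.curryLeft_apply_apply]
    simp [sub_eq_add_neg]
  | succ n =>
    rw [differential_succ_apply, sub_eq_add_neg, neg_add, add_assoc]
    congr 1
    rw [← Finset.sum_neg_distrib, ← Finset.sum_neg_distrib]
    congr 1
    · refine Finset.sum_congr rfl fun i _ => ?_
      rw [pow_succ, mul_neg_one, neg_smul]
      rfl
    · refine Finset.sum_congr rfl fun i _ => ?_
      have hs' : Finset.Ici i.succ = (Finset.Ici i).map (Fin.succEmb (n + 1)) := by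
        simp
      rw [← Finset.sum_neg_distrib]
      rw [hs', Finset.sum_map]
      refine Finset.sum_congr rfl fun j _ => ?_
      rw [← smul_neg]
      -- Both indices of a pair are raised by one because of the leading `b`, which does not affect
      -- the sign. The minus sign of the formula comes from interchanging `b` with the bracket in
      -- front of it.
      have hz : (-1 : ℤ) ^ ((i.succ.castSucc : ℕ) + (((Fin.succEmb (n + 1)) j : Fin (n + 2)) + 1 : ℕ)) =
          (-1) ^ ((i.castSucc : ℕ) + (j + 1 : ℕ)) := by
        simp only [Fin.val_castSucc, Fin.val_succ, Fin.coe_succEmb]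
        ring
      rw [hz]
      congr 1
      have h3 : Fin.removeNth ((Fin.succEmb (n + 1)) j) (Fin.removeNth i.succ.castSucc
          (Fin.cons b v : Fin (n + 3) → L)) =
          Matrix.vecCons b (j.removeNth (i.castSucc.removeNth v)) := by
        rw [← Fin.succ_castSucc, hr]
        funext l
        refine Fin.cases ?_ (fun l => ?_) l
        · simp [Fin.removeNth]
        · simp [Fin.removeNth]
      rw [h3]
      have h4 := η.map_swap (Matrix.vecCons b (Matrix.vecCons ⁅v i.castSucc, v j.succ⁆
        (j.removeNth (i.castSucc.removeNth v)))) (i := 0) (j := 1) (by simp)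
      rw [AlternatingMap.curryLeft_apply_apply, ← h4]
      congr 1
      funext l
      refine Fin.cases ?_ (fun l => ?_) l
      · simp
      · refine Fin.cases ?_ (fun l => ?_) l
        · simp
        · rw [Function.comp_apply, Equiv.swap_apply_of_ne_of_ne]
          · rfl
          · exact Fin.succ_ne_zero _
          · exact fun h => Fin.succ_ne_zero l (Fin.succ_injective _ h)

/-- The interior product of an alternating form with a tuple. -/
def interior : {k m : ℕ} → (Fin k → L) → L [⋀^Fin (k + m)]→ₗ[ℝ] C → L [⋀^Fin m]→ₗ[ℝ] C
  | 0, m, _, η => AlternatingMap.domDomCongr (finCongr (zero_add m)) η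
  | k + 1, m, u, η => interior (Fin.tail u)
      ((AlternatingMap.domDomCongr (finCongr (Nat.succ_add k m)) η).curryLeft (u 0))

theorem interior_apply {k m : ℕ} (u : Fin k → L) (η : L [⋀^Fin (k + m)]→ₗ[ℝ] C) (a : Fin m → L) :
    interior u η a = η (Fin.append u a) := by
  induction k with
  | zero =>
    rw [interior, AlternatingMap.domDomCongr_apply]
    congr 1
    funext i
    refine Fin.addCases (fun i => i.elim0) (fun i => ?_) i
    rw [Fin.append_right]
    simp
  | succ k ih =>
    rw [interior, ih, AlternatingMap.curryLeft_apply_apply, AlternatingMap.domDomCongr_apply,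
      append_succ_left]
    rfl

/-- Cartan's formula for a tuple of commuting elements that commute with the other arguments. -/
theorem differential_append {k m : ℕ} (u : Fin k → L) (η : L [⋀^Fin (k + m)]→ₗ[ℝ] C)
    (a : Fin (m + 1) → L) (hu : ∀ i j, ⁅u i, u j⁆ = 0) (ha : ∀ i j, ⁅u i, a j⁆ = 0) :
    differential ρ η (Fin.append (m := k) (n := m + 1) u a) =
      (∑ j : Fin k, (-1 : ℤ) ^ (j : ℕ) • ρ (u j)
        (η ((Fin.castAdd (m + 1) j : Fin (k + m + 1)).removeNth
          (Fin.append (m := k) (n := m + 1) u a)))) +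
      (-1 : ℤ) ^ k • differential ρ (interior u η) a := by
  induction k with
  | zero =>
    simp only [Finset.univ_eq_empty, Finset.sum_empty, zero_add, pow_zero, one_smul, interior]
    rw [differential_domDomCongr]
    congr 1
    funext i
    refine Fin.addCases (fun i => i.elim0) (fun i => ?_) i
    rw [Fin.append_right, Function.comp_apply]
    congr 1
    ext
    simp
  | succ k ih =>
    set η' := AlternatingMap.domDomCongr (finCongr (Nat.succ_add k m)) η with hη'
    have hη : ∀ w : Fin (k + m + 1) → L, η (w ∘ Fin.cast (Nat.succ_add k m)) = η' w := fun w => rfl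
    have e1 : (Fin.append (m := k + 1) (n := m + 1) u a : Fin (k + 1 + m + 1) → L) =
        (Fin.cons (u 0) (Fin.append (m := k) (n := m + 1) (Fin.tail u) a) :
          Fin (k + m + 1 + 1) → L) ∘
        Fin.cast (congrArg (· + 1) (Nat.succ_add k m)) := append_succ_left u a
    have hc : ∀ i : Fin (k + m + 1),
        ⁅u 0, Fin.append (m := k) (n := m + 1) (Fin.tail u) a i⁆ = 0 := by
      intro i
      refine Fin.addCases (m := k) (n := m + 1) (fun i => ?_) (fun i => ?_) i
      · exact (congrArg _ (Fin.append_left _ _ _)).trans (hu _ _)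
      · exact (congrArg _ (Fin.append_right _ _ _)).trans (ha _ _)
    have e2 : ∀ j : Fin (k + 1), η ((Fin.castAdd (m + 1) j : Fin (k + 1 + m + 1)).removeNth
        (Fin.append (m := k + 1) (n := m + 1) u a)) = η' ((Fin.cast (congrArg (· + 1)
          (Nat.succ_add k m)) (Fin.castAdd (m + 1) j : Fin (k + 1 + m + 1))).removeNth
            (Fin.cons (u 0) (Fin.append (m := k) (n := m + 1) (Fin.tail u) a) :
              Fin (k + m + 1 + 1) → L)) := by
      intro j
      rw [e1, ← hη]
      congr 1
      exact removeNth_comp_cast (Nat.succ_add k m) _ _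
    simp only [e2]
    rw [e1]
    rw [← differential_domDomCongr ρ (Nat.succ_add k m) η, ← hη']
    -- The minus sign in front of the contracted form raises by one the exponents `j` and `k` that
    -- the induction hypothesis provides.
    refine (differential_cons ρ η' (u 0) _ hc).trans ?_
    rw [ih (Fin.tail u) (η'.curryLeft (u 0)) (fun i j => hu _ _) (fun i j => ha _ _),
      Fin.sum_univ_succ]
    rw [sub_eq_add_neg, neg_add, ← add_assoc]
    congr 1
    · congr 1
      · simp only [Fin.val_zero, pow_zero, one_smul]
        congr 2
      · rw [← Finset.sum_neg_distrib]
        refine Finset.sum_congr rfl fun j _ => ?_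
        rw [Fin.val_succ, pow_succ, mul_neg_one, neg_smul, AlternatingMap.curryLeft_apply_apply]
        congr 4
        funext l
        refine Fin.cases ?_ (fun l => ?_) l
        · rfl
        · symm
          have : (Fin.cast (congrArg (· + 1) (Nat.succ_add k m))
            (Fin.castAdd (m + 1) j.succ : Fin (k + 1 + m + 1)) : Fin (k + m + 1 + 1)) =
              (Fin.castAdd (m + 1) j : Fin (k + m + 1)).succ := rfl
          rw [this]
          simp [Fin.removeNth]
    · rw [pow_succ, mul_neg_one, neg_smul]
      rfl

end Cartan

/-! ### Alternating forms on the edges of a simplex. -/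

section Shear

variable {L N : Type*} [AddCommGroup L] [Module ℝ L] [AddCommGroup N] [Module ℝ N]

/-- In the multilinear expansion every term that picks some `c i • x` contains `x` twice, up to a
scalar. -/
theorem map_cons_add_smul {n : ℕ} (g : L [⋀^Fin (n + 1)]→ₗ[ℝ] N) (x : L) (w : Fin n → L)
    (c : Fin n → ℝ) :
    g (Matrix.vecCons x (w + fun i => c i • x)) = g (Matrix.vecCons x w) := by
  classical
  rw [← AlternatingMap.curryLeft_apply_apply, ← AlternatingMap.curryLeft_apply_apply]
  have h := (g.curryLeft x).toMultilinearMap.map_add_univ w (fun i => c i • x)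
  refine h.trans ?_
  rw [Finset.sum_eq_single Finset.univ]
  · simp only [Finset.piecewise_univ]
    rfl
  · intro s _ hs
    obtain ⟨i, hi⟩ : ∃ i, i ∉ s := by
      by_contra! h'
      exact hs (Finset.eq_univ_iff_forall.2 h')
    have h1 : s.piecewise w (fun i => c i • x) =
        Function.update (s.piecewise w (fun i => c i • x)) i (c i • x) := by
      rw [Function.eq_update_iff]
      simp [hi]
    change (g.curryLeft x) _ = 0
    rw [h1, AlternatingMap.map_update_smul, AlternatingMap.curryLeft_apply_apply,
      g.map_eq_zero_of_eq _ (i := 0) (j := i.succ) (by simp) (Fin.succ_ne_zero i).symm, smul_zero]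
  · simp

/-- The value of a form on the edges `e_{i+1} - e_0` of a simplex is the alternating sum of its
values on the faces of the tuple `e`. -/
theorem map_append_sub {k m : ℕ} (η : L [⋀^Fin (k + 1 + m)]→ₗ[ℝ] N) (φ : L →ₗ[ℝ] ℝ)
    (e : Fin (k + 1) → L) (a : Fin (m + 1) → L) (he : ∀ i, φ (e i) = 1) (ha : ∀ i, φ (a i) = 0) :
    η (Fin.append (fun i : Fin k => e i.succ - e 0) a ∘
        Fin.cast (by omega : k + 1 + m = k + (m + 1))) =
      ∑ j : Fin (k + 1), (-1 : ℤ) ^ (j : ℕ) •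
        η ((Fin.castAdd (m + 1) j : Fin (k + 1 + m + 1)).removeNth
          (Fin.append (m := k + 1) (n := m + 1) e a)) := by
  -- `Θ` is the wedge product of `φ` and `η`. On `(e, a)` it is the alternating sum on the right, as
  -- `φ` is `1` on `e` and `0` on `a`. Subtracting `e 0` from the other `e i` does not change its
  -- value, and then `φ` vanishes on all arguments but the first, so only the term on the left
  -- survives.
  let Θ := AlternatingMap.alternatizeUncurryFin (φ.smulRight η)
  have hΘ : ∀ w : Fin (k + 1 + m + 1) → L, Θ w = ∑ i : Fin (k + 1 + m + 1), (-1 : ℤ) ^ (i : ℕ) • φ (w i) • η (i.removeNth w) := fun w =>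
    AlternatingMap.alternatizeUncurryFin_apply _ _
  have hsum : ∀ e' : Fin (k + 1) → L, Θ (Fin.append (m := k + 1) (n := m + 1) e' a) = ∑ j : Fin (k + 1), (-1 : ℤ) ^ (j : ℕ) •
      φ (e' j) • η ((Fin.castAdd (m + 1) j : Fin (k + 1 + m + 1)).removeNth
          (Fin.append (m := k + 1) (n := m + 1) e' a)) := by
    intro e'
    rw [hΘ]
    refine (Fin.sum_univ_add (a := k + 1) (b := m + 1) _).trans ?_
    simp only [Fin.append_left, Fin.append_right, ha, zero_smul, smul_zero, Finset.sum_const_zero,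
      add_zero]
    rfl
  let e' : Fin (k + 1) → L := Fin.cons (e 0) fun i => e i.succ - e 0
  have h1 : Θ (Fin.append (m := k + 1) (n := m + 1) e' a) =
      Θ (Fin.append (m := k + 1) (n := m + 1) e a) := by
    let Θ' := AlternatingMap.domDomCongr (finCongr (Nat.succ_add k (m + 1))) Θ
    have h2 : ∀ f : Fin (k + 1) → L, Θ (Fin.append (m := k + 1) (n := m + 1) f a) =
        Θ' (Matrix.vecCons (f 0) (Fin.append (Fin.tail f) a)) := by
      intro f
      change Θ _ = Θ _
      congr 1
      exact append_succ_left f a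
    -- The coefficients are `-1` on the entries of `e` and `0` on those of `a`.
    rw [h2, h2, ← map_cons_add_smul Θ' (e 0) (Fin.append (Fin.tail e) a)
      (Fin.append (fun _ => -1) fun _ => 0)]
    congr 2
    funext i
    refine Fin.addCases (fun i => ?_) (fun i => ?_) i
    · simp [e', Fin.tail, sub_eq_add_neg]
    · simp
  rw [hsum, hsum, Fin.sum_univ_succ] at h1
  simp only [he, one_smul] at h1
  rw [← h1]
  have h3 : ∀ i : Fin k, φ (e' i.succ) = 0 := fun i => by simp [e', he]
  simp only [h3, zero_smul, smul_zero, Finset.sum_const_zero, add_zero, Fin.val_zero, pow_zero,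
    one_smul]
  rw [removeNth_castAdd_append]
  have h4 : φ (e' 0) = 1 := by simp [e', he]
  rw [h4, one_smul]
  congr 2

end Shear

/-! ### Differentiation under the integral over the simplex. -/

section DerivativeUnderIntegral

open MeasureTheory

variable {k : ℕ} {V : Type*} [NormedAddCommGroup V] [NormedSpace ℝ V] [FiniteDimensional ℝ V]

/-- Dominated convergence with a constant bound: the derivative in `y` is jointly continuous, hence
bounded on the product of the simplex with a small closed ball. The ball is compact because `V` has
finite dimension. -/
theorem hasFDerivAt_integral_simplex {U : Set V} (hU : IsOpen U) (g : (Fin k → ℝ) × V → ℝ)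
    (hg : ∀ t, ∀ y ∈ U, ContDiffAt ℝ ∞ g (t, y)) {y₀ : V} (hy₀ : y₀ ∈ U) :
    IntegrableOn (fun t => fderiv ℝ (fun y => g (t, y)) y₀) (simplex k) ∧
    HasFDerivAt (fun y => ∫ t in simplex k, g (t, y))
      (∫ t in simplex k, fderiv ℝ (fun y => g (t, y)) y₀) y₀ := by
  have hpr : ProperSpace V := FiniteDimensional.proper ℝ V
  -- The partial derivative as a restriction of the total derivative, so that its joint continuity
  -- is inherited from `fderiv ℝ g`.
  let F' : V → (Fin k → ℝ) → V →L[ℝ] ℝ := fun y t =>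
    (fderiv ℝ g (t, y)).comp (ContinuousLinearMap.inr ℝ (Fin k → ℝ) V)
  have hd : ∀ t, ∀ y ∈ U, HasFDerivAt (fun y => g (t, y)) (F' y t) y := fun t y hy =>
    ((hg t y hy).differentiableAt (by simp)).hasFDerivAt.comp y (hasFDerivAt_prodMk_right t y)
  have hc : ∀ t, ∀ y ∈ U, ContinuousAt (fun q : (Fin k → ℝ) × V => F' q.2 q.1) (t, y) := by
    intro t y hy
    have h1 : ContinuousAt (fderiv ℝ g) (t, y) :=
      ((hg t y hy).fderiv_right (m := 0) (by simp)).continuousAt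
    exact h1.clm_comp continuousAt_const
  have hcg : ∀ y ∈ U, Continuous fun t => g (t, y) := fun y hy =>
    continuous_iff_continuousAt.2 fun t =>
      (hg t y hy).continuousAt.comp (f := fun t => (t, y)) (by fun_prop)
  have hcF : Continuous fun t => F' y₀ t :=
    continuous_iff_continuousAt.2 fun t =>
      (hc t y₀ hy₀).comp (f := fun t => (t, y₀)) (by fun_prop)
  obtain ⟨r, hr, hrU⟩ := Metric.nhds_basis_closedBall.mem_iff.1 (hU.mem_nhds hy₀)
  obtain ⟨B, hB⟩ := ((isCompact_simplex k).prod
    (isCompact_closedBall y₀ r)).exists_bound_of_continuousOn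
    (f := fun q : (Fin k → ℝ) × V => F' q.2 q.1)
    fun q hq => (hc q.1 q.2 (hrU hq.2)).continuousWithinAt
  have hfd : (fun t => fderiv ℝ (fun y => g (t, y)) y₀) = F' y₀ :=
    funext fun t => (hd t y₀ hy₀).fderiv
  rw [hfd]
  refine ⟨hcF.continuousOn.integrableOn_compact (isCompact_simplex k), ?_⟩
  refine hasFDerivAt_integral_of_dominated_of_fderiv_le (bound := fun _ => B)
    (F := fun y t => g (t, y)) (F' := F') (Metric.closedBall_mem_nhds y₀ hr) ?_ ?_ ?_ ?_ ?_ ?_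
  · filter_upwards [hU.mem_nhds hy₀] with y hy using (hcg y hy).aestronglyMeasurable
  · exact (hcg y₀ hy₀).continuousOn.integrableOn_compact (isCompact_simplex k)
  · exact hcF.aestronglyMeasurable
  · filter_upwards [ae_restrict_mem (isCompact_simplex k).measurableSet] with t ht y hy
    exact hB (t, y) ⟨ht, hy⟩
  · exact integrableOn_const (isCompact_simplex k).measure_lt_top.ne
  · exact Filter.Eventually.of_forall fun t y hy => hd t y (hrU hy)

variable {M : Type*} [TopologicalSpace M] [ChartedSpace V M] [IsManifold 𝓘(ℝ, V) ∞ M]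
  [T2Space M]

/-- A vector field on `M` can be applied under the integral over the simplex. -/
theorem vectorFieldDerivation_integrateSimplex (X : VectorFields 𝓘(ℝ, V) M)
    (f : C^∞⟮𝓘(ℝ, Fin k → ℝ).prod 𝓘(ℝ, V), (Fin k → ℝ) × M; ℝ⟯) :
    vectorFieldDerivation X (integrateSimplex f) =
      integrateSimplex (vectorFieldDerivation (prodVectorField 0 X) f) := by
  ext x
  set φ := extChartAt 𝓘(ℝ, V) x
  set g : (Fin k → ℝ) × V → ℝ := fun q => f (q.1, φ.symm q.2)
  obtain ⟨hi, h⟩ := hasFDerivAt_integral_simplex (isOpen_extChartAt_target (I := 𝓘(ℝ, V)) x) g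
    (fun t y hy => contDiffAt_chart f t x hy) (mem_extChartAt_target x)
  have h1 : vectorFieldDerivation X (integrateSimplex f) x =
      fderiv ℝ (fun y => ∫ t in simplex k, g (t, y)) (φ x) (X x) :=
    mfderiv_eq_fderiv_chart (integrateSimplex f).mdifferentiableAt (X x)
  rw [h1, h.fderiv]
  refine (ContinuousLinearMap.integral_apply hi (X x : V)).trans ?_
  change _ = ∫ t in simplex k, vectorFieldDerivation (prodVectorField 0 X) f (t, x)
  congr 1
  funext t
  rw [prodVectorField_zero_left]
  exact (mfderiv_eq_fderiv_chart (slice f t).mdifferentiableAt (X x)).symm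

end DerivativeUnderIntegral

/-! ### Fubini's and Stokes' theorems for the standard simplex. -/

section Stokes

open MeasureTheory

variable {k : ℕ}

theorem insertNth_mem_simplex_iff (i : Fin (k + 1)) (x : ℝ) (r : Fin k → ℝ) :
    (i.insertNth x r : Fin (k + 1) → ℝ) ∈ simplex (k + 1) ↔
      r ∈ simplex k ∧ x ∈ Set.Icc 0 (1 - ∑ j, r j) := by
  simp only [simplex, Set.mem_ofPred_eq, Set.mem_Icc, Fin.forall_iff_succAbove i,
    Fin.sum_univ_succAbove _ i, Fin.insertNth_apply_same, Fin.insertNth_apply_succAbove]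
  constructor
  · rintro ⟨⟨h1, h2⟩, h3⟩
    exact ⟨⟨h2, by linarith⟩, h1, by linarith⟩
  · rintro ⟨⟨h1, h2⟩, h3, h4⟩
    exact ⟨⟨h3, h1⟩, by linarith⟩

/-- Fubini's theorem for the standard simplex. -/
theorem integral_simplex_succ (i : Fin (k + 1)) {f : (Fin (k + 1) → ℝ) → ℝ} (hf : Continuous f) :
    ∫ t in simplex (k + 1), f t =
      ∫ r in simplex k, ∫ x in (0 : ℝ)..(1 - ∑ j, r j), f (i.insertNth x r) := by
  have hm := (isCompact_simplex (k + 1)).measurableSet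
  have hmk := (isCompact_simplex k).measurableSet
  set e : ℝ × (Fin k → ℝ) ≃ᵐ (Fin (k + 1) → ℝ) :=
    (MeasurableEquiv.piFinSuccAbove (fun _ => ℝ) i).symm
  have hem : MeasurePreserving e :=
    (volume_preserving_piFinSuccAbove (fun _ : Fin (k + 1) => ℝ) i).symm _
  have he : ∀ q, e q = i.insertNth q.1 q.2 := fun q => rfl
  have hint : Integrable ((simplex (k + 1)).indicator f) :=
    (integrable_indicator_iff hm).2 (hf.continuousOn.integrableOn_compact (isCompact_simplex _))
  rw [← integral_indicator hm, ← hem.integral_comp e.measurableEmbedding, Measure.volume_eq_prod,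
    integral_prod_symm _ (by
      rw [← Measure.volume_eq_prod]
      exact (hem.integrable_comp_emb e.measurableEmbedding).2 hint),
    ← integral_indicator hmk]
  congr 1
  funext r
  by_cases hr : r ∈ simplex k
  · have h0 : 0 ≤ 1 - ∑ j, r j := sub_nonneg.2 hr.2
    rw [Set.indicator_of_mem hr, intervalIntegral.integral_of_le h0, ← integral_Icc_eq_integral_Ioc,
      ← integral_indicator measurableSet_Icc]
    congr 1
    funext x
    by_cases hx : x ∈ Set.Icc 0 (1 - ∑ j, r j)
    · rw [he, Set.indicator_of_mem ((insertNth_mem_simplex_iff i x r).2 ⟨hr, hx⟩),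
        Set.indicator_of_mem hx]
    · rw [he, Set.indicator_of_notMem fun h => hx ((insertNth_mem_simplex_iff i x r).1 h).2,
        Set.indicator_of_notMem hx]
  · rw [Set.indicator_of_notMem hr]
    refine (integral_congr_ae (Filter.Eventually.of_forall fun x => ?_)).trans (integral_zero _ _)
    simp only [he]
    exact Set.indicator_of_notMem (fun h => hr ((insertNth_mem_simplex_iff i x r).1 h).1) _

/-- The integral over the face opposite to the origin does not depend on the coordinate that is
used to parametrize it as a graph. -/
theorem integral_slanted_face (i : Fin (k + 1)) {f : (Fin (k + 1) → ℝ) → ℝ} (hf : Continuous f) :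
    ∫ s in simplex k, f (i.insertNth (1 - ∑ j, s j) s) =
      ∫ s in simplex k, f (Fin.cons (1 - ∑ j, s j) s) := by
  have hins : ∀ i : Fin (k + 1), Continuous fun s : Fin k → ℝ =>
      f (i.insertNth (1 - ∑ j, s j) s) := fun i => hf.comp (by fun_prop)
  cases k with
  | zero =>
    refine Fin.cases ?_ (fun i => i.elim0) i
    simp only [Fin.insertNth_zero']
  | succ k =>
    refine Fin.cases ?_ (fun i => ?_) i
    · simp only [Fin.insertNth_zero']
    · have h0 := hins 0
      simp only [Fin.insertNth_zero'] at h0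
      rw [integral_simplex_succ 0 (hins i.succ), integral_simplex_succ i h0]
      congr 1
      funext r
      -- After Fubini the two integrands run through the same points of the face for fixed `r`. The
      -- inner variables are the coordinates `0` and `i.succ`, whose sum is `1 - ∑ j, r j`, so a
      -- reflection of the interval of integration exchanges them.
      have h1 : ∀ x : ℝ, f (i.succ.insertNth
          (1 - ∑ j, (Fin.insertNth 0 x r : Fin (k + 1) → ℝ) j) (Fin.insertNth 0 x r)) =
          (fun y => f (Fin.cons (1 - ∑ j, (i.insertNth y r : Fin (k + 1) → ℝ) j)
            (i.insertNth y r))) ((1 - ∑ j, r j) - x) := by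
        intro x
        have hs : ∀ y, ∑ j, (i.insertNth y r : Fin (k + 1) → ℝ) j = y + ∑ j, r j := fun y => by
          rw [Fin.sum_univ_succAbove _ i]
          simp
        simp only [hs, Fin.insertNth_zero', Fin.sum_cons]
        congr 1
        funext l
        refine Fin.cases ?_ (fun l => ?_) l
        · simp only [Fin.insertNth_succ_cons, Fin.cons_zero]
          ring
        · simp [Fin.insertNth_succ_cons, sub_sub, add_comm]
      simp only [h1]
      rw [intervalIntegral.integral_comp_sub_left (fun y => f (Fin.cons (1 - ∑ j,
        (i.insertNth y r : Fin (k + 1) → ℝ) j) (i.insertNth y r)))]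
      simp

/-- Stokes' theorem for the standard simplex and the differential form
`(-1)^j f dt_0 ... (omit dt_j) ... dt_k`. -/
theorem integral_simplex_fderiv (j : Fin (k + 1)) {f : (Fin (k + 1) → ℝ) → ℝ}
    (hf : ContDiff ℝ ∞ f) :
    ∫ t in simplex (k + 1), fderiv ℝ f t (Pi.single j 1) =
      (∫ s in simplex k, f (Fin.cons (1 - ∑ i, s i) s)) -
        ∫ s in simplex k, f (j.insertNth 0 s) := by
  have hc : Continuous fun t => fderiv ℝ f t (Pi.single j 1) :=
    (hf.continuous_fderiv (by simp)).clm_apply continuous_const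
  have h1 : Continuous fun s : Fin k → ℝ => f (j.insertNth (1 - ∑ i, s i) s) :=
    hf.continuous.comp (by fun_prop)
  have h2 : Continuous fun s : Fin k → ℝ => f (j.insertNth 0 s) :=
    hf.continuous.comp (by fun_prop)
  -- The coordinate `j` is integrated first. The upper end of its interval lies on the face opposite
  -- to the origin, as a graph over the other coordinates; `integral_slanted_face` passes to a
  -- parametrization that is the same for all `j`.
  rw [integral_simplex_succ j hc, ← integral_slanted_face j hf.continuous, ← integral_sub
    (h1.continuousOn.integrableOn_compact (isCompact_simplex k))
    (h2.continuousOn.integrableOn_compact (isCompact_simplex k))]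
  congr 1
  funext r
  have hd : ∀ x : ℝ, HasDerivAt (fun x => f (j.insertNth x r))
      (fderiv ℝ f (j.insertNth x r) (Pi.single j 1)) x := by
    intro x
    have hl : HasDerivAt (fun x : ℝ => (j.insertNth x r : Fin (k + 1) → ℝ)) (Pi.single j 1) x := by
      rw [hasDerivAt_pi]
      intro i
      refine Fin.succAboveCases j ?_ (fun i => ?_) i
      · simp only [Fin.insertNth_apply_same, Pi.single_eq_same]
        exact hasDerivAt_id' x
      · simpa using hasDerivAt_const x (r i)
    exact ((hf.differentiable (by simp)) _).hasFDerivAt.comp_hasDerivAt x hl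
  refine intervalIntegral.integral_eq_sub_of_hasDerivAt (fun x _ => hd x) ?_
  exact (hc.comp (by fun_prop : Continuous fun x : ℝ =>
    (j.insertNth x r : Fin (k + 1) → ℝ))).intervalIntegrable _ _

end Stokes

/-! ### Chern character forms of intertwined connections. -/

section Naturality

variable {V : Type*} [NormedAddCommGroup V] [NormedSpace ℝ V] [FiniteDimensional ℝ V]
  {H : Type*} [TopologicalSpace H]
  {I : ModelWithCorners ℝ V H} {M : Type*} [TopologicalSpace M] [ChartedSpace H M]
  [IsManifold I ∞ M] [T2Space M]
  {F : Type*} [NormedAddCommGroup F] [NormedSpace ℝ F] [FiniteDimensional ℝ F] {E : M → Type*}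
  [TopologicalSpace (TotalSpace F E)] [∀ x, AddCommGroup (E x)] [∀ x, Module ℝ (E x)]
  [∀ x, TopologicalSpace (E x)] [FiberBundle F E] [VectorBundle ℝ F E]
  [ContMDiffVectorBundle ∞ F E I]
  {V' : Type*} [NormedAddCommGroup V'] [NormedSpace ℝ V'] [FiniteDimensional ℝ V']
  {H' : Type*} [TopologicalSpace H']
  {I' : ModelWithCorners ℝ V' H'} {M' : Type*} [TopologicalSpace M'] [ChartedSpace H' M']
  [IsManifold I' ∞ M'] [T2Space M']
  {F' : Type*} [NormedAddCommGroup F'] [NormedSpace ℝ F'] [FiniteDimensional ℝ F']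
  {E' : M' → Type*}
  [TopologicalSpace (TotalSpace F' E')] [∀ x, AddCommGroup (E' x)] [∀ x, Module ℝ (E' x)]
  [∀ x, TopologicalSpace (E' x)] [FiberBundle F' E'] [VectorBundle ℝ F' E']
  [ContMDiffVectorBundle ∞ F' E' I']

/-- Every vector of a fibre is the value of a global section, so the two endomorphisms of fibres are
conjugate under `e`. The map `r` may lose information away from `x`, as restriction to a face does.
-/
theorem fiberTrace_eq_of_intertwining {r : Cₛ^∞⟮I; F, E⟯ → Cₛ^∞⟮I'; F', E'⟯} {x : M} {x' : M'}
    (e : E x ≃ₗ[ℝ] E' x') (he : ∀ s, r s x' = e (s x))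
    (φ : Module.End C^∞⟮I, M; ℝ⟯ Cₛ^∞⟮I; F, E⟯) (φ' : Module.End C^∞⟮I', M'; ℝ⟯ Cₛ^∞⟮I'; F', E'⟯)
    (hφ : ∀ s, r (φ s) = φ' (r s)) : fiberTrace φ x = fiberTrace φ' x' := by
  have h : fiberMap φ' x' = e.conj (fiberMap φ x) := by
    ext v'
    obtain ⟨v, rfl⟩ := e.surjective v'
    obtain ⟨s, rfl⟩ := exists_section_eq (I := I) (F := F) x v
    rw [LinearEquiv.conj_apply_apply, LinearEquiv.symm_apply_apply, fiberMap_apply, ← he, ← he,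
      fiberMap_apply, hφ]
  rw [fiberTrace_apply, fiberTrace_apply, h, LinearMap.trace_conj']

variable {L L' : Type*} [LieRing L] [LieAlgebra ℝ L] [LieRing L'] [LieAlgebra ℝ L']
  {ρ : L →ₗ⁅ℝ⁆ Derivation ℝ C^∞⟮I, M; ℝ⟯ C^∞⟮I, M; ℝ⟯}
  {ρ' : L' →ₗ⁅ℝ⁆ Derivation ℝ C^∞⟮I', M'; ℝ⟯ C^∞⟮I', M'; ℝ⟯}

/-- If a map of sections intertwines two connections and is given at a point by an isomorphism of
fibres, then the Chern character forms agree at this point. -/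
theorem chernForm_eq_of_intertwining (D : RConnection ρ Cₛ^∞⟮I; F, E⟯)
    (D' : RConnection ρ' Cₛ^∞⟮I'; F', E'⟯) (lam : L' → L) (hlam : ∀ a b, lam ⁅a, b⁆ = ⁅lam a, lam b⁆)
    (r : Cₛ^∞⟮I; F, E⟯ →+ Cₛ^∞⟮I'; F', E'⟯)
    (hr : ∀ a s, r (D.toFun (lam a) s) = D'.toFun a (r s)) {x : M} {x' : M'}
    (e : E x ≃ₗ[ℝ] E' x') (he : ∀ s, r s x' = e (s x)) (p : ℕ) (a : Fin (2 * p) → L') :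
    D.chernForm fiberTrace p (lam ∘ a) x = D'.chernForm fiberTrace p a x' := by
  have hR : ∀ a b s, r (D.curvature (lam a) (lam b) s) = D'.curvature a b (r s) := fun a b s => by
    simp only [RConnection.curvature, LinearMap.coe_mk, AddHom.coe_mk, map_sub, hr, ← hlam]
  have hprod : ∀ (n : ℕ) (g : Fin n → Module.End C^∞⟮I, M; ℝ⟯ Cₛ^∞⟮I; F, E⟯)
      (g' : Fin n → Module.End C^∞⟮I', M'; ℝ⟯ Cₛ^∞⟮I'; F', E'⟯)
      (_ : ∀ i s, r (g i s) = g' i (r s)) (s : Cₛ^∞⟮I; F, E⟯),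
      r ((List.ofFn g).prod s) = (List.ofFn g').prod (r s) := by
    intro n
    induction n with
    | zero => intro g g' _ s; simp
    | succ n ih =>
      intro g g' hg s
      rw [List.ofFn_succ, List.ofFn_succ, List.prod_cons, List.prod_cons, Module.End.mul_apply,
        Module.End.mul_apply, hg, ih _ _ fun i s => hg i.succ s]
  let ev : C^∞⟮I, M; ℝ⟯ →+ ℝ :=
    { toFun := fun f => f x, map_zero' := rfl, map_add' := fun _ _ => rfl }
  let ev' : C^∞⟮I', M'; ℝ⟯ →+ ℝ :=
    { toFun := fun f => f x', map_zero' := rfl, map_add' := fun _ _ => rfl }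
  change ev (D.chernForm fiberTrace p (lam ∘ a)) = ev' (D'.chernForm fiberTrace p a)
  rw [D.chernForm_apply, D'.chernForm_apply, map_altSum, map_altSum]
  refine Finset.sum_congr rfl fun σ _ => ?_
  congr 1
  change (1 / 2 ^ p : ℝ) * fiberTrace _ x = (1 / 2 ^ p : ℝ) * fiberTrace _ x'
  congr 1
  exact fiberTrace_eq_of_intertwining (r := r) e he _ _ (hprod p _ _ fun i s => hR _ _ s)

end Naturality

/-! ### The faces of the simplex in barycentric coordinates. -/

section Faces

variable {k : ℕ}

/-- The barycentric coordinates of a point of `ℝ^k`. -/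
def barycentric (s : Fin k → ℝ) : Fin (k + 1) → ℝ := Fin.cons (1 - ∑ i, s i) s

/-- The affine map `ℝ^k → ℝ^(k+1)` onto the hyperplane where the `j`-th barycentric coordinate
vanishes. -/
def faceMap (j : Fin (k + 2)) (s : Fin k → ℝ) : Fin (k + 1) → ℝ :=
  fun i => (j.insertNth 0 (barycentric s) : Fin (k + 2) → ℝ) i.succ

/-- `faceMap` drops the coordinate `0`, which is recovered from the fact that barycentric
coordinates have sum `1`. -/
theorem barycentric_faceMap (j : Fin (k + 2)) (s : Fin k → ℝ) :
    barycentric (faceMap j s) = j.insertNth 0 (barycentric s) := by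
  funext i
  refine Fin.cases ?_ (fun i => rfl) i
  have h : ∑ i, (j.insertNth 0 (barycentric s) : Fin (k + 2) → ℝ) i = 1 := by
    rw [Fin.sum_univ_succAbove _ j]
    simp [barycentric, Fin.sum_univ_succ]
  rw [Fin.sum_univ_succ] at h
  simp only [barycentric, Fin.cons_zero, faceMap] at h ⊢
  linarith

/-- The linear part of `faceMap`. -/
def faceLin (j : Fin (k + 2)) : (Fin k → ℝ) →ₗ[ℝ] (Fin (k + 1) → ℝ) where
  toFun v := fun i => (j.insertNth 0 (Fin.cons (-∑ i, v i) v : Fin (k + 1) → ℝ) :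
    Fin (k + 2) → ℝ) i.succ
  map_add' v w := by
    funext i
    simp only [Pi.add_apply]
    generalize i.succ = l
    refine Fin.succAboveCases j ?_ (fun l => ?_) l
    · simp
    · refine Fin.cases ?_ (fun l => ?_) l
      · simp [Finset.sum_add_distrib, add_comm]
      · simp
  map_smul' c v := by
    funext i
    simp only [Pi.smul_apply, RingHom.id_apply]
    generalize i.succ = l
    refine Fin.succAboveCases j ?_ (fun l => ?_) l
    · simp
    · refine Fin.cases ?_ (fun l => ?_) l
      · simp [Finset.mul_sum]
      · simp

theorem faceMap_eq (j : Fin (k + 2)) (s : Fin k → ℝ) : faceMap j s = faceMap j 0 + faceLin j s := by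
  funext i
  simp only [Pi.add_apply, faceMap, faceLin, LinearMap.coe_mk, AddHom.coe_mk]
  generalize i.succ = l
  refine Fin.succAboveCases j ?_ (fun l => ?_) l
  · simp
  · refine Fin.cases ?_ (fun l => ?_) l
    · simp [barycentric, sub_eq_add_neg]
    · simp [barycentric]

theorem hasFDerivAt_faceMap (j : Fin (k + 2)) (s : Fin k → ℝ) :
    HasFDerivAt (faceMap j) (faceLin j).toContinuousLinearMap s := by
  have h : faceMap (k := k) j = fun s => faceMap j 0 + (faceLin j).toContinuousLinearMap s :=
    funext fun s => faceMap_eq j s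
  rw [h]
  exact ((faceLin j).toContinuousLinearMap.hasFDerivAt).const_add _

theorem contDiff_faceMap (j : Fin (k + 2)) : ContDiff ℝ ∞ (faceMap (k := k) j) := by
  have h : faceMap (k := k) j = fun s => faceMap j 0 + (faceLin j).toContinuousLinearMap s :=
    funext fun s => faceMap_eq j s
  rw [h]
  exact contDiff_const.add (faceLin j).toContinuousLinearMap.contDiff

/-- The face maps are exactly the parametrizations that occur in `integral_simplex_fderiv`, so no
Jacobian factors arise. -/
theorem faceMap_zero (s : Fin k → ℝ) : faceMap 0 s = Fin.cons (1 - ∑ i, s i) s := by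
  funext i
  simp [faceMap, barycentric]

theorem faceMap_succ (j : Fin (k + 1)) (s : Fin k → ℝ) : faceMap j.succ s = j.insertNth 0 s := by
  funext i
  simp [faceMap, barycentric, Fin.insertNth_succ_cons]

/-- These are the edges of the face opposite to the origin, in the form required by
`map_append_sub`. The other faces have coordinate vectors as edges. -/
theorem faceLin_zero_single (i : Fin k) :
    faceLin 0 (Pi.single i 1) = Pi.single i.succ 1 - Pi.single 0 1 := by
  funext l
  simp only [faceLin, LinearMap.coe_mk, AddHom.coe_mk, Fin.insertNth_zero', Fin.cons_succ,
    Pi.sub_apply]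
  refine Fin.cases ?_ (fun l => ?_) l
  · simp
  · simp [Pi.single_apply]

theorem faceLin_succ_single (j : Fin (k + 1)) (i : Fin k) :
    faceLin j.succ (Pi.single i 1) = Pi.single (j.succAbove i) 1 := by
  funext l
  simp only [faceLin, LinearMap.coe_mk, AddHom.coe_mk, Fin.insertNth_succ_cons, Fin.cons_succ]
  refine Fin.succAboveCases j ?_ (fun l => ?_) l
  · simp
  · simp [Pi.single_apply]

end Faces

/-! ### Restriction of the affine combination to faces. -/

section AffineFaces

variable {k : ℕ} {V : Type*} [NormedAddCommGroup V] [NormedSpace ℝ V] [FiniteDimensional ℝ V]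
  {M : Type*} [TopologicalSpace M] [ChartedSpace V M] [IsManifold 𝓘(ℝ, V) ∞ M] [T2Space M]
  {FA : Type*} [NormedAddCommGroup FA] [NormedSpace ℝ FA] [FiniteDimensional ℝ FA] {A : M → Type*}
  [TopologicalSpace (TotalSpace FA A)] [∀ x, AddCommGroup (A x)] [∀ x, Module ℝ (A x)]
  [∀ x, TopologicalSpace (A x)] [FiberBundle FA A] [VectorBundle ℝ FA A]
  [ContMDiffVectorBundle ∞ FA A 𝓘(ℝ, V)] [LieAlgebroid 𝓘(ℝ, V) FA A]
  {FE : Type*} [NormedAddCommGroup FE] [NormedSpace ℝ FE] [FiniteDimensional ℝ FE] {E : M → Type*}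
  [TopologicalSpace (TotalSpace FE E)] [∀ x, AddCommGroup (E x)] [∀ x, Module ℝ (E x)]
  [∀ x, TopologicalSpace (E x)] [FiberBundle FE E] [VectorBundle ℝ FE E]
  [ContMDiffVectorBundle ∞ FE E 𝓘(ℝ, V)]

/-- The restriction of sections of the pullback bundle along a face map. -/
def restrictFace (j : Fin (k + 2)) : PullbackSections (k + 1) V FE E →+ PullbackSections k V FE E where
  toFun S := ⟨fun p => S (faceMap j p.1, p.2),
    (contMDiff_pullback_iff (E := E) fun p => S (faceMap j p.1, p.2)).2
      (((contMDiff_pullback_iff (E := E) S).1 S.contMDiff).comp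
        (((contDiff_faceMap j).contMDiff.comp contMDiff_fst).prodMk contMDiff_snd))⟩
  map_zero' := rfl
  map_add' _ _ := rfl

theorem restrictFace_affineOp (j : Fin (k + 2))
    (D : Fin (k + 2) → RConnection (anchorHom 𝓘(ℝ, V) FA A) Cₛ^∞⟮𝓘(ℝ, V); FE, E⟯)
    (u : Fin k → ℝ) (a : Cₛ^∞⟮𝓘(ℝ, V); FA, A⟯) (S : PullbackSections (k + 1) V FE E) :
    restrictFace j (affineOp D (faceLin j u) a S) =
      affineOp (fun i => D (j.succAbove i)) u a (restrictFace j S) := by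
  ext ⟨s, x⟩
  refine (affineOp_apply D (faceLin j u) a S (faceMap j s) x).trans ((?_ : _ = _).trans
    (affineOp_apply (fun i => D (j.succAbove i)) u a (restrictFace j S) s x).symm)
  refine congrArg₂ (fun v w : E x => v + w) ?_ ?_
  -- The chain rule in the fixed fibre `E x`.
  · change fiberDeriv FE (E := E) (fun τ => S (τ, x)) (faceMap j s) (faceLin j u) =
      fiberDeriv FE (E := E) (fun τ => S (faceMap j τ, x)) s u
    simp only [fiberDeriv]
    congr 1
    have h := (differentiable_time S x (faceMap j s)).hasFDerivAt.comp s (hasFDerivAt_faceMap j s)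
    exact (congrArg (fun T : (Fin k → ℝ) →L[ℝ] FE => T u) h.fderiv).symm
  -- The weight of `D j` is zero on the face `j`, and the other weights are the barycentric
  -- coordinates of `s`.
  · have hw : ∀ i, weight V M i (faceMap j s, x) =
        (j.insertNth 0 (barycentric s) : Fin (k + 2) → ℝ) i := fun i =>
      congrFun (barycentric_faceMap j s) i
    rw [Fin.sum_univ_succAbove _ j]
    simp only [hw, Fin.insertNth_apply_same, Fin.insertNth_apply_succAbove, zero_smul, zero_add]
    rfl

/-- On a face, the Chern character form of the affine combination of `∇⁰, …, ∇ᵏ⁺¹` is the one of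
the affine combination with one connection omitted. -/
theorem chernForm_affineConnection_face (j : Fin (k + 2))
    (D : Fin (k + 2) → RConnection (anchorHom 𝓘(ℝ, V) FA A) Cₛ^∞⟮𝓘(ℝ, V); FE, E⟯) (p : ℕ)
    (a : Fin (2 * p) → (Fin k → ℝ) × Cₛ^∞⟮𝓘(ℝ, V); FA, A⟯) (s : Fin k → ℝ) (x : M) :
    (affineConnection D).chernForm fiberTrace p (fun i => (faceLin j (a i).1, (a i).2))
      (faceMap j s, x) =
    (affineConnection fun i => D (j.succAbove i)).chernForm fiberTrace p a (s, x) := by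
  refine chernForm_eq_of_intertwining (affineConnection D)
    (affineConnection fun i => D (j.succAbove i)) (fun b => (faceLin j b.1, b.2)) (fun b c => ?_)
    (restrictFace j) (fun b S => restrictFace_affineOp j D b.1 b.2 S)
    (x := (faceMap j s, x)) (x' := (s, x)) (LinearEquiv.refl ℝ (E x)) (fun S => rfl) p a
  exact Prod.ext (map_zero (faceLin j)) rfl

/-- For `k = 0` the cylinder is a copy of `M` and the only weight is `1`. Restriction to `t = 0`
intertwines the connections. -/
theorem chernForm_affineConnection_zero
    (D : Fin 1 → RConnection (anchorHom 𝓘(ℝ, V) FA A) Cₛ^∞⟮𝓘(ℝ, V); FE, E⟯) (p : ℕ)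
    (a : Fin (2 * p) → Cₛ^∞⟮𝓘(ℝ, V); FA, A⟯) (x : M) :
    (affineConnection (k := 0) D).chernForm fiberTrace p (fun i => (0, a i)) (0, x) =
      (D 0).chernForm fiberTrace p a x := by
  let r : PullbackSections 0 V FE E →+ Cₛ^∞⟮𝓘(ℝ, V); FE, E⟯ :=
    { toFun := fun S => sliceSection S 0, map_zero' := rfl, map_add' := fun _ _ => rfl }
  refine chernForm_eq_of_intertwining (affineConnection (k := 0) D) (D 0)
    (fun b => (0, b)) (fun b c => ?_) r (fun b S => ?_)
    (x := ((0 : Fin 0 → ℝ), x)) (x' := x) (LinearEquiv.refl ℝ (E x)) (fun S => rfl) p a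
  · exact Prod.ext rfl rfl
  · ext y
    refine (affineOp_apply D 0 b S 0 y).trans ?_
    have h : (sliceSection (timeDeriv 0 S) 0 y : E y) = 0 := by
      change fiberDeriv FE (E := E) (fun τ => S (τ, y)) 0 0 = 0
      simp only [fiberDeriv]
      exact (congrArg _ (map_zero _)).trans (map_zero _)
    have hw : weight V M (0 : Fin 1) ((0 : Fin 0 → ℝ), y) = 1 :=
      (Fin.sum_univ_one _).symm.trans (sum_weight (V := V) (k := 0) 0 y)
    rw [h, zero_add, Fin.sum_univ_one, hw, one_smul]
    rfl

end AffineFaces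

/-! ### The Chern–Simons formula. -/

section ChernSimonsFormula

open MeasureTheory

variable {V : Type*} [NormedAddCommGroup V] [NormedSpace ℝ V] [FiniteDimensional ℝ V]
  {M : Type*} [TopologicalSpace M] [ChartedSpace V M] [IsManifold 𝓘(ℝ, V) ∞ M] [T2Space M]
  {FA : Type*} [NormedAddCommGroup FA] [NormedSpace ℝ FA] [FiniteDimensional ℝ FA] {A : M → Type*}
  [TopologicalSpace (TotalSpace FA A)] [∀ x, AddCommGroup (A x)] [∀ x, Module ℝ (A x)]
  [∀ x, TopologicalSpace (A x)] [FiberBundle FA A] [VectorBundle ℝ FA A]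
  [ContMDiffVectorBundle ∞ FA A 𝓘(ℝ, V)] [LieAlgebroid 𝓘(ℝ, V) FA A]
  {FE : Type*} [NormedAddCommGroup FE] [NormedSpace ℝ FE] [FiniteDimensional ℝ FE] {E : M → Type*}
  [TopologicalSpace (TotalSpace FE E)] [∀ x, AddCommGroup (E x)] [∀ x, Module ℝ (E x)]
  [∀ x, TopologicalSpace (E x)] [FiberBundle FE E] [VectorBundle ℝ FE E]
  [ContMDiffVectorBundle ∞ FE E 𝓘(ℝ, V)]

/-- The sections `∂/∂t_1, ..., ∂/∂t_k, a_1, ..., a_m` of `Tℝ^k × A`. -/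
def timeTuple {L : Type*} [AddCommGroup L] (k : ℕ) {m : ℕ} (a : Fin m → L) :
    Fin (k + m) → (Fin k → ℝ) × L :=
  Fin.append (fun j => (Pi.single j 1, 0)) (fun i => (0, a i))

/-- Brings the case `k = 0`, defined separately, under the integral formula, since faces of the
`1`-simplex are points. -/
theorem chernSimons_apply (p k m : ℕ) (h : k + m = 2 * p)
    (D : Fin (k + 1) → RConnection (anchorHom 𝓘(ℝ, V) FA A) Cₛ^∞⟮𝓘(ℝ, V); FE, E⟯)
    (a : Fin m → Cₛ^∞⟮𝓘(ℝ, V); FA, A⟯) (x : M) :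
    chernSimons p k m h D a x = ∫ t in simplex k,
      (affineConnection D).chernForm fiberTrace p (timeTuple k a ∘ Fin.cast h.symm) (t, x) := by
  cases k with
  | zero =>
    have hs : simplex 0 = Set.univ := by
      ext t
      simp [simplex]
    have hv : (volume : Measure (Fin 0 → ℝ)).real Set.univ = 1 := by
      simp [Measure.real, volume_pi]
    -- The `0`-simplex is a single point of measure `1`.
    have hint : ∀ f : (Fin 0 → ℝ) → ℝ, ∫ t in simplex 0, f t = f 0 := fun f => by
      rw [hs, Measure.restrict_univ, integral_unique, hv, one_smul]
      exact congrArg f (Subsingleton.elim _ _)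
    have h1 : timeTuple 0 a ∘ Fin.cast h.symm =
        fun i => (0, a (Fin.cast (h.symm.trans (zero_add m)) i)) := by
      funext i
      have h2 : Fin.cast h.symm i = Fin.natAdd 0 (Fin.cast (h.symm.trans (zero_add m)) i) := by
        ext
        simp
      rw [Function.comp_apply, h2, timeTuple, Fin.append_right]
    rw [hint, h1, chernForm_affineConnection_zero]
    rfl
  | succ k => rfl

/-- The inclusion of the Lie algebra of sections of `A` in the one of sections of `Tℝ^k × A`. -/
def inrLieHom (k : ℕ) (L : Type*) [LieRing L] [LieAlgebra ℝ L] : L →ₗ⁅ℝ⁆ (Fin k → ℝ) × L where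
  toLinearMap := LinearMap.inr ℝ (Fin k → ℝ) L
  map_lie' := rfl

/-- Naturality of the differential for integration over the simplex; the hypothesis on anchors is
differentiation under the integral. -/
theorem differential_fiberIntegral {k m : ℕ}
    (η : ((Fin k → ℝ) × Cₛ^∞⟮𝓘(ℝ, V); FA, A⟯) [⋀^Fin (k + m)]→ₗ[ℝ]
      C^∞⟮𝓘(ℝ, Fin k → ℝ).prod 𝓘(ℝ, V), (Fin k → ℝ) × M; ℝ⟯)
    (a : Fin (m + 1) → Cₛ^∞⟮𝓘(ℝ, V); FA, A⟯) :
    differential (anchorHom 𝓘(ℝ, V) FA A) (fiberIntegral η) a =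
      integrateSimplex (differential (prodAnchorHom (V := V) k FA A)
        (interior (fun j => (Pi.single j 1, 0)) η) fun i => (0, a i)) := by
  refine differential_naturality (prodAnchorHom (V := V) k FA A) (anchorHom 𝓘(ℝ, V) FA A)
    (inrLieHom k _) integrateSimplex (fun b f => ?_) _ _ (fun v => ?_) a
  · exact (vectorFieldDerivation_integrateSimplex _ f).symm
  · rw [interior_apply]
    rfl

theorem integrateSimplex_timeDerivative {k : ℕ} (j : Fin (k + 1))
    (f : C^∞⟮𝓘(ℝ, Fin (k + 1) → ℝ).prod 𝓘(ℝ, V), (Fin (k + 1) → ℝ) × M; ℝ⟯) (x : M) :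
    integrateSimplex (prodAnchorHom (V := V) (k + 1) FA A (Pi.single j 1, 0) f) x =
      (∫ s in simplex k, f (faceMap 0 s, x)) - ∫ s in simplex k, f (faceMap j.succ s, x) := by
  simp only [faceMap_zero, faceMap_succ]
  rw [← integral_simplex_fderiv j (smooth_time f x)]
  change ∫ t in simplex (k + 1), vectorFieldDerivation (prodVectorField (Pi.single j 1)
    ((LieAlgebroid.anchor (I := 𝓘(ℝ, V)) (F := FA) (A := A)).onSections 0)) f (t, x) = _
  rw [map_zero]
  simp only [prodVectorField_zero_right]

theorem integrableOn_simplex_face {k : ℕ} (j : Fin (k + 2))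
    (f : C^∞⟮𝓘(ℝ, Fin (k + 1) → ℝ).prod 𝓘(ℝ, V), (Fin (k + 1) → ℝ) × M; ℝ⟯) (x : M) :
    IntegrableOn (fun s => f (faceMap j s, x)) (simplex k) :=
  ((smooth_time f x).continuous.comp (contDiff_faceMap j).continuous).continuousOn
    |>.integrableOn_compact (isCompact_simplex k)

/-- Expresses all the terms on the right of the formula through one form, that of the full affine
combination, evaluated on the tangent vectors of the faces. -/
theorem chernSimons_face_apply (p k m : ℕ) (h : k + m = 2 * p)
    (D : Fin (k + 2) → RConnection (anchorHom 𝓘(ℝ, V) FA A) Cₛ^∞⟮𝓘(ℝ, V); FE, E⟯) (j : Fin (k + 2))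
    (a : Fin m → Cₛ^∞⟮𝓘(ℝ, V); FA, A⟯) (x : M) :
    chernSimons p k m h (fun i => D (j.succAbove i)) a x = ∫ s in simplex k,
      (affineConnection D).chernForm fiberTrace p
        ((Fin.append (fun i => (faceLin j (Pi.single i 1), 0)) (fun i => (0, a i)) :
          Fin (k + m) → (Fin (k + 1) → ℝ) × Cₛ^∞⟮𝓘(ℝ, V); FA, A⟯) ∘ Fin.cast h.symm)
        (faceMap j s, x) := by
  rw [chernSimons_apply]
  congr 1
  funext s
  rw [← chernForm_affineConnection_face]
  congr 2
  funext i
  simp only [Function.comp_apply]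
  generalize Fin.cast h.symm i = l
  refine Fin.addCases (fun l => ?_) (fun l => ?_) l
  · simp [timeTuple]
  · simp [timeTuple]

theorem neg_one_pow_zsmul {N : Type*} [AddCommGroup N] [Module ℝ N] (k : ℕ) (y : N) :
    (-1 : ℤ) ^ k • y = (-1 : ℝ) ^ k • y := by
  rw [← Int.cast_smul_eq_zsmul ℝ]
  simp

/-- The Chern-Simons formula. -/
theorem differential_chernSimons (p k m : ℕ) (h : (k + 1) + m = 2 * p)
    (h' : k + (m + 1) = 2 * p)
    (D : Fin (k + 2) → RConnection (anchorHom 𝓘(ℝ, V) FA A) Cₛ^∞⟮𝓘(ℝ, V); FE, E⟯) :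
    (-1 : ℝ) ^ ((k + 1) + 1) •
        differential (anchorHom 𝓘(ℝ, V) FA A) (chernSimons p (k + 1) m h D) =
      ∑ j : Fin (k + 2), (-1 : ℝ) ^ (j : ℕ) •
        chernSimons p k (m + 1) h' (fun i => D (j.succAbove i)) := by
  set θ := (affineConnection D).chernForm fiberTrace p with hθ
  set η := AlternatingMap.domDomCongr (finCongr h.symm) θ with hη
  ext a x
  let u : Fin (k + 1) → (Fin (k + 1) → ℝ) × Cₛ^∞⟮𝓘(ℝ, V); FA, A⟯ := fun j => (Pi.single j 1, 0)
  let b : Fin (m + 1) → (Fin (k + 1) → ℝ) × Cₛ^∞⟮𝓘(ℝ, V); FA, A⟯ := fun i => (0, a i)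
  -- `c j` is the form with the `j`-th time direction omitted, the function that gets differentiated
  -- in that direction.
  let c : Fin (k + 1) → C^∞⟮𝓘(ℝ, Fin (k + 1) → ℝ).prod 𝓘(ℝ, V), (Fin (k + 1) → ℝ) × M; ℝ⟯ :=
    fun j => η ((Fin.castAdd (m + 1) j : Fin (k + 1 + m + 1)).removeNth
      (Fin.append (m := k + 1) (n := m + 1) u b))
  have hclosed : differential (prodAnchorHom (V := V) (k + 1) FA A) η = 0 := by
    ext1 v
    rw [hη, differential_domDomCongr, hθ, differential_chernForm_affineConnection]
    rfl
  have hcartan := differential_append (prodAnchorHom (V := V) (k + 1) FA A) u η b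
    (fun i j => Prod.ext rfl (lie_self _)) (fun i j => Prod.ext rfl (zero_lie _))
  rw [hclosed, AlternatingMap.zero_apply] at hcartan
  simp only [neg_one_pow_zsmul] at hcartan
  -- Closedness makes the two parts of Cartan's formula opposite; the sign is absorbed by raising
  -- the exponent `k + 1` by one.
  have hleft : (-1 : ℝ) ^ ((k + 1) + 1) •
      differential (prodAnchorHom (V := V) (k + 1) FA A) (interior u η) b =
      ∑ j : Fin (k + 1), (-1 : ℝ) ^ (j : ℕ) • prodAnchorHom (V := V) (k + 1) FA A (u j) (c j) := by
    rw [pow_succ, mul_neg_one, neg_smul]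
    exact (eq_neg_of_add_eq_zero_left hcartan.symm).symm
  have hzero : ∀ v : Fin (2 * p) → (Fin (k + 1) → ℝ) × Cₛ^∞⟮𝓘(ℝ, V); FA, A⟯,
      ∀ w, v = w ∘ Fin.cast h.symm → θ v = η w := fun v w hvw => by
    rw [hvw]
    rfl
  have hface_succ : ∀ j : Fin (k + 1),
      chernSimons p k (m + 1) h' (fun i => D (j.succ.succAbove i)) a x =
        ∫ s in simplex k, c j (faceMap j.succ s, x) := by
    intro j
    rw [chernSimons_face_apply]
    congr 1
    funext s
    congr 1
    refine hzero _ _ ?_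
    rw [removeNth_castAdd_append]
    simp only [faceLin_succ_single]
    rfl
  have hface_zero : chernSimons p k (m + 1) h' (fun i => D ((0 : Fin (k + 2)).succAbove i))
      a x = ∑ j : Fin (k + 1), (-1 : ℝ) ^ (j : ℕ) * ∫ s in simplex k, c j (faceMap 0 s, x) := by
    rw [chernSimons_face_apply]
    -- The sum of the time components is `1` on every `∂/∂t_j` and `0` on sections of `A`. It lets
    -- `map_append_sub` combine all the `c j` into the value on the edges of the face.
    let φ : (Fin (k + 1) → ℝ) × Cₛ^∞⟮𝓘(ℝ, V); FA, A⟯ →ₗ[ℝ] ℝ :=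
      (∑ i, LinearMap.proj i) ∘ₗ LinearMap.fst ℝ _ _
    have hsub := map_append_sub η φ u b (fun i => by simp [φ, u]) (fun i => by simp [φ, b])
    have hfun : ∀ s : Fin k → ℝ, (∑ j : Fin (k + 1), (-1 : ℤ) ^ (j : ℕ) • c j) (faceMap 0 s, x) =
        ∑ j : Fin (k + 1), (-1 : ℝ) ^ (j : ℕ) * c j (faceMap 0 s, x) := by
      intro s
      rw [sum_fun_apply]
      simp only [neg_one_pow_zsmul]
      rfl
    simp only [← integral_const_mul]
    rw [← integral_finsetSum _ fun j _ => (integrableOn_simplex_face 0 (c j) x).const_mul _]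
    congr 1
    funext s
    rw [← hfun, ← hsub]
    congr 1
    refine hzero _ _ ?_
    simp only [faceLin_zero_single]
    have h1 : (fun i : Fin k => u i.succ - u 0) =
        fun i => ((Pi.single i.succ 1 - Pi.single 0 1 : Fin (k + 1) → ℝ), 0) := by
      funext i
      exact Prod.ext rfl (sub_zero _)
    rw [h1]
    rfl
  calc _ = integrateSimplex ((-1 : ℝ) ^ ((k + 1) + 1) •
        differential (prodAnchorHom (V := V) (k + 1) FA A) (interior u η) b) x := by
        rw [map_smul, ← differential_fiberIntegral]
        rfl
    _ = ∑ j : Fin (k + 1), (-1 : ℝ) ^ (j : ℕ) *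
        ((∫ s in simplex k, c j (faceMap 0 s, x)) - ∫ s in simplex k, c j (faceMap j.succ s, x)) := by
        rw [hleft, map_sum, sum_fun_apply]
        refine Finset.sum_congr rfl fun j _ => ?_
        rw [map_smul, ← integrateSimplex_timeDerivative (FA := FA) (A := A)]
        rfl
    -- The integrals over the opposite face add up to the term `j = 0`. The face `t_j = 0` gives the
    -- term `j.succ`, and this shift of index accounts for its minus sign.
    _ = ∑ j : Fin (k + 2), (-1 : ℝ) ^ (j : ℕ) *
        chernSimons p k (m + 1) h' (fun i => D (j.succAbove i)) a x := by
        rw [Fin.sum_univ_succ (n := k + 1), hface_zero]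
        simp only [hface_succ, mul_sub]
        rw [Finset.sum_sub_distrib, sub_eq_add_neg, ← Finset.sum_neg_distrib]
        simp only [Fin.val_zero, pow_zero, one_mul, Fin.val_succ, pow_succ, mul_neg_one, neg_mul]
    _ = _ := by
        let ev : Cₛ^∞⟮𝓘(ℝ, V); FA, A⟯ [⋀^Fin (m + 1)]→ₗ[ℝ] C^∞⟮𝓘(ℝ, V), M; ℝ⟯ →+ ℝ :=
          { toFun := fun ξ => ξ a x, map_zero' := rfl, map_add' := fun _ _ => rfl }
        exact (map_sum ev (fun j : Fin (k + 2) => (-1 : ℝ) ^ (j : ℕ) •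
          chernSimons p k (m + 1) h' (fun i => D (j.succAbove i))) Finset.univ).symm

end ChernSimonsFormula

end LieAlgebroidCS

end

theorem mainTheorem1
    {V : Type*} [NormedAddCommGroup V] [NormedSpace ℝ V] [FiniteDimensional ℝ V]
    {M : Type*} [TopologicalSpace M] [ChartedSpace V M] [IsManifold 𝓘(ℝ, V) ∞ M] [T2Space M]
    {FA : Type*} [NormedAddCommGroup FA] [NormedSpace ℝ FA] [FiniteDimensional ℝ FA]
    {A : M → Type*} [TopologicalSpace (TotalSpace FA A)] [∀ x, AddCommGroup (A x)]
    [∀ x, Module ℝ (A x)] [∀ x, TopologicalSpace (A x)] [FiberBundle FA A] [VectorBundle ℝ FA A]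
    [ContMDiffVectorBundle ∞ FA A 𝓘(ℝ, V)] [LieAlgebroid 𝓘(ℝ, V) FA A]
    {FE : Type*} [NormedAddCommGroup FE] [NormedSpace ℝ FE] [FiniteDimensional ℝ FE]
    {E : M → Type*} [TopologicalSpace (TotalSpace FE E)] [∀ x, AddCommGroup (E x)]
    [∀ x, Module ℝ (E x)] [∀ x, TopologicalSpace (E x)] [FiberBundle FE E] [VectorBundle ℝ FE E]
    [ContMDiffVectorBundle ∞ FE E 𝓘(ℝ, V)] :
    -- the formula for `0 < k + 1 ≤ 2 p`, with `m = 2 p - (k + 1)` the degree of the form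
    (∀ (p k m : ℕ) (h : (k + 1) + m = 2 * p)
      (D : Fin (k + 2) → RConnection (anchorHom 𝓘(ℝ, V) FA A) Cₛ^∞⟮𝓘(ℝ, V); FE, E⟯),
      (-1 : ℝ) ^ ((k + 1) + 1) •
          differential (anchorHom 𝓘(ℝ, V) FA A) (chernSimons p (k + 1) m h D) =
        ∑ j : Fin (k + 2), (-1 : ℝ) ^ (j : ℕ) •
          chernSimons p k (m + 1) (by omega) (fun i => D (j.succAbove i))) ∧
    (∀ (p : ℕ), 1 ≤ p →
      ∀ D : RConnection (anchorHom 𝓘(ℝ, V) FA A) Cₛ^∞⟮𝓘(ℝ, V); FE, E⟯,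
        differential (anchorHom 𝓘(ℝ, V) FA A) (D.chernForm fiberTrace p) = 0) :=
  ⟨fun p k m h D => differential_chernSimons p k m h _ D, fun p _ D => differential_chernForm_fiberTrace D p⟩
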